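/- Let $\chi\in C^\infty(\mathbb R)$ be a partition function: $\chi=0$ on $(-\infty,0]$, $\chi=1$ on $[1,\infty)$, $\chi'\ge 0$. Let $V$ be the Banach space of bounded continuous functions $f$ on $\mathbb R$ with weak derivative $f_\xi\in L^2(\mathbb R)$, with norm $\|f\|_{L^\infty}+\|f_\xi\|_{L^2}$. Let $H_{0,\infty}(\mathbb R)=\{u+c\chi : u\in H^1(\mathbb R),\ c\in\mathbb R\}$ with norm $\|u+c\chi\|=\|u\|_{H^1}+|c|$, and let $E=V\times H_{0,\infty}(\mathbb R)\times L^2(\mathbb R)$. For $X=(\zeta,U,h)\in E$, let $y(\xi)=\xi+\zeta(\xi)$, let $c$ be the coefficient of $\chi$ in $U$, and let $\bar U=U-c\,\chi\circ y$. Put $$g(x)=\chi^2(x)+\tfrac12\int_{\mathbb R}e^{-|x-z|}\bigl(2\chi'^2+2\chi\chi''\bigr)(z)\,dz,\qquad k_y(\xi,\eta)=e^{-\operatorname{sgn}(\xi-\eta)(y(\xi)-y(\eta))},$$ $$P(\xi)=\tfrac14\int_{\mathbb R}k_y(\xi,\eta)\bigl((2\bar U^2+4c\,\bar U\,\chi\circ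 y)\,y_\xi+h\bigr)(\eta)\,d\eta+c^2\,g(y(\xi)),$$ $$Q(\xi)=-\tfrac14\int_{\mathbb R}\operatorname{sgn}(\xi-\eta)\,k_y(\xi,\eta)\bigl((2\bar U^2+4c\,\bar U\,\chi\circ y)\,y_\xi+h\bigr)(\eta)\,d\eta+c^2\,g'(y(\xi)).$$ When $y$ is nondecreasing, $k_y(\xi,\eta)=e^{-|y(\xi)-y(\eta)|}$. Consider the system $$y_t=U,\qquad U_t=-Q,\qquad h_t=2(U^2-P)U_\xi. \tag{1}$$ Let $\mathcal G$ be the set of all $(\zeta,U,h)\in E$ such that $\zeta,U\in W^{1,\infty}(\mathbb R)$, $h\in L^\infty(\mathbb R)$, and, almost everywhere, $y_\xi\ge0$, $h\ge0$, $y_\xi+h>0$ and $y_\xi h=U_\xi^2$. Theorem. For every $X_0\in\mathcal G$ the system (1) has a unique global solution $X=(\zeta,U,h)\in C^1([0,\infty),E)$ with $X(0)=X_0$ (unique among all solutions in $C^1([0,\infty),E)$), and $X(t)\in\mathcal G$ for all $t\ge0$. If $\mathcal G$ carries the topology induced by the $E$-norm, then the map $S:\mathcal G\times[0,\infty)\to\mathcal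 G$, $S_t(X_0)=X(t)$, is a continuous semigroup: $S_0=\mathrm{id}$, $S_{s+t}=S_s\circ S_t$ for $s,t\ge0$, and $S$ is continuous on $\mathcal G\times[0,\infty)$. -/

import Mathlib

open MeasureTheory Set
open scoped ContDiff BoundedContinuousFunction

noncomputable section

namespace CamassaHolm

/-- A partition function: smooth, nondecreasing, `0` on `(-∞, 0]` and `1` on `[1, ∞)`. -/
structure IsPartitionFunction (χ : ℝ → ℝ) : Prop where
  smooth : ContDiff ℝ ∞ χ
  eq_zero : ∀ x ≤ 0, χ x = 0
  eq_one : ∀ x, 1 ≤ x → χ x = 1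
  deriv_nonneg : ∀ x, 0 ≤ deriv χ x

/-! ### Weak derivatives and function spaces -/

/-- `g` is the weak (distributional) derivative of `f` on the real line. -/
def HasWeakDeriv (f g : ℝ → ℝ) : Prop :=
  LocallyIntegrable f ∧ LocallyIntegrable g ∧
    ∀ φ : ℝ → ℝ, ContDiff ℝ ∞ φ → HasCompactSupport φ →
      ∫ x, f x * deriv φ x = -∫ x, g x * φ x

theorem HasWeakDeriv.congr {f f' g g' : ℝ → ℝ} (h : HasWeakDeriv f g)
    (hf : f =ᵐ[volume] f') (hg : g =ᵐ[volume] g') : HasWeakDeriv f' g' := by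
  obtain ⟨h1, h2, h3⟩ := h
  have aux : ∀ {u v : ℝ → ℝ}, LocallyIntegrable u → u =ᵐ[volume] v → LocallyIntegrable v := by
    intro u v hu huv x
    obtain ⟨s, hs, hi⟩ := hu x
    exact ⟨s, hs, hi.congr (ae_restrict_of_ae huv)⟩
  refine ⟨aux h1 hf, aux h2 hg, fun φ hφ hc => ?_⟩
  have e1 : ∫ x, f' x * deriv φ x = ∫ x, f x * deriv φ x :=
    integral_congr_ae (by filter_upwards [hf] with x hx; rw [hx])
  have e2 : ∫ x, g' x * φ x = ∫ x, g x * φ x :=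
    integral_congr_ae (by filter_upwards [hg] with x hx; rw [hx])
  rw [e1, e2, h3 φ hφ hc]

theorem HasWeakDeriv.add {f f' g g' : ℝ → ℝ} (h : HasWeakDeriv f g) (h' : HasWeakDeriv f' g') :
    HasWeakDeriv (f + f') (g + g') := by
  obtain ⟨h1, h2, h3⟩ := h
  obtain ⟨k1, k2, k3⟩ := h'
  refine ⟨h1.add k1, h2.add k2, fun φ hφ hc => ?_⟩
  have cφ : Continuous φ := hφ.continuous
  have cd : Continuous (deriv φ) := hφ.continuous_deriv (by simp)
  have i : ∀ {u v : ℝ → ℝ}, LocallyIntegrable u → Continuous v → HasCompactSupport v →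
      Integrable (fun x => u x * v x) := by
    intro u v hu hv hvc
    simpa [smul_eq_mul] using hu.integrable_smul_right_of_hasCompactSupport hv hvc
  simp only [Pi.add_apply, add_mul]
  rw [integral_add (i h1 cd hc.deriv) (i k1 cd hc.deriv), integral_add (i h2 cφ hc) (i k2 cφ hc),
    h3 φ hφ hc, k3 φ hφ hc, neg_add]

theorem HasWeakDeriv.const_smul {f g : ℝ → ℝ} (c : ℝ) (h : HasWeakDeriv f g) :
    HasWeakDeriv (c • f) (c • g) := by
  obtain ⟨h1, h2, h3⟩ := h
  refine ⟨h1.smul c, h2.smul c, fun φ hφ hc => ?_⟩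
  simp only [Pi.smul_apply, smul_eq_mul, mul_assoc, integral_const_mul]
  rw [h3 φ hφ hc, mul_neg]

theorem hasWeakDeriv_zero : HasWeakDeriv 0 0 :=
  ⟨locallyIntegrable_zero, locallyIntegrable_zero, fun φ _ _ => by simp⟩

/-- `L²(ℝ)`. -/
abbrev L2 : Type := Lp ℝ 2 (volume : Measure ℝ)

/-- `H¹(ℝ)`, as the space of pairs `(f, f_ξ)` in `L² × L²`; the inherited norm is
`(‖f‖² + ‖f_ξ‖²)^(1/2)`. -/
def H1Submodule : Submodule ℝ (WithLp 2 (L2 × L2)) where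
  carrier := {p | HasWeakDeriv p.fst p.snd}
  zero_mem' := hasWeakDeriv_zero.congr (Lp.coeFn_zero _ _ _).symm (Lp.coeFn_zero _ _ _).symm
  add_mem' {p q} hp hq :=
    (HasWeakDeriv.add hp hq).congr (Lp.coeFn_add p.fst q.fst).symm (Lp.coeFn_add p.snd q.snd).symm
  smul_mem' c p hp :=
    (HasWeakDeriv.const_smul c hp).congr (Lp.coeFn_smul c p.fst).symm (Lp.coeFn_smul c p.snd).symm

abbrev H1 : Type := H1Submodule

/-- `V`, the bounded continuous functions with weak derivative in `L²`, as the space of pairs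
`(f, f_ξ)`; the inherited norm is `‖f‖_{L^∞} + ‖f_ξ‖_{L²}`. -/
def VSubmodule : Submodule ℝ (WithLp 1 ((ℝ →ᵇ ℝ) × L2)) where
  carrier := {p | HasWeakDeriv p.fst p.snd}
  zero_mem' := hasWeakDeriv_zero.congr (Filter.EventuallyEq.refl _ _) (Lp.coeFn_zero _ _ _).symm
  add_mem' {p q} hp hq :=
    (HasWeakDeriv.add hp hq).congr (Filter.EventuallyEq.refl _ _) (Lp.coeFn_add p.snd q.snd).symm
  smul_mem' c p hp :=
    (HasWeakDeriv.const_smul c hp).congr (Filter.EventuallyEq.refl _ _)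
      (Lp.coeFn_smul c p.snd).symm

abbrev V : Type := VSubmodule

/-- `H_{0,∞}(ℝ)`: the pair `(u, c)` stands for the function `u + c χ`, see `HInf.val`; the norm
is `‖u‖_{H¹} + |c|`. -/
abbrev HInf : Type := WithLp 1 (H1 × ℝ)

/-- The function `u + c χ` represented by an element of `H_{0,∞}`. -/
def HInf.val (χ : ℝ → ℝ) (U : HInf) (ξ : ℝ) : ℝ := U.fst.1.fst ξ + U.snd * χ ξ

/-- The weak derivative `u_ξ + c χ'` of the function represented by an element of `H_{0,∞}`. -/
def HInf.weakDeriv (χ : ℝ → ℝ) (U : HInf) (ξ : ℝ) : ℝ := U.fst.1.snd ξ + U.snd * deriv χ ξ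

/-- `E = V × H_{0,∞} × L²`, the Banach space of states `X = (ζ, U, h)`. -/
abbrev E : Type := V × HInf × L2

namespace E

variable (χ : ℝ → ℝ) (X : E)

/-- `ζ`. -/
def zeta (ξ : ℝ) : ℝ := X.1.1.fst ξ

/-- `ζ_ξ`. -/
def zetaDeriv (ξ : ℝ) : ℝ := X.1.1.snd ξ

/-- `y = id + ζ`. -/
def y (ξ : ℝ) : ℝ := ξ + X.zeta ξ

/-- `y_ξ = 1 + ζ_ξ`. -/
def yDeriv (ξ : ℝ) : ℝ := 1 + X.zetaDeriv ξ

/-- `U`. -/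
def U (ξ : ℝ) : ℝ := X.2.1.val χ ξ

/-- `U_ξ`. -/
def UDeriv (ξ : ℝ) : ℝ := X.2.1.weakDeriv χ ξ

/-- The asymptotic value `c` of `U` at `+∞`. -/
def c : ℝ := X.2.1.snd

/-- `h`. -/
def h (ξ : ℝ) : ℝ := X.2.2 ξ

/-- `Ū = U - c χ ∘ y`. -/
def Ubar (ξ : ℝ) : ℝ := X.U χ ξ - X.c * χ (X.y ξ)

end E

/-! ### The nonlocal terms and the system -/

/-- `g(x) = χ²(x) + ½ ∫ e^{-|x-z|} (2 χ'² + 2 χ χ'')(z) dz`. -/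
def g (χ : ℝ → ℝ) (x : ℝ) : ℝ :=
  χ x ^ 2 + 1 / 2 * ∫ z, Real.exp (-|x - z|) *
    (2 * deriv χ z ^ 2 + 2 * χ z * deriv (deriv χ) z)

/-- The kernel `e^{-sgn(ξ-η)(y(ξ)-y(η))}`. -/
def kernel (y : ℝ → ℝ) (ξ η : ℝ) : ℝ := Real.exp (-(Real.sign (ξ - η) * (y ξ - y η)))

/-- For nondecreasing `y` the kernel is `e^{-|y(ξ)-y(η)|}`. -/
theorem kernel_eq_of_monotone {y : ℝ → ℝ} (hy : Monotone y) (ξ η : ℝ) :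
    kernel y ξ η = Real.exp (-|y ξ - y η|) := by
  unfold kernel
  rcases lt_trichotomy ξ η with h | h | h
  · rw [Real.sign_of_neg (by linarith), abs_of_nonpos (by linarith [hy h.le])]
    ring_nf
  · subst h; simp
  · rw [Real.sign_of_pos (by linarith), abs_of_nonneg (by linarith [hy h.le])]
    ring_nf

namespace E

variable (χ : ℝ → ℝ) (X : E)

/-- The density `(2 Ū² + 4 c Ū χ∘y) y_ξ + h`. -/
def density (η : ℝ) : ℝ :=
  (2 * X.Ubar χ η ^ 2 + 4 * X.c * X.Ubar χ η * χ (X.y η)) * X.yDeriv η + X.h η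

/-- `P(ξ)`. -/
def P (ξ : ℝ) : ℝ :=
  1 / 4 * (∫ η, kernel X.y ξ η * X.density χ η) + X.c ^ 2 * g χ (X.y ξ)

/-- `Q(ξ)`. -/
def Q (ξ : ℝ) : ℝ :=
  -(1 / 4) * (∫ η, Real.sign (ξ - η) * kernel X.y ξ η * X.density χ η) +
    X.c ^ 2 * deriv (g χ) (X.y ξ)

end E

/-- The velocity `X'` (an element of `E`) is given by the right-hand side of the system
`y_t = U`, `U_t = -Q`, `h_t = 2 (U² - P) U_ξ` at the state `X`. Since `y = id + ζ`, `y_t` is the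
first component of the velocity. -/
def IsVelocity (χ : ℝ → ℝ) (X X' : E) : Prop :=
  (∀ᵐ ξ, X'.zeta ξ = X.U χ ξ) ∧
  (∀ᵐ ξ, X'.U χ ξ = -X.Q χ ξ) ∧
  (∀ᵐ ξ, X'.h ξ = 2 * (X.U χ ξ ^ 2 - X.P χ ξ) * X.UDeriv χ ξ)

/-- `X ∈ C¹([0,∞), E)` solves the system; the values of `X` at negative times are irrelevant. -/
def IsGlobalSolution (χ : ℝ → ℝ) (X : ℝ → E) : Prop :=
  ContDiffOn ℝ 1 X (Ici 0) ∧ ∀ t ∈ Ici (0 : ℝ), IsVelocity χ (X t) (derivWithin X (Ici 0) t)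

/-- The set `𝒢`. -/
def setG (χ : ℝ → ℝ) : Set E :=
  {X | (MemLp X.zeta ⊤ ∧ MemLp X.zetaDeriv ⊤) ∧ (MemLp (X.U χ) ⊤ ∧ MemLp (X.UDeriv χ) ⊤) ∧
    MemLp X.h ⊤ ∧
    (∀ᵐ ξ, 0 ≤ X.yDeriv ξ) ∧ (∀ᵐ ξ, 0 ≤ X.h ξ) ∧ (∀ᵐ ξ, 0 < X.yDeriv ξ + X.h ξ) ∧
    ∀ᵐ ξ, X.yDeriv ξ * X.h ξ = X.UDeriv χ ξ ^ 2}

end CamassaHolm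

end

/-! In these Lagrangian variables the equation is an autonomous ordinary differential equation `X' =
F(X)` in the Banach space `E`, where `F` (`field`) is Lipschitz on bounded sets (`lipBdd_field`).
The reason is the factorization e^{-(y(ξ)-y(η))} = e^{-ζ(ξ)} e^{-(ξ-η)} e^{ζ(η)}: the nonlocal terms
are fixed one-sided exponential convolutions placed between multiplications by e^{±ζ}, and
everything else is a product or a superposition operator in ζ. The terms with χ∘y - χ, g'∘y and
g''∘y lie in L² because χ', g' and g'' decay like e^{-|x|} and the displacement ζ is bounded.
Picard-Lindelöf gives local solutions and Gronwall gives uniqueness; `isVelocity_iff` identifies the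
pointwise system with `X' = F(X)`.

Invariance of 𝒢. Differentiation in ξ gives y_ξt = U_ξ, U_ξt = h/2 + (U² - P) y_ξ, h_t = 2 (U² - P)
U_ξ. This is the symmetric square of the planar linear system α' = β/2, β' = (U² - P) α, with (y_ξ,
U_ξ, h) in the role of (α², αβ, β²). The flow therefore acts on (y_ξ, U_ξ, h), read as a quadratic
form at each ξ, by substitution of a matrix of determinant 1 with bounded continuous entries
(`exists_quadratic`). Such a substitution keeps the coefficients in L^∞ and preserves the cone of
nonzero nonnegative degenerate forms, which is the pointwise condition defining 𝒢
(`quadratic_cone`).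

Global existence. On 𝒢 the energy ∫ Ū² y_ξ + h controls ‖Ū‖_∞², P and the kernel integrals linearly
(`exists_bounds`), because U_ξ² = y_ξ h and because χ'(y) y_ξ has total mass at most 1. The rate of
change of the energy is the integral of a total derivative, whose boundary terms are bounded along
suitable sequences, plus c χ'(y) y_ξ times a factor at most linear in the energy. Since c is
conserved, the energy obeys a linear Gronwall inequality (`exists_energyRate_bound`). Once the
energy is bounded, so are ζ, U and the kernel integrals, and in that region `F` grows at most
linearly (`linGrowth_field`); a second Gronwall argument bounds the norm. This bound is uniform over
bounded sets of data and bounded times, so continuity of the semigroup follows from the Lipschitz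
estimate for `F`. -/

open MeasureTheory Set Filter Topology
open scoped ContDiff BoundedContinuousFunction

noncomputable section

namespace CamassaHolm

/-! ### Primitives of locally integrable functions -/

/-- `f` is a primitive of the locally integrable function `f'`. -/
def HasPrim (f f' : ℝ → ℝ) : Prop :=
  LocallyIntegrable f' ∧ ∀ a b, f b - f a = ∫ x in a..b, f' x

namespace HasPrim

variable {f f' k k' : ℝ → ℝ}

theorem intervalIntegrable (h : HasPrim f f') (a b : ℝ) : IntervalIntegrable f' volume a b :=
  (h.1.integrableOn_isCompact isCompact_uIcc).intervalIntegrable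

theorem eq_add (h : HasPrim f f') (a b : ℝ) : f b = f a + ∫ x in a..b, f' x := by
  rw [← h.2 a b]; ring

theorem absolutelyContinuousOnInterval (h : HasPrim f f') (a b : ℝ) :
    AbsolutelyContinuousOnInterval f a b := by
  have h1 := (h.intervalIntegrable a b).absolutelyContinuousOnInterval_intervalIntegral
    (c := a) left_mem_uIcc
  have h2 : AbsolutelyContinuousOnInterval (fun _ : ℝ => f a) a b :=
    (LipschitzWith.const (f a)).lipschitzOnWith.absolutelyContinuousOnInterval
  have : f = (fun _ : ℝ => f a) + fun x => ∫ v in a..x, f' v := by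
    funext x; simpa using h.eq_add a x
  rw [this]
  exact h2.add h1

theorem continuous (h : HasPrim f f') : Continuous f := by
  rw [continuous_iff_continuousAt]
  intro x
  have := (h.absolutelyContinuousOnInterval (x - 1) (x + 1)).continuousOn
  rw [uIcc_of_le (by linarith)] at this
  exact this.continuousAt (Icc_mem_nhds (by linarith) (by linarith))

theorem ae_hasDerivAt (h : HasPrim f f') : ∀ᵐ x, HasDerivAt f (f' x) x := by
  filter_upwards [LocallyIntegrable.ae_hasDerivAt_integral h.1] with x hx
  have h1 := (hx 0).const_add (f 0)
  have : f = fun x => f 0 + ∫ v in (0:ℝ)..x, f' v := by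
    funext x; exact h.eq_add 0 x
  rw [this]
  exact h1

theorem congr_right (h : HasPrim f f') (h' : f' =ᵐ[volume] k') : HasPrim f k' := by
  refine ⟨?_, fun a b => ?_⟩
  · intro x
    obtain ⟨s, hs, hi⟩ := h.1 x
    exact ⟨s, hs, hi.congr (ae_restrict_of_ae h')⟩
  · rw [h.2 a b]
    exact intervalIntegral.integral_congr_ae (by filter_upwards [h'] with x hx _ using hx)

/-- The fundamental theorem of calculus for absolutely continuous functions. The calculus rules
below reduce to it: absolute continuity survives the operation, and the derivative has to be
identified only almost everywhere. -/
theorem of_absolutelyContinuousOnInterval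
    (hf : ∀ a b, AbsolutelyContinuousOnInterval f a b) (hd : ∀ᵐ x, HasDerivAt f (f' x) x) :
    HasPrim f f' := by
  have e : deriv f =ᵐ[volume] f' := by filter_upwards [hd] with x hx using hx.deriv
  have h1 : HasPrim f (deriv f) := by
    refine ⟨fun x => ⟨Icc (x - 1) (x + 1), Icc_mem_nhds (by linarith) (by linarith), ?_⟩,
      fun a b => (hf a b).integral_deriv_eq_sub.symm⟩
    have := (hf (x - 1) (x + 1)).intervalIntegrable_deriv
    rwa [intervalIntegrable_iff_integrableOn_Icc_of_le (by linarith)] at this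
  exact h1.congr_right e

theorem mul (h : HasPrim f f') (hk : HasPrim k k') :
    HasPrim (fun x => f x * k x) (fun x => f' x * k x + f x * k' x) := by
  refine of_absolutelyContinuousOnInterval (fun a b => ?_) ?_
  · exact (h.absolutelyContinuousOnInterval a b).mul (hk.absolutelyContinuousOnInterval a b)
  · filter_upwards [h.ae_hasDerivAt, hk.ae_hasDerivAt] with x h1 h2 using h1.mul h2

theorem add (h : HasPrim f f') (hk : HasPrim k k') :
    HasPrim (fun x => f x + k x) (fun x => f' x + k' x) := by
  refine of_absolutelyContinuousOnInterval (fun a b => ?_) ?_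
  · exact (h.absolutelyContinuousOnInterval a b).add (hk.absolutelyContinuousOnInterval a b)
  · filter_upwards [h.ae_hasDerivAt, hk.ae_hasDerivAt] with x h1 h2 using h1.add h2

theorem const_mul (c : ℝ) (h : HasPrim f f') : HasPrim (fun x => c * f x) (fun x => c * f' x) := by
  refine ⟨h.1.smul c, fun a b => ?_⟩
  rw [intervalIntegral.integral_const_mul, ← h.2 a b]; ring

theorem neg (h : HasPrim f f') : HasPrim (fun x => -f x) (fun x => -f' x) := by
  simpa using h.const_mul (-1)

theorem sub (h : HasPrim f f') (hk : HasPrim k k') :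
    HasPrim (fun x => f x - k x) (fun x => f' x - k' x) := by
  simpa [sub_eq_add_neg] using h.add hk.neg

theorem of_hasDerivAt (h : ∀ x, HasDerivAt f (f' x) x) (hc : Continuous f') : HasPrim f f' :=
  ⟨hc.locallyIntegrable, fun a b => (intervalIntegral.integral_eq_sub_of_hasDerivAt
    (fun x _ => h x) (hc.intervalIntegrable a b)).symm⟩

/-- On the compact image of an interval φ is Lipschitz, and a Lipschitz function of an absolutely
continuous one is absolutely continuous. -/
theorem comp {φ φ' : ℝ → ℝ} (hφ : ∀ x, HasDerivAt φ (φ' x) x) (hc : Continuous φ')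
    (h : HasPrim f f') : HasPrim (fun x => φ (f x)) (fun x => φ' (f x) * f' x) := by
  refine of_absolutelyContinuousOnInterval (fun a b => ?_) ?_
  · have hcomp : IsCompact (f '' uIcc a b) := isCompact_uIcc.image h.continuous
    obtain ⟨R, hR⟩ := hcomp.isBounded.subset_closedBall 0
    obtain ⟨K, hK⟩ := (isCompact_closedBall (0:ℝ) R).exists_bound_of_continuousOn
      (f := φ') hc.continuousOn
    have hlip : ∀ x ∈ uIcc a b, ∀ y ∈ uIcc a b, dist (φ (f x)) (φ (f y)) ≤ |K| * dist (f x) (f y) := by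
      intro x hx y hy
      have := (convex_closedBall (0:ℝ) R).norm_image_sub_le_of_norm_hasDerivWithin_le
        (f := φ) (f' := φ') (C := |K|) (fun z _ => (hφ z).hasDerivWithinAt)
        (fun z hz => (hK z hz).trans (le_abs_self K)) (hR (mem_image_of_mem f hy))
        (hR (mem_image_of_mem f hx))
      simpa [Real.dist_eq] using this
    have hac := h.absolutelyContinuousOnInterval a b
    rw [absolutelyContinuousOnInterval_iff] at hac ⊢
    intro ε hε
    obtain ⟨δ, hδ, H⟩ := hac (ε / (|K| + 1)) (by positivity)
    refine ⟨δ, hδ, fun E hE hs => ?_⟩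
    have h1 := H E hE hs
    have hmem := hE.1
    calc ∑ i ∈ Finset.range E.1, dist (φ (f (E.2 i).1)) (φ (f (E.2 i).2))
        ≤ ∑ i ∈ Finset.range E.1, |K| * dist (f (E.2 i).1) (f (E.2 i).2) :=
          Finset.sum_le_sum fun i hi =>
            hlip _ (hmem i hi).1 _ (hmem i hi).2
      _ = |K| * ∑ i ∈ Finset.range E.1, dist (f (E.2 i).1) (f (E.2 i).2) := by
          rw [Finset.mul_sum]
      _ ≤ |K| * (ε / (|K| + 1)) := by gcongr
      _ < (|K| + 1) * (ε / (|K| + 1)) := by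
          have : 0 < ε / (|K| + 1) := by positivity
          nlinarith
      _ = ε := by field_simp
  · filter_upwards [h.ae_hasDerivAt] with x hx
    exact (hφ (f x)).comp x hx

theorem id : HasPrim (fun x => x) (fun _ => 1) :=
  of_hasDerivAt (fun x => hasDerivAt_id x) continuous_const

theorem hasWeakDeriv (h : HasPrim f f') : HasWeakDeriv f f' := by
  refine ⟨h.continuous.locallyIntegrable, h.1, fun φ hφ hc => ?_⟩
  have hφ' : HasPrim φ (deriv φ) := of_hasDerivAt
    (fun x => (hφ.differentiable (by simp)).differentiableAt.hasDerivAt)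
    (hφ.continuous_deriv (by simp))
  have hm := h.mul hφ'
  obtain ⟨R, hR⟩ := hc.isCompact.isBounded.subset_closedBall 0
  have hz : ∀ x, R < |x| → φ x = 0 ∧ deriv φ x = 0 := by
    intro x hx
    have hx' : x ∉ tsupport φ := fun hx' => by
      have := hR hx'
      simp at this; linarith
    exact ⟨image_eq_zero_of_notMem_tsupport hx',
      by_contra fun h0 => hx' (support_deriv_subset h0)⟩
  set S := |R| + 1
  have hS : R < S := by have := le_abs_self R; simp only [S]; linarith
  have hS0 : 0 < S := by positivity
  have hout : ∀ x, x ∉ Ioc (-S) S → φ x = 0 ∧ deriv φ x = 0 := by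
    intro x hx
    apply hz
    rw [mem_Ioc, not_and_or] at hx
    rcases hx with hx | hx
    · exact lt_abs.2 (Or.inr (by linarith))
    · exact lt_abs.2 (Or.inl (by linarith))
  have i1 : ∫ x, f x * deriv φ x = ∫ x in (-S)..S, f x * deriv φ x := by
    rw [intervalIntegral.integral_of_le (by linarith)]
    exact (setIntegral_eq_integral_of_forall_compl_eq_zero
      (fun x hx => by rw [(hout x hx).2, mul_zero])).symm
  have i2 : ∫ x, f' x * φ x = ∫ x in (-S)..S, f' x * φ x := by
    rw [intervalIntegral.integral_of_le (by linarith)]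
    exact (setIntegral_eq_integral_of_forall_compl_eq_zero
      (fun x hx => by rw [(hout x hx).1, mul_zero])).symm
  have key := hm.2 (-S) S
  have e1 : φ S = 0 := (hz S (by rw [abs_of_pos hS0]; exact hS)).1
  have e2 : φ (-S) = 0 := (hz (-S) (by rw [abs_neg, abs_of_pos hS0]; exact hS)).1
  beta_reduce at key
  rw [e1, e2, intervalIntegral.integral_add] at key
  · rw [i1, i2]; linarith
  · exact (h.intervalIntegrable _ _).mul_continuousOn hφ.continuous.continuousOn
  · exact (hφ'.intervalIntegrable _ _).continuousOn_mul h.continuous.continuousOn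

end HasPrim

theorem hasPrim_integral {f' : ℝ → ℝ} (h : LocallyIntegrable f') (a : ℝ) :
    HasPrim (fun x => ∫ v in a..x, f' v) f' := by
  refine ⟨h, fun b c => ?_⟩
  have hi : ∀ b c, IntervalIntegrable f' volume b c := fun b c =>
    (h.integrableOn_isCompact isCompact_uIcc).intervalIntegrable
  rw [intervalIntegral.integral_interval_sub_left (hi _ _) (hi _ _)]

/-- A locally integrable function with vanishing weak derivative is constant. -/
theorem HasWeakDeriv.ae_eq_const {f : ℝ → ℝ} (h : HasWeakDeriv f 0) : ∃ c, ∀ᵐ x, f x = c := by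
  obtain ⟨hf, -, H⟩ := h
  let b : ContDiffBump (0:ℝ) := default
  set ρ : ℝ → ℝ := b.normed volume
  have hρ : ContDiff ℝ ∞ ρ := b.contDiff_normed
  have hρc : HasCompactSupport ρ := b.hasCompactSupport_normed
  have hρ1 : ∫ x, ρ x = 1 := b.integral_normed
  have hi : ∀ {v : ℝ → ℝ}, Continuous v → HasCompactSupport v →
      Integrable (fun x => f x * v x) := by
    intro v hv hvc
    simpa [smul_eq_mul] using hf.integrable_smul_right_of_hasCompactSupport hv hvc
  refine ⟨∫ x, f x * ρ x, ?_⟩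
  refine ae_eq_of_integral_contDiff_smul_eq hf (locallyIntegrable_const _) fun φ hφ hφc => ?_
  set m := ∫ x, φ x
  -- Removing the mean with the bump ρ makes the primitive of ψ compactly supported, so this
  -- primitive is an admissible test function.
  set ψ : ℝ → ℝ := fun x => φ x - m * ρ x
  have hψ : ContDiff ℝ ∞ ψ := hφ.sub (contDiff_const.mul hρ)
  have hψc : HasCompactSupport ψ := by
    have h1 : HasCompactSupport (fun x => m * ρ x) := hρc.mul_left
    exact hφc.sub h1
  have iφ : Integrable φ := hφ.continuous.integrable_of_hasCompactSupport hφc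
  have iρ : Integrable ρ := hρ.continuous.integrable_of_hasCompactSupport hρc
  have hψ0 : ∫ x, ψ x = 0 := by
    simp only [ψ]
    rw [integral_sub iφ (iρ.const_mul m), integral_const_mul, hρ1]; simp [m]
  have iψ : Integrable ψ := hψ.continuous.integrable_of_hasCompactSupport hψc
  obtain ⟨R, hR⟩ := hψc.isCompact.isBounded.subset_closedBall 0
  have hz : ∀ x, R < |x| → ψ x = 0 := by
    intro x hx
    refine image_eq_zero_of_notMem_tsupport fun hx' => ?_
    have := hR hx'
    simp at this; linarith
  set S := |R| + 1
  have hS : R < S := by have := le_abs_self R; simp only [S]; linarith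
  have hS0 : 0 < S := by positivity
  set Ψ : ℝ → ℝ := fun x => ∫ v in (-S)..x, ψ v
  have hΨd : ∀ x, HasDerivAt Ψ (ψ x) x := fun x =>
    intervalIntegral.integral_hasDerivAt_right (hψ.continuous.intervalIntegrable _ _)
      (hψ.continuous.stronglyMeasurableAtFilter _ _) hψ.continuous.continuousAt
  have hΨ' : deriv Ψ = ψ := funext fun x => (hΨd x).deriv
  have hΨ : ContDiff ℝ ∞ Ψ := by
    rw [contDiff_infty_iff_deriv]
    exact ⟨fun x => (hΨd x).differentiableAt, by rw [hΨ']; exact hψ⟩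
  have hΨc : HasCompactSupport Ψ := by
    refine HasCompactSupport.of_support_subset_isCompact (isCompact_Icc (a := -S) (b := S)) ?_
    intro x hx
    by_contra hx'
    rw [mem_Icc, not_and_or] at hx'
    apply hx
    rcases hx' with hx' | hx'
    · have : ∀ v ∈ uIcc (-S) x, ψ v = 0 := by
        intro v hv
        rw [uIcc_of_ge (by linarith)] at hv
        exact hz v (lt_abs.2 (Or.inr (by linarith [hv.2])))
      simp only [Ψ]
      rw [intervalIntegral.integral_congr this]; simp
    · have h1 : Ψ x = ∫ v, ψ v := by
        simp only [Ψ]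
        rw [intervalIntegral.integral_of_le (by linarith)]
        refine setIntegral_eq_integral_of_forall_compl_eq_zero fun v hv => hz v ?_
        rw [mem_Ioc, not_and_or] at hv
        rcases hv with hv | hv
        · exact lt_abs.2 (Or.inr (by linarith))
        · exact lt_abs.2 (Or.inl (by linarith))
      rw [h1, hψ0]
  have key := H Ψ hΨ hΨc
  rw [hΨ'] at key
  simp only [Pi.zero_apply, zero_mul, integral_zero, neg_zero, ψ] at key
  have e : ∀ x, f x * (φ x - m * ρ x) = f x * φ x - m * (f x * ρ x) := fun x => by ring
  simp only [e] at key
  rw [integral_sub (hi hφ.continuous hφc) ((hi hρ.continuous hρc).const_mul m),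
    integral_const_mul] at key
  simp only [smul_eq_mul]
  rw [integral_mul_const]
  simp only [mul_comm (φ _)]
  linarith

theorem HasWeakDeriv.sub {f f' g g' : ℝ → ℝ} (h : HasWeakDeriv f g) (h' : HasWeakDeriv f' g') :
    HasWeakDeriv (f - f') (g - g') := by
  simpa [sub_eq_add_neg] using h.add (h'.const_smul (-1))

/-- A function with a weak derivative agrees almost everywhere with a primitive of it. -/
theorem HasWeakDeriv.exists_hasPrim {f g : ℝ → ℝ} (h : HasWeakDeriv f g) :
    ∃ F, HasPrim F g ∧ f =ᵐ[volume] F := by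
  have h1 := hasPrim_integral h.2.1 0
  have h2 := h.sub h1.hasWeakDeriv
  rw [sub_self] at h2
  obtain ⟨c, hc⟩ := h2.ae_eq_const
  have h3 : HasPrim (fun _ : ℝ => c) (fun _ => 0) :=
    HasPrim.of_hasDerivAt (fun x => hasDerivAt_const x c) continuous_const
  refine ⟨_, (h1.add h3).congr_right (by simp), ?_⟩
  filter_upwards [hc] with x hx
  simp only [Pi.sub_apply] at hx
  linarith

theorem HasWeakDeriv.hasPrim {f g : ℝ → ℝ} (h : HasWeakDeriv f g) (hf : Continuous f) :
    HasPrim f g := by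
  obtain ⟨F, hF, e⟩ := h.exists_hasPrim
  have : f = F := (Continuous.ae_eq_iff_eq volume hf hF.continuous).1 e
  rwa [this]

theorem HasWeakDeriv.unique {f f' g g' : ℝ → ℝ} (h : HasWeakDeriv f g) (h' : HasWeakDeriv f' g')
    (e : f =ᵐ[volume] f') : g =ᵐ[volume] g' := by
  obtain ⟨F, hF, e1⟩ := h.exists_hasPrim
  obtain ⟨F', hF', e2⟩ := h'.exists_hasPrim
  have : F = F' := (Continuous.ae_eq_iff_eq volume hF.continuous hF'.continuous).1
    (e1.symm.trans (e.trans e2))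
  subst this
  filter_upwards [hF.ae_hasDerivAt, hF'.ae_hasDerivAt] with x h1 h2 using h1.unique h2

/-- The Banach algebra of bounded continuous functions on the line. -/
abbrev Cb : Type := ℝ →ᵇ ℝ

theorem Cb.ext_of_ae {a b : Cb} (h : a =ᵐ[volume] b) : a = b :=
  DFunLike.coe_injective ((Continuous.ae_eq_iff_eq volume a.continuous b.continuous).1 h)

/-! ### Square integrable functions -/

namespace L2

theorem integrable_mul (f k : L2) : Integrable (fun x => f x * k x) :=
  (Lp.memLp f).integrable_mul (Lp.memLp k)

theorem integrable_sq (f : L2) : Integrable (fun x => f x ^ 2) := by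
  simpa [sq] using integrable_mul f f

theorem inner_eq (f k : L2) : inner ℝ f k = ∫ x, f x * k x := by
  rw [MeasureTheory.L2.inner_def]
  exact integral_congr_ae (Eventually.of_forall fun x => by simp [mul_comm])

theorem norm_sq (f : L2) : ‖f‖ ^ 2 = ∫ x, f x ^ 2 := by
  rw [← real_inner_self_eq_norm_sq, inner_eq]
  simp only [sq]

theorem norm_le_of_sq {f : L2} {C : ℝ} (hC : 0 ≤ C) (h : ∫ x, f x ^ 2 ≤ C ^ 2) : ‖f‖ ≤ C := by
  rw [← norm_sq] at h
  exact (sq_le_sq₀ (norm_nonneg _) hC).1 h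

theorem locallyIntegrable (f : L2) : LocallyIntegrable f :=
  (Lp.memLp f).locallyIntegrable (by norm_num)

end L2

/-- The class in `L²` of a bounded continuous multiple of a square integrable function. -/
theorem memLp_mul (a : Cb) (f : L2) : MemLp (fun x => a x * f x) 2 := by
  refine (Lp.memLp f).of_le_mul (c := ‖a‖)
    (a.continuous.aestronglyMeasurable.mul (Lp.aestronglyMeasurable f)) ?_
  exact Eventually.of_forall fun x => by
    rw [norm_mul]
    exact mul_le_mul_of_nonneg_right (a.norm_coe_le_norm x) (norm_nonneg _)

/-- Multiplication `C_b × L² → L²`. -/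
def mulL2 : Cb →L[ℝ] L2 →L[ℝ] L2 :=
  LinearMap.mkContinuous₂
    (LinearMap.mk₂ ℝ (fun (a : Cb) (f : L2) => (memLp_mul a f).toLp)
      (fun a b f => by
        apply Lp.ext
        filter_upwards [(memLp_mul (a + b) f).coeFn_toLp, (memLp_mul a f).coeFn_toLp,
          (memLp_mul b f).coeFn_toLp, Lp.coeFn_add (memLp_mul a f).toLp (memLp_mul b f).toLp]
          with x h1 h2 h3 h4
        rw [h1, h4, Pi.add_apply, h2, h3]; simp [add_mul])
      (fun c a f => by
        apply Lp.ext
        filter_upwards [(memLp_mul (c • a) f).coeFn_toLp, (memLp_mul a f).coeFn_toLp,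
          Lp.coeFn_smul c (memLp_mul a f).toLp] with x h1 h2 h4
        rw [h1, h4, Pi.smul_apply, h2]; simp [mul_assoc])
      (fun a f k => by
        apply Lp.ext
        filter_upwards [(memLp_mul a (f + k)).coeFn_toLp, (memLp_mul a f).coeFn_toLp,
          (memLp_mul a k).coeFn_toLp, Lp.coeFn_add (memLp_mul a f).toLp (memLp_mul a k).toLp,
          Lp.coeFn_add f k] with x h1 h2 h3 h4 h5
        rw [h1, h4, Pi.add_apply, h2, h3, h5]; simp [mul_add])
      (fun c a f => by
        apply Lp.ext
        filter_upwards [(memLp_mul a (c • f)).coeFn_toLp, (memLp_mul a f).coeFn_toLp,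
          Lp.coeFn_smul c (memLp_mul a f).toLp, Lp.coeFn_smul c f] with x h1 h2 h4 h5
        rw [h1, h4, Pi.smul_apply, h2, h5]; simp; ring))
    1 (fun a f => by
      rw [one_mul]
      refine Lp.norm_le_mul_norm_of_ae_le_mul ?_
      filter_upwards [(memLp_mul a f).coeFn_toLp] with x h1
      simp only [LinearMap.mk₂_apply]
      rw [h1, norm_mul]
      exact mul_le_mul_of_nonneg_right (a.norm_coe_le_norm x) (norm_nonneg _))

theorem coeFn_mulL2 (a : Cb) (f : L2) : mulL2 a f =ᵐ[volume] fun x => a x * f x :=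
  (memLp_mul a f).coeFn_toLp

/-- A square integrable function is small somewhere near `+∞`. -/
theorem exists_abs_le_atTop {f : ℝ → ℝ} (hf : Integrable fun x => f x ^ 2) {ε : ℝ} (hε : 0 < ε)
    (N : ℝ) : ∃ b ≥ N, |f b| ≤ ε := by
  by_contra! H
  have h1 : Integrable (fun _ : ℝ => ε ^ 2) (volume.restrict (Ioi N)) := by
    refine (hf.integrableOn (s := Ioi N)).mono' (by fun_prop) ?_
    filter_upwards [ae_restrict_mem measurableSet_Ioi] with x hx
    rw [Real.norm_of_nonneg (by positivity), ← sq_abs (f x)]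
    have := H x (le_of_lt hx)
    gcongr
  rw [integrable_const_iff] at h1
  rcases h1 with h1 | h1
  · simp at h1; exact hε.ne' h1
  · have := h1.measure_univ_lt_top
    simp at this

theorem exists_abs_le_atBot {f : ℝ → ℝ} (hf : Integrable fun x => f x ^ 2) {ε : ℝ} (hε : 0 < ε)
    (N : ℝ) : ∃ b ≤ N, |f b| ≤ ε := by
  obtain ⟨b, hb, h⟩ := exists_abs_le_atTop (f := fun x => f (-x)) hf.comp_neg hε (-N)
  exact ⟨-b, by linarith, h⟩

/-! ### The Sobolev embedding -/

theorem HasPrim.sq {f f' : ℝ → ℝ} (h : HasPrim f f') :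
    HasPrim (fun x => f x ^ 2) (fun x => 2 * f x * f' x) := by
  have := h.mul h
  simp only [← pow_two] at this
  exact this.congr_right (Eventually.of_forall fun x => by simp; ring)

/-- Integrate (F²)' = 2 F F' ≤ F² + F'² from a far left point where F² is at most ε. Square
integrability supplies such points, so no limit at infinity has to be established first. -/
theorem HasPrim.sq_le_of_L2 {F : ℝ → ℝ} {f f' : L2} (hF : HasPrim F f') (h : f =ᵐ[volume] F)
    (x : ℝ) : F x ^ 2 ≤ ‖f‖ ^ 2 + ‖f'‖ ^ 2 := by
  have hsq : Integrable fun x => F x ^ 2 :=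
    (L2.integrable_sq f).congr (by filter_upwards [h] with x hx; rw [hx])
  refine le_of_forall_pos_le_add fun ε hε => ?_
  obtain ⟨a, hax, ha⟩ := exists_abs_le_atBot hsq (Real.sqrt_pos.2 hε) x
  have ha2 : F a ^ 2 ≤ ε := by
    rw [← sq_abs, ← Real.sq_sqrt hε.le]; gcongr
  have h1 := hF.sq.2 a x
  have h2 : ∫ t in a..x, 2 * F t * f' t ≤ ∫ t in a..x, (F t ^ 2 + f' t ^ 2) := by
    refine intervalIntegral.integral_mono_on hax (hF.sq.intervalIntegrable _ _) ?_ fun t _ => ?_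
    · exact (hsq.add (L2.integrable_sq f')).intervalIntegrable
    · nlinarith [sq_nonneg (F t - f' t)]
  have h3 : ∫ t in a..x, (F t ^ 2 + f' t ^ 2) ≤ ∫ t, (F t ^ 2 + f' t ^ 2) := by
    rw [intervalIntegral.integral_of_le hax]
    exact setIntegral_le_integral (hsq.add (L2.integrable_sq f'))
      (Eventually.of_forall fun t => by positivity)
  have h4 : ∫ t, (F t ^ 2 + f' t ^ 2) = ‖f‖ ^ 2 + ‖f'‖ ^ 2 := by
    rw [integral_add hsq (L2.integrable_sq f'), L2.norm_sq, L2.norm_sq]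
    congr 1
    exact integral_congr_ae (by filter_upwards [h] with x hx; rw [hx])
  simp only at h1
  linarith

theorem H1.exists_rep (u : H1) : ∃ F : Cb, HasPrim F u.1.snd ∧ u.1.fst =ᵐ[volume] F ∧
    ‖F‖ ≤ 1 * ‖u‖ := by
  obtain ⟨F, hF, e⟩ := u.2.exists_hasPrim
  have hb : ∀ x, ‖F x‖ ≤ ‖u‖ := fun x => by
    have h1 := hF.sq_le_of_L2 e x
    have h2 : ‖u‖ = √(‖u.1.fst‖ ^ 2 + ‖u.1.snd‖ ^ 2) := WithLp.prod_norm_eq_of_L2 u.1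
    rw [h2]
    exact Real.abs_le_sqrt h1
  refine ⟨BoundedContinuousFunction.ofNormedAddCommGroup F hF.continuous ‖u‖ hb, hF, e, ?_⟩
  rw [one_mul]
  exact BoundedContinuousFunction.norm_ofNormedAddCommGroup_le _ (norm_nonneg _) _

/-- The embedding `H¹ ⊂ C_b`. -/
def sobolev : H1 →L[ℝ] Cb :=
  LinearMap.mkContinuous
    { toFun := fun u => (H1.exists_rep u).choose
      map_add' := fun u v => by
        apply Cb.ext_of_ae
        filter_upwards [(H1.exists_rep (u + v)).choose_spec.2.1,
          (H1.exists_rep u).choose_spec.2.1, (H1.exists_rep v).choose_spec.2.1,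
          Lp.coeFn_add u.1.fst v.1.fst] with x h1 h2 h3 h4
        rw [← h1, BoundedContinuousFunction.coe_add, Pi.add_apply, ← h2, ← h3]
        exact h4
      map_smul' := fun c u => by
        apply Cb.ext_of_ae
        filter_upwards [(H1.exists_rep (c • u)).choose_spec.2.1,
          (H1.exists_rep u).choose_spec.2.1, Lp.coeFn_smul c u.1.fst] with x h1 h2 h4
        rw [← h1, RingHom.id_apply, BoundedContinuousFunction.coe_smul]
        simp only
        rw [← h2]
        exact h4 }
    1 (fun u => (H1.exists_rep u).choose_spec.2.2)

theorem sobolev_hasPrim (u : H1) : HasPrim (sobolev u) u.1.snd := (H1.exists_rep u).choose_spec.1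

theorem sobolev_ae (u : H1) : u.1.fst =ᵐ[volume] sobolev u := (H1.exists_rep u).choose_spec.2.1

/-! ### Convolution with one-sided exponentials -/

theorem memLp_expKernel (ξ : ℝ) :
    MemLp ((Iic ξ).indicator fun η => Real.exp (η - ξ)) 2 (volume : Measure ℝ) := by
  rw [memLp_two_iff_integrable_sq]
  · have h1 : (fun x => (Iic ξ).indicator (fun η => Real.exp (η - ξ)) x ^ 2) =
        (Iic ξ).indicator fun η => Real.exp (-(2 * ξ)) * Real.exp (2 * η) := by
      funext x
      by_cases hx : x ∈ Iic ξ
      · simp only [indicator_of_mem hx]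
        rw [← Real.exp_add, ← Real.exp_nat_mul]; congr 1; push_cast; ring
      · simp [indicator_of_notMem hx]
    rw [h1, integrable_indicator_iff measurableSet_Iic]
    exact (integrableOn_exp_mul_Iic two_pos ξ).const_mul _
  · exact ((by fun_prop : Continuous fun η => Real.exp (η - ξ)).aestronglyMeasurable).indicator
      measurableSet_Iic

theorem norm_expKernel_le (ξ : ℝ) : ‖(memLp_expKernel ξ).toLp‖ ≤ 1 := by
  refine L2.norm_le_of_sq zero_le_one ?_
  have h1 : ∫ x, ((memLp_expKernel ξ).toLp : L2) x ^ 2 =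
      ∫ x in Iic ξ, Real.exp (-(2 * ξ)) * Real.exp (2 * x) := by
    rw [← integral_indicator measurableSet_Iic]
    refine integral_congr_ae ?_
    filter_upwards [(memLp_expKernel ξ).coeFn_toLp] with x h
    rw [h]
    by_cases hx : x ∈ Iic ξ
    · simp only [indicator_of_mem hx]
      rw [← Real.exp_add, ← Real.exp_nat_mul]; congr 1; push_cast; ring
    · simp [indicator_of_notMem hx]
  rw [h1, integral_const_mul, integral_exp_mul_Iic two_pos, mul_div_assoc', ← Real.exp_add]
  simp; norm_num

theorem integrableOn_exp_mul (f : L2) (ξ : ℝ) :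
    IntegrableOn (fun η => Real.exp η * f η) (Iic ξ) := by
  have h := ((memLp_expKernel ξ).integrable_mul (Lp.memLp f)).const_mul (Real.exp ξ)
  rw [← integrable_indicator_iff measurableSet_Iic]
  refine h.congr (Eventually.of_forall fun x => ?_)
  by_cases hx : x ∈ Iic ξ
  · simp only [Pi.mul_apply, indicator_of_mem hx]
    rw [← mul_assoc, ← Real.exp_add]; ring_nf
  · simp [indicator_of_notMem hx]

/-- `ξ ↦ ∫_{-∞}^ξ e^{-(ξ-η)} f(η) dη`. -/
def expConvFun (f : ℝ → ℝ) (ξ : ℝ) : ℝ := Real.exp (-ξ) * ∫ η in Iic ξ, Real.exp η * f η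

/-- As an inner product with a function of norm at most 1, the convolution is visibly linear in `f`
and bounded in the sup norm by Cauchy-Schwarz. -/
theorem expConvFun_eq_inner (f : L2) (ξ : ℝ) :
    expConvFun f ξ = inner ℝ (memLp_expKernel ξ).toLp f := by
  rw [L2.inner_eq, expConvFun, ← integral_const_mul, ← integral_indicator measurableSet_Iic]
  refine integral_congr_ae ?_
  filter_upwards [(memLp_expKernel ξ).coeFn_toLp] with x h
  rw [h]
  by_cases hx : x ∈ Iic ξ
  · simp only [indicator_of_mem hx]
    rw [← mul_assoc, ← Real.exp_add]; ring_nf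
  · simp [indicator_of_notMem hx]

theorem abs_expConvFun_le (f : L2) (ξ : ℝ) : ‖expConvFun f ξ‖ ≤ ‖f‖ := by
  rw [expConvFun_eq_inner]
  refine (abs_real_inner_le_norm _ _).trans ?_
  have := norm_expKernel_le ξ
  nlinarith [norm_nonneg f]

theorem expConvFun_hasPrim (f : L2) :
    HasPrim (expConvFun f) (fun x => f x - expConvFun f x) := by
  have h1 : HasPrim (fun ξ => ∫ η in Iic ξ, Real.exp η * f η) (fun η => Real.exp η * f η) := by
    refine ⟨?_, fun a b => intervalIntegral.integral_Iic_sub_Iic (integrableOn_exp_mul f a)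
      (integrableOn_exp_mul f b)⟩
    intro x
    exact ⟨Iic (x + 1), Iic_mem_nhds (by linarith), integrableOn_exp_mul f _⟩
  have h2 : HasPrim (fun ξ : ℝ => Real.exp (-ξ)) (fun ξ => -Real.exp (-ξ)) := by
    refine HasPrim.of_hasDerivAt (fun x => ?_) (by fun_prop)
    simpa using (hasDerivAt_neg x).exp
  refine (h2.mul h1).congr_right (Eventually.of_forall fun x => ?_)
  simp only [expConvFun]
  rw [← mul_assoc, ← Real.exp_add]
  simp; ring

/-- The energy estimate for v' = f - v: from (v²)' = 2 v f - 2 v² ≤ f² - v², integration over [-n,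
n] bounds ∫ v² by ‖f‖² plus the boundary value v(-n)². This replaces Young's inequality for the
convolution. -/
theorem sq_integrable_of_prim {v : ℝ → ℝ} {f : L2} {M : ℝ} (hv : HasPrim v (fun x => f x - v x))
    (hM : ∀ x, |v x| ≤ M) : Integrable (fun x => v x ^ 2) ∧ ∫ x, v x ^ 2 ≤ ‖f‖ ^ 2 + M ^ 2 := by
  have hb : ∀ n : ℕ, ∫ x in (-(n:ℝ))..n, v x ^ 2 ≤ ‖f‖ ^ 2 + M ^ 2 := by
    intro n
    have hn : -(n:ℝ) ≤ n := by have : (0:ℝ) ≤ n := n.cast_nonneg; linarith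
    have h1 := hv.sq.2 (-(n:ℝ)) n
    have iv : IntervalIntegrable (fun x => v x ^ 2) volume (-(n:ℝ)) n :=
      (hv.continuous.pow 2).intervalIntegrable _ _
    have jf : IntervalIntegrable (fun x => f x ^ 2) volume (-(n:ℝ)) n :=
      (L2.integrable_sq f).intervalIntegrable
    have h2 : ∫ t in (-(n:ℝ))..n, 2 * v t * (f t - v t) ≤
        ∫ t in (-(n:ℝ))..n, (f t ^ 2 - v t ^ 2) :=
      intervalIntegral.integral_mono_on hn (hv.sq.intervalIntegrable _ _) (jf.sub iv) fun t _ => by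
        nlinarith [sq_nonneg (v t - f t)]
    rw [intervalIntegral.integral_sub jf iv] at h2
    have h3 : ∫ t in (-(n:ℝ))..n, f t ^ 2 ≤ ‖f‖ ^ 2 := by
      rw [intervalIntegral.integral_of_le hn, L2.norm_sq]
      exact setIntegral_le_integral (L2.integrable_sq f)
        (Eventually.of_forall fun t => by positivity)
    have h4 : v (-(n:ℝ)) ^ 2 ≤ M ^ 2 := by
      rw [← sq_abs]; gcongr; exact hM _
    have h5 := sq_nonneg (v n)
    simp only at h1
    linarith
  have hi : Integrable (fun x => v x ^ 2) := by
    refine integrable_of_intervalIntegral_norm_bounded (l := atTop) (‖f‖ ^ 2 + M ^ 2)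
      (fun n : ℕ => ((hv.continuous.pow 2).integrableOn_Ioc)) (a := fun n : ℕ => -(n:ℝ))
      (b := fun n : ℕ => (n:ℝ)) (tendsto_neg_atTop_atBot.comp tendsto_natCast_atTop_atTop)
      tendsto_natCast_atTop_atTop (Eventually.of_forall fun n => ?_)
    simpa using hb n
  refine ⟨hi, le_of_tendsto' (intervalIntegral_tendsto_integral hi
    (tendsto_neg_atTop_atBot.comp tendsto_natCast_atTop_atTop) tendsto_natCast_atTop_atTop) hb⟩

theorem memLp_expConvFun (f : L2) : MemLp (expConvFun f) 2 :=
  (memLp_two_iff_integrable_sq (expConvFun_hasPrim f).continuous.aestronglyMeasurable).2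
    (sq_integrable_of_prim (expConvFun_hasPrim f) (abs_expConvFun_le f)).1

theorem expConvFun_add (f k : L2) (ξ : ℝ) :
    expConvFun (f + k : L2) ξ = expConvFun f ξ + expConvFun k ξ := by
  simp only [expConvFun_eq_inner, inner_add_right]

theorem expConvFun_smul (c : ℝ) (f : L2) (ξ : ℝ) :
    expConvFun (c • f : L2) ξ = c * expConvFun f ξ := by
  simp only [expConvFun_eq_inner, inner_smul_right]

/-- `f ↦ (ξ ↦ ∫_{-∞}^ξ e^{-(ξ-η)} f(η) dη)` from `L²` to `C_b`. -/
def convLeft : L2 →L[ℝ] Cb :=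
  LinearMap.mkContinuous
    { toFun := fun f => BoundedContinuousFunction.ofNormedAddCommGroup (expConvFun f)
        (expConvFun_hasPrim f).continuous ‖f‖ (abs_expConvFun_le f)
      map_add' := fun f k => by ext ξ; exact expConvFun_add f k ξ
      map_smul' := fun c f => by ext ξ; exact expConvFun_smul c f ξ }
    1 (fun f => by
      rw [one_mul]
      exact BoundedContinuousFunction.norm_ofNormedAddCommGroup_le _ (norm_nonneg _)
        (abs_expConvFun_le f))

theorem convLeft_apply (f : L2) (ξ : ℝ) : convLeft f ξ = expConvFun f ξ := rfl

/-- `convLeft` as an operator on `L²`. -/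
def convLeftL2 : L2 →L[ℝ] L2 :=
  LinearMap.mkContinuous
    { toFun := fun f => (memLp_expConvFun f).toLp
      map_add' := fun f k => by
        apply Lp.ext
        filter_upwards [(memLp_expConvFun (f + k)).coeFn_toLp, (memLp_expConvFun f).coeFn_toLp,
          (memLp_expConvFun k).coeFn_toLp,
          Lp.coeFn_add (memLp_expConvFun f).toLp (memLp_expConvFun k).toLp] with x h1 h2 h3 h4
        rw [h1, h4, Pi.add_apply, h2, h3, expConvFun_add]
      map_smul' := fun c f => by
        apply Lp.ext
        filter_upwards [(memLp_expConvFun (c • f)).coeFn_toLp, (memLp_expConvFun f).coeFn_toLp,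
          Lp.coeFn_smul c (memLp_expConvFun f).toLp] with x h1 h2 h4
        rw [h1, RingHom.id_apply, h4, Pi.smul_apply, h2, expConvFun_smul, smul_eq_mul] }
    -- The estimate with M = ‖f‖ gives 2 ‖f‖², which is below (2 ‖f‖)².
    2 (fun f => by
      refine L2.norm_le_of_sq (by positivity) ?_
      have h1 := (sq_integrable_of_prim (expConvFun_hasPrim f) (abs_expConvFun_le f)).2
      have h2 : ∫ x, ((memLp_expConvFun f).toLp : L2) x ^ 2 = ∫ x, expConvFun f x ^ 2 :=
        integral_congr_ae (by
          filter_upwards [(memLp_expConvFun f).coeFn_toLp] with x h; rw [h])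
      simp only [LinearMap.coe_mk, AddHom.coe_mk]
      rw [h2]
      nlinarith [sq_nonneg ‖f‖])

theorem coeFn_convLeftL2 (f : L2) : convLeftL2 f =ᵐ[volume] convLeft f :=
  (memLp_expConvFun f).coeFn_toLp

theorem convLeft_hasPrim (f : L2) : HasPrim (convLeft f) (fun x => f x - convLeft f x) :=
  expConvFun_hasPrim f

/-- Reflection `x ↦ -x` on `L²`. -/
def reflL2 : L2 →L[ℝ] L2 :=
  (Lp.compMeasurePreservingₗᵢ ℝ (Neg.neg : ℝ → ℝ)
    (Measure.measurePreserving_neg volume)).toContinuousLinearMap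

theorem coeFn_reflL2 (f : L2) : reflL2 f =ᵐ[volume] fun x => f (-x) :=
  Lp.coeFn_compMeasurePreserving f (Measure.measurePreserving_neg volume)

/-- Reflection `x ↦ -x` on `C_b`. -/
def reflCb : Cb →L[ℝ] Cb :=
  LinearMap.mkContinuous
    { toFun := fun a => a.compContinuous ⟨Neg.neg, continuous_neg⟩
      map_add' := fun a b => rfl
      map_smul' := fun c a => rfl }
    1 (fun a => by
      rw [one_mul]
      exact (BoundedContinuousFunction.norm_le (norm_nonneg _)).2 fun x => a.norm_coe_le_norm _)

theorem reflCb_apply (a : Cb) (x : ℝ) : reflCb a x = a (-x) := rfl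

/-- `f ↦ (ξ ↦ ∫_ξ^∞ e^{-(η-ξ)} f(η) dη)` from `L²` to `C_b`. -/
def convRight : L2 →L[ℝ] Cb := reflCb ∘L convLeft ∘L reflL2

/-- `convRight` as an operator on `L²`. -/
def convRightL2 : L2 →L[ℝ] L2 := reflL2 ∘L convLeftL2 ∘L reflL2

theorem ae_neg {p : ℝ → Prop} (h : ∀ᵐ x, p x) : ∀ᵐ x, p (-x) :=
  (Measure.measurePreserving_neg (volume : Measure ℝ)).quasiMeasurePreserving.ae h

theorem coeFn_convRightL2 (f : L2) : convRightL2 f =ᵐ[volume] convRight f := by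
  filter_upwards [coeFn_reflL2 (convLeftL2 (reflL2 f)), ae_neg (coeFn_convLeftL2 (reflL2 f))]
    with x h1 h2
  exact h1.trans h2

theorem HasPrim.comp_neg {f f' : ℝ → ℝ} (h : HasPrim f f') :
    HasPrim (fun x => f (-x)) (fun x => -f' (-x)) := by
  have hi : ∀ a b, ∫ x in a..b, -f' (-x) = f (-b) - f (-a) := by
    intro a b
    rw [intervalIntegral.integral_neg, intervalIntegral.integral_comp_neg, ← h.2]; ring
  refine ⟨?_, fun a b => (hi a b).symm⟩
  have h2 : LocallyIntegrable (fun x => f' (-x)) := by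
    intro x
    obtain ⟨s, hs, hi⟩ := h.1 (-x)
    refine ⟨Neg.neg ⁻¹' s, continuous_neg.continuousAt.preimage_mem_nhds hs, ?_⟩
    exact ((Measure.measurePreserving_neg (volume : Measure ℝ)).integrableOn_comp_preimage
      (MeasurableEquiv.neg ℝ).measurableEmbedding).2 hi
  exact h2.neg

theorem convRight_hasPrim (f : L2) : HasPrim (convRight f) (fun x => convRight f x - f x) := by
  refine (convLeft_hasPrim (reflL2 f)).comp_neg.congr_right ?_
  filter_upwards [ae_neg (coeFn_reflL2 f)] with x h
  rw [h]
  simp [convRight, reflCb_apply]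

theorem convLeft_eq (f : L2) (ξ : ℝ) :
    convLeft f ξ = ∫ η in Iic ξ, Real.exp (-(ξ - η)) * f η := by
  rw [convLeft_apply, expConvFun, ← integral_const_mul]
  refine setIntegral_congr_fun measurableSet_Iic fun x _ => ?_
  rw [← mul_assoc, ← Real.exp_add]; ring_nf

theorem convRight_eq (f : L2) (ξ : ℝ) :
    convRight f ξ = ∫ η in Ioi ξ, Real.exp (ξ - η) * f η := by
  have h1 : convRight f ξ = convLeft (reflL2 f) (-ξ) := rfl
  rw [h1, convLeft_eq]
  have h2 : ∫ η in Ioi ξ, Real.exp (ξ - η) * f η =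
      ∫ η in Iic (-ξ), Real.exp (ξ - -η) * f (-η) := by
    rw [integral_comp_neg_Iic (-ξ) (fun η => Real.exp (ξ - η) * f η), neg_neg]
  rw [h2]
  refine integral_congr_ae (ae_restrict_of_ae ?_)
  filter_upwards [coeFn_reflL2 f] with x h
  rw [h]; ring_nf

theorem integrableOn_convLeft (f : L2) (ξ : ℝ) :
    IntegrableOn (fun η => Real.exp (-(ξ - η)) * f η) (Iic ξ) := by
  refine ((integrableOn_exp_mul f ξ).const_mul (Real.exp (-ξ))).congr
    (Eventually.of_forall fun x => ?_)
  simp only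
  rw [← mul_assoc, ← Real.exp_add]; ring_nf

theorem integrableOn_convRight (f : L2) (ξ : ℝ) :
    IntegrableOn (fun η => Real.exp (ξ - η) * f η) (Ioi ξ) := by
  have h1 := integrableOn_convLeft (reflL2 f) (-ξ)
  have h2 : IntegrableOn (fun η => Real.exp (ξ - -η) * f (-η)) (Iic (-ξ)) := by
    refine h1.congr (ae_restrict_of_ae ?_)
    filter_upwards [coeFn_reflL2 f] with x h
    rw [h]; ring_nf
  have h3 := ((Measure.measurePreserving_neg (volume : Measure ℝ)).integrableOn_comp_preimage
    (MeasurableEquiv.neg ℝ).measurableEmbedding (f := fun η => Real.exp (ξ - η) * f η)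
    (s := Ici ξ)).1 (by
      have : Neg.neg ⁻¹' Ici ξ = Iic (-ξ) := by ext x; simp
      rw [this]; exact h2)
  exact h3.mono_set Ioi_subset_Ici_self

/-! ### Maps that are Lipschitz on bounded sets -/

section LipBdd

variable {A B C D : Type*} [NormedAddCommGroup A] [NormedAddCommGroup B] [NormedAddCommGroup C]
  [NormedAddCommGroup D]

/-- `f` is Lipschitz on bounded sets. -/
def LipBdd (f : A → B) : Prop :=
  ∀ R : ℝ, ∃ K : ℝ, 0 ≤ K ∧ ∀ x y, ‖x‖ ≤ R → ‖y‖ ≤ R → ‖f x - f y‖ ≤ K * ‖x - y‖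

namespace LipBdd

theorem const (b : B) : LipBdd fun _ : A => b := fun _ => ⟨0, le_rfl, fun x y _ _ => by simp⟩

theorem bdd {f : A → B} (hf : LipBdd f) (R : ℝ) : ∃ M, 0 ≤ M ∧ ∀ x, ‖x‖ ≤ R → ‖f x‖ ≤ M := by
  obtain ⟨K, hK, H⟩ := hf (max R 0)
  refine ⟨‖f 0‖ + K * max R 0, by positivity, fun x hx => ?_⟩
  have h1 := H x 0 (hx.trans (le_max_left _ _)) (by simp)
  have h2 : ‖f x‖ ≤ ‖f 0‖ + ‖f x - f 0‖ := by
    have := norm_add_le (f 0) (f x - f 0); simpa using this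
  rw [sub_zero] at h1
  have h3 : K * ‖x‖ ≤ K * max R 0 := by gcongr; exact hx.trans (le_max_left _ _)
  linarith

theorem comp {g : B → C} {f : A → B} (hg : LipBdd g) (hf : LipBdd f) :
    LipBdd fun x => g (f x) := by
  intro R
  obtain ⟨M, -, hM⟩ := hf.bdd R
  obtain ⟨K, hK, H⟩ := hf R
  obtain ⟨L, hL, H'⟩ := hg M
  refine ⟨L * K, by positivity, fun x y hx hy => ?_⟩
  calc _ ≤ L * ‖f x - f y‖ := H' _ _ (hM x hx) (hM y hy)
    _ ≤ L * (K * ‖x - y‖) := by gcongr; exact H x y hx hy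
    _ = _ := by ring

theorem add {f g : A → B} (hf : LipBdd f) (hg : LipBdd g) : LipBdd fun x => f x + g x := by
  intro R
  obtain ⟨K, hK, H⟩ := hf R
  obtain ⟨L, hL, H'⟩ := hg R
  refine ⟨K + L, by positivity, fun x y hx hy => ?_⟩
  calc _ = ‖(f x - f y) + (g x - g y)‖ := by rw [add_sub_add_comm]
    _ ≤ _ := norm_add_le _ _
    _ ≤ K * ‖x - y‖ + L * ‖x - y‖ := add_le_add (H x y hx hy) (H' x y hx hy)
    _ = _ := by ring

theorem neg {f : A → B} (hf : LipBdd f) : LipBdd fun x => -f x := by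
  intro R
  obtain ⟨K, hK, H⟩ := hf R
  refine ⟨K, hK, fun x y hx hy => ?_⟩
  rw [← neg_sub', norm_neg]; exact H x y hx hy

theorem sub {f g : A → B} (hf : LipBdd f) (hg : LipBdd g) : LipBdd fun x => f x - g x := by
  simpa [sub_eq_add_neg] using hf.add hg.neg

theorem prodMk {f : A → B} {g : A → C} (hf : LipBdd f) (hg : LipBdd g) :
    LipBdd fun x => (f x, g x) := by
  intro R
  obtain ⟨K, hK, H⟩ := hf R
  obtain ⟨L, hL, H'⟩ := hg R
  refine ⟨max K L, by positivity, fun x y hx hy => ?_⟩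
  rw [Prod.mk_sub_mk, Prod.norm_mk]
  refine max_le ((H x y hx hy).trans ?_) ((H' x y hx hy).trans ?_)
  · gcongr; exact le_max_left _ _
  · gcongr; exact le_max_right _ _

theorem continuous {f : A → B} (hf : LipBdd f) : Continuous f := by
  rw [continuous_iff_continuousAt]
  intro x
  obtain ⟨K, hK, H⟩ := hf (‖x‖ + 1)
  have h1 : Tendsto (fun y => K * ‖y - x‖) (𝓝 x) (𝓝 0) := by
    have : Continuous fun y => K * ‖y - x‖ := by fun_prop
    simpa using this.tendsto x
  refine tendsto_iff_norm_sub_tendsto_zero.2 (squeeze_zero' (Eventually.of_forall fun _ =>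
    norm_nonneg _) ?_ h1)
  filter_upwards [Metric.ball_mem_nhds x one_pos] with y hy
  refine H y x ?_ (by linarith)
  have h2 := norm_add_le x (y - x)
  rw [mem_ball_iff_norm] at hy
  rw [add_sub_cancel] at h2
  linarith

variable [NormedSpace ℝ B] [NormedSpace ℝ C] [NormedSpace ℝ D]

theorem clm [NormedSpace ℝ A] (f : A →L[ℝ] B) : LipBdd f := fun _ =>
  ⟨‖f‖, norm_nonneg _, fun x y _ _ => by rw [← map_sub]; exact f.le_opNorm _⟩

theorem bilin (b : B →L[ℝ] C →L[ℝ] D) {f : A → B} {g : A → C} (hf : LipBdd f) (hg : LipBdd g) :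
    LipBdd fun x => b (f x) (g x) := by
  intro R
  obtain ⟨K, hK, H⟩ := hf R
  obtain ⟨L, hL, H'⟩ := hg R
  obtain ⟨M, hM, h1⟩ := hf.bdd R
  obtain ⟨N, hN, h2⟩ := hg.bdd R
  refine ⟨‖b‖ * K * N + ‖b‖ * M * L, by positivity, fun x y hx hy => ?_⟩
  calc _ = ‖b (f x - f y) (g x) + b (f y) (g x - g y)‖ := by simp
    _ ≤ _ := norm_add_le _ _
    _ ≤ ‖b‖ * ‖f x - f y‖ * ‖g x‖ + ‖b‖ * ‖f y‖ * ‖g x - g y‖ :=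
      add_le_add (b.le_opNorm₂ _ _) (b.le_opNorm₂ _ _)
    _ ≤ ‖b‖ * (K * ‖x - y‖) * N + ‖b‖ * M * (L * ‖x - y‖) := by
      gcongr
      exacts [H x y hx hy, h2 x hx, h1 y hy, H' x y hx hy]
    _ = _ := by ring

theorem smul {f : A → ℝ} {g : A → B} (hf : LipBdd f) (hg : LipBdd g) :
    LipBdd fun x => f x • g x :=
  bilin (ContinuousLinearMap.lsmul ℝ ℝ) hf hg

theorem const_smul (c : ℝ) {g : A → B} (hg : LipBdd g) : LipBdd fun x => c • g x :=
  (const c).smul hg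

end LipBdd

theorem LipBdd.mulCb {A : Type*} [NormedAddCommGroup A] {f g : A → Cb}
    (hf : LipBdd f) (hg : LipBdd g) : LipBdd fun x => f x * g x :=
  LipBdd.bilin (ContinuousLinearMap.mul ℝ Cb) hf hg

theorem LipBdd.mulReal {A : Type*} [NormedAddCommGroup A] {f g : A → ℝ}
    (hf : LipBdd f) (hg : LipBdd g) : LipBdd fun x => f x * g x :=
  LipBdd.bilin (ContinuousLinearMap.mul ℝ ℝ) hf hg

end LipBdd

/-! ### Superposition operators -/

/-- Functions `Ψ(ξ, s)` that are bounded and Lipschitz in `s`, uniformly in `ξ`, for bounded `s`. -/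
structure SupKernel where
  toFun : ℝ → ℝ → ℝ
  cont : Continuous fun p : ℝ × ℝ => toFun p.1 p.2
  bdd : ∀ R, ∃ M, 0 ≤ M ∧ ∀ ξ s, |s| ≤ R → |toFun ξ s| ≤ M
  lip : ∀ R, ∃ K, 0 ≤ K ∧ ∀ ξ s t, |s| ≤ R → |t| ≤ R → |toFun ξ s - toFun ξ t| ≤ K * |s - t|

theorem lip_of_deriv {Ψ Ψ' : ℝ → ℝ → ℝ} (hd : ∀ ξ s, HasDerivAt (Ψ ξ) (Ψ' ξ s) s) {R M : ℝ}
    (hM : ∀ ξ s, |s| ≤ R → |Ψ' ξ s| ≤ M) (ξ s t : ℝ) (hs : |s| ≤ R) (ht : |t| ≤ R) :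
    |Ψ ξ s - Ψ ξ t| ≤ M * |s - t| := by
  have := (convex_closedBall (0:ℝ) R).norm_image_sub_le_of_norm_hasDerivWithin_le
    (f := Ψ ξ) (f' := Ψ' ξ) (C := M) (fun z _ => (hd ξ z).hasDerivWithinAt)
    (fun z hz => hM ξ z (by simpa using hz)) (x := t) (y := s) (by simpa using ht)
    (by simpa using hs)
  simpa using this

/-- A kernel from bounds for its derivative in the second variable. -/
def SupKernel.ofDeriv (Ψ Ψ' : ℝ → ℝ → ℝ) (cont : Continuous fun p : ℝ × ℝ => Ψ p.1 p.2)
    (hd : ∀ ξ s, HasDerivAt (Ψ ξ) (Ψ' ξ s) s) (h0 : ∃ M, ∀ ξ, |Ψ ξ 0| ≤ M)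
    (hb : ∀ R, ∃ M, 0 ≤ M ∧ ∀ ξ s, |s| ≤ R → |Ψ' ξ s| ≤ M) : SupKernel where
  toFun := Ψ
  cont := cont
  bdd R := by
    obtain ⟨M, hM⟩ := h0
    obtain ⟨N, hN, H⟩ := hb |R|
    refine ⟨|M| + N * |R|, by positivity, fun ξ s hs => ?_⟩
    have hs' : |s| ≤ |R| := hs.trans (le_abs_self R)
    have h1 := lip_of_deriv hd H ξ s 0 hs' (by simp)
    have h2 : |Ψ ξ s| ≤ |Ψ ξ 0| + |Ψ ξ s - Ψ ξ 0| := by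
      have := abs_add_le (Ψ ξ 0) (Ψ ξ s - Ψ ξ 0); simpa using this
    rw [sub_zero] at h1
    have h3 : N * |s| ≤ N * |R| := by gcongr
    linarith [hM ξ, le_abs_self M]
  lip R := by
    obtain ⟨N, hN, H⟩ := hb R
    exact ⟨N, hN, fun ξ s t hs ht => lip_of_deriv hd H ξ s t hs ht⟩

namespace SupKernel

variable (Ψ Ψ' : SupKernel)

/-- The superposition operator `ζ ↦ Ψ(·, ζ(·))` on `C_b`. -/
def op (ζ : Cb) : Cb :=
  BoundedContinuousFunction.ofNormedAddCommGroup (fun ξ => Ψ.toFun ξ (ζ ξ))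
    (Ψ.cont.comp (continuous_id.prodMk ζ.continuous)) (Ψ.bdd ‖ζ‖).choose
    (fun ξ => (Ψ.bdd ‖ζ‖).choose_spec.2 ξ _ (ζ.norm_coe_le_norm ξ))

theorem op_apply (ζ : Cb) (ξ : ℝ) : Ψ.op ζ ξ = Ψ.toFun ξ (ζ ξ) := rfl

theorem lipBdd_op : LipBdd Ψ.op := by
  intro R
  obtain ⟨K, hK, H⟩ := Ψ.lip R
  refine ⟨K, hK, fun x y hx hy => ?_⟩
  refine (BoundedContinuousFunction.norm_le (by positivity)).2 fun ξ => ?_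
  refine (H ξ _ _ ((x.norm_coe_le_norm ξ).trans hx) ((y.norm_coe_le_norm ξ).trans hy)).trans ?_
  gcongr
  exact (x - y).norm_coe_le_norm ξ

/-- The Lipschitz bound for Ψ' makes the Taylor remainder quadratic in the sup norm, uniformly in ξ.
It is needed to differentiate χ∘y along solutions. -/
theorem hasFDerivAt_op {Ψ Ψ' : SupKernel}
    (hd : ∀ ξ s, HasDerivAt (Ψ.toFun ξ) (Ψ'.toFun ξ s) s) (ζ : Cb) :
    HasFDerivAt Ψ.op (ContinuousLinearMap.mul ℝ Cb (Ψ'.op ζ)) ζ := by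
  rw [hasFDerivAt_iff_isLittleO_nhds_zero]
  obtain ⟨K, hK, H⟩ := Ψ'.lip (‖ζ‖ + 1)
  have hO : (fun v : Cb => Ψ.op (ζ + v) - Ψ.op ζ - ContinuousLinearMap.mul ℝ Cb (Ψ'.op ζ) v)
      =O[𝓝 0] fun v : Cb => ‖v‖ ^ 2 := by
    refine Asymptotics.IsBigO.of_bound K ?_
    filter_upwards [Metric.ball_mem_nhds (0:Cb) one_pos] with v hv
    have hv1 : ‖v‖ ≤ 1 := by simpa using (mem_ball_zero_iff.1 hv).le
    rw [Real.norm_of_nonneg (by positivity)]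
    refine (BoundedContinuousFunction.norm_le (by positivity)).2 fun ξ => ?_
    simp only [BoundedContinuousFunction.coe_sub, Pi.sub_apply, op_apply,
      BoundedContinuousFunction.coe_add, Pi.add_apply, ContinuousLinearMap.mul_apply',
      BoundedContinuousFunction.coe_mul, Pi.mul_apply]
    set s := ζ ξ
    set t := v ξ
    have ht : |t| ≤ ‖v‖ := v.norm_coe_le_norm ξ
    have hs : |s| ≤ ‖ζ‖ := ζ.norm_coe_le_norm ξ
    -- The mean value inequality is applied to Ψ minus its linear part at s, whose derivative is at
    -- most K |t| between s and s + t.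
    have hder : ∀ z ∈ uIcc s (s + t), HasDerivWithinAt
        (fun z => Ψ.toFun ξ z - Ψ'.toFun ξ s * z) (Ψ'.toFun ξ z - Ψ'.toFun ξ s)
        (uIcc s (s + t)) z := fun z _ => by
      have := ((hd ξ z).fun_sub ((hasDerivAt_id z).const_mul (Ψ'.toFun ξ s))).hasDerivWithinAt
        (s := uIcc s (s + t))
      simpa using this
    have hb : ∀ z ∈ uIcc s (s + t), ‖Ψ'.toFun ξ z - Ψ'.toFun ξ s‖ ≤ K * |t| := fun z hz => by
      have hz' : |z - s| ≤ |t| := by simpa using abs_sub_left_of_mem_uIcc hz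
      have hz2 : |z| ≤ ‖ζ‖ + 1 := by
        have := abs_add_le s (z - s); rw [add_sub_cancel] at this; linarith
      refine (H ξ z s hz2 (by linarith)).trans ?_
      gcongr
    have h := (convex_uIcc s (s + t)).norm_image_sub_le_of_norm_hasDerivWithin_le hder hb
      left_mem_uIcc right_mem_uIcc
    have e : Ψ.toFun ξ (s + t) - Ψ'.toFun ξ s * (s + t) - (Ψ.toFun ξ s - Ψ'.toFun ξ s * s) =
      Ψ.toFun ξ (s + t) - Ψ.toFun ξ s - Ψ'.toFun ξ s * t := by ring
    rw [e, add_sub_cancel_left] at h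
    refine h.trans ?_
    rw [Real.norm_eq_abs, mul_assoc, ← pow_two]
    gcongr
  exact hO.trans_isLittleO (Asymptotics.isLittleO_norm_pow_id one_lt_two)

end SupKernel

/-- The kernel `e^s`. -/
def expKernel (σ : ℝ) : SupKernel :=
  .ofDeriv (fun _ s => Real.exp (σ * s)) (fun _ s => σ * Real.exp (σ * s)) (by fun_prop)
    (fun _ s => by
      have := ((hasDerivAt_id s).const_mul σ).exp
      simpa [mul_comm] using this)
    ⟨1, by simp⟩
    (fun R => ⟨|σ| * Real.exp (|σ| * R), by positivity, fun ξ s hs => by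
      rw [abs_mul, Real.abs_exp]
      refine mul_le_mul_of_nonneg_left (Real.exp_le_exp.2 ?_) (abs_nonneg _)
      refine (le_abs_self _).trans ?_
      rw [abs_mul]; gcongr⟩)

/-- A displacement by s changes the exponential weight by at most the factor e^{|s|}, since |ξ| ≤ |ξ
+ s| + |s|. Hence e^{|ξ|} φ(ξ + s) stays bounded for bounded s when φ decays exponentially, and a
bounded superposition operator times e^{-|ξ|} lands in L². -/
theorem exp_abs_le (ξ s : ℝ) : Real.exp |ξ| * Real.exp (-|ξ + s|) ≤ Real.exp |s| := by
  rw [← Real.exp_add]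
  refine Real.exp_le_exp.2 ?_
  have := abs_add_le (ξ + s) (-s)
  rw [add_neg_cancel_right, abs_neg] at this
  linarith

/-- `φ` and its derivative `φ'` decay exponentially. -/
structure ExpDecay (φ φ' : ℝ → ℝ) : Prop where
  deriv : ∀ x, HasDerivAt φ (φ' x) x
  bound : ∃ C, ∀ x, |φ x| ≤ C * Real.exp (-|x|)
  bound' : ∃ C, ∀ x, |φ' x| ≤ C * Real.exp (-|x|)

theorem hasDerivAt_comp_add {φ φ' : ℝ → ℝ} (h : ∀ x, HasDerivAt φ (φ' x) x) (ξ s : ℝ) :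
    HasDerivAt (fun s => φ (ξ + s)) (φ' (ξ + s)) s := by
  simpa using (h (ξ + s)).comp_const_add ξ s

theorem weighted_bound {φ' : ℝ → ℝ} (h : ∃ C, ∀ x, |φ' x| ≤ C * Real.exp (-|x|)) (R : ℝ) :
    ∃ M, 0 ≤ M ∧ ∀ ξ s, |s| ≤ R → |Real.exp |ξ| * φ' (ξ + s)| ≤ M := by
  obtain ⟨C, hC⟩ := h
  refine ⟨|C| * Real.exp R, by positivity, fun ξ s hs => ?_⟩
  rw [abs_mul, Real.abs_exp]
  calc Real.exp |ξ| * |φ' (ξ + s)| ≤ Real.exp |ξ| * (|C| * Real.exp (-|ξ + s|)) := by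
        gcongr
        refine (hC _).trans ?_
        gcongr; exact le_abs_self C
    _ = |C| * (Real.exp |ξ| * Real.exp (-|ξ + s|)) := by ring
    _ ≤ |C| * Real.exp |s| := by gcongr; exact exp_abs_le ξ s
    _ ≤ _ := by gcongr

/-- The kernel `φ(ξ + s)` for a bounded function `φ` with bounded derivative. -/
def shiftKernel (φ φ' : ℝ → ℝ) (hd : ∀ x, HasDerivAt φ (φ' x) x) (hb : ∃ C, ∀ x, |φ x| ≤ C)
    (hb' : ∃ C, ∀ x, |φ' x| ≤ C) : SupKernel :=
  .ofDeriv (fun ξ s => φ (ξ + s)) (fun ξ s => φ' (ξ + s))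
    ((continuous_iff_continuousAt.2 fun x => (hd x).continuousAt).comp
      (continuous_fst.add continuous_snd))
    (hasDerivAt_comp_add hd) (by obtain ⟨C, hC⟩ := hb; exact ⟨C, fun ξ => hC _⟩)
    (fun R => by
      obtain ⟨C, hC⟩ := hb'
      exact ⟨|C|, abs_nonneg _, fun ξ s _ => (hC _).trans (le_abs_self C)⟩)

/-- The kernel `e^{|ξ|} φ(ξ + s)` for an exponentially decaying function `φ`. -/
def weightedKernel (φ φ' : ℝ → ℝ) (h : ExpDecay φ φ') : SupKernel :=
  .ofDeriv (fun ξ s => Real.exp |ξ| * φ (ξ + s)) (fun ξ s => Real.exp |ξ| * φ' (ξ + s))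
    (by
      have : Continuous φ := continuous_iff_continuousAt.2 fun x => (h.deriv x).continuousAt
      fun_prop)
    (fun ξ s => (hasDerivAt_comp_add h.deriv ξ s).const_mul _)
    (by
      obtain ⟨M, -, hM⟩ := weighted_bound h.bound 0
      exact ⟨M, fun ξ => hM ξ 0 (by simp)⟩)
    (weighted_bound h.bound')

/-- The kernel `e^{|ξ|} (φ(ξ + s) - φ(ξ))` for a function `φ` with exponentially decaying
derivative. -/
def diffKernel (φ φ' : ℝ → ℝ) (hd : ∀ x, HasDerivAt φ (φ' x) x)
    (hb : ∃ C, ∀ x, |φ' x| ≤ C * Real.exp (-|x|)) : SupKernel :=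
  .ofDeriv (fun ξ s => Real.exp |ξ| * (φ (ξ + s) - φ ξ)) (fun ξ s => Real.exp |ξ| * φ' (ξ + s))
    (by
      have : Continuous φ := continuous_iff_continuousAt.2 fun x => (hd x).continuousAt
      fun_prop)
    (fun ξ s => ((hasDerivAt_comp_add hd ξ s).sub_const _).const_mul _)
    ⟨0, by simp⟩
    (weighted_bound hb)

/-- The weight `e^{-|ξ|}`. -/
def weight : Cb :=
  BoundedContinuousFunction.ofNormedAddCommGroup (fun ξ : ℝ => Real.exp (-|ξ|)) (by fun_prop) 1
    (fun ξ => by rw [Real.norm_eq_abs, Real.abs_exp]; simp)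

theorem weight_apply (ξ : ℝ) : weight ξ = Real.exp (-|ξ|) := rfl

theorem memLp_weight : MemLp weight 2 (volume : Measure ℝ) := by
  rw [memLp_two_iff_integrable_sq weight.continuous.aestronglyMeasurable]
  have h : (fun x : ℝ => weight x ^ 2) = fun x => Real.exp (-2 * |x|) := by
    funext x
    rw [weight_apply, ← Real.exp_nat_mul]; congr 1; push_cast; ring
  rw [h]
  have h1 : IntegrableOn (fun x : ℝ => Real.exp (-2 * |x|)) (Iic 0) :=
    (integrableOn_exp_mul_Iic two_pos 0).congr_fun (fun x hx => by
      simp only [abs_of_nonpos (mem_Iic.1 hx)]; ring_nf) measurableSet_Iic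
  have h2 : IntegrableOn (fun x : ℝ => Real.exp (-2 * |x|)) (Ioi 0) :=
    (integrableOn_exp_mul_Ioi (by norm_num : (-2:ℝ) < 0) 0).congr_fun (fun x hx => by
      simp only [abs_of_pos (mem_Ioi.1 hx)]) measurableSet_Ioi
  rw [← integrableOn_univ, ← Iic_union_Ioi (a := (0:ℝ))]
  exact h1.union h2

/-- The weight `e^{-|ξ|}` as an element of `L²`. -/
def weightL2 : L2 := memLp_weight.toLp

theorem coeFn_weightL2 : weightL2 =ᵐ[volume] weight := memLp_weight.coeFn_toLp

theorem weight_mul_exp (ξ : ℝ) (r : ℝ) : weight ξ * (Real.exp |ξ| * r) = r := by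
  rw [weight_apply, ← mul_assoc, ← Real.exp_add]; simp

/-! ### The function `g` -/

theorem HasPrim.hasDerivAt {f f' : ℝ → ℝ} (h : HasPrim f f') (hc : Continuous f') (x : ℝ) :
    HasDerivAt f (f' x) x := by
  have h1 : HasDerivAt (fun x => f 0 + ∫ v in (0:ℝ)..x, f' v) (f' x) x :=
    (intervalIntegral.integral_hasDerivAt_right (hc.intervalIntegrable _ _)
      (hc.stronglyMeasurableAtFilter _ _) hc.continuousAt).const_add (f 0)
  have : f = fun x => f 0 + ∫ v in (0:ℝ)..x, f' v := by
    funext x; exact h.eq_add 0 x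
  rwa [← this] at h1

/-- To the left of the support of `f` the integral vanishes; for x ≥ -1 the prefactor e^{-x} is at
most e² e^{-|x|}, and the remaining integral is bounded because `f` vanishes outside [-1, 1]. -/
theorem convLeft_decay {f : L2} (hf : ∀ᵐ x, 1 < |x| → f x = 0) :
    ∃ C, ∀ x, |convLeft f x| ≤ C * Real.exp (-|x|) := by
  have hi : Integrable fun η => Real.exp η * f η := by
    rw [← integrableOn_univ, ← Iic_union_Ioi (a := (1:ℝ))]
    refine (integrableOn_exp_mul f 1).union ?_
    refine (integrable_zero ℝ ℝ (volume.restrict (Ioi (1:ℝ)))).congr ?_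
    filter_upwards [ae_restrict_of_ae hf, ae_restrict_mem measurableSet_Ioi] with x h1 h2
    rw [h1 (lt_abs.2 (Or.inl h2)), mul_zero, Pi.zero_apply]
  set C := ∫ η, |Real.exp η * f η|
  have hC : 0 ≤ C := integral_nonneg fun _ => abs_nonneg _
  refine ⟨C * Real.exp 2, fun x => ?_⟩
  rw [convLeft_apply, expConvFun, abs_mul, Real.abs_exp]
  rcases lt_or_ge x (-1) with hx | hx
  · have : ∫ η in Iic x, Real.exp η * f η = 0 := by
      rw [← integral_zero ℝ ℝ (μ := volume.restrict (Iic x))]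
      refine integral_congr_ae ?_
      filter_upwards [ae_restrict_of_ae hf, ae_restrict_mem measurableSet_Iic] with z h1 h2
      rw [h1 (lt_abs.2 (Or.inr (by have : z ≤ x := h2; linarith))), mul_zero]
    rw [this]; simp; positivity
  · have h1 : |∫ η in Iic x, Real.exp η * f η| ≤ C := by
      refine (abs_integral_le_integral_abs).trans ?_
      exact setIntegral_le_integral hi.abs (Eventually.of_forall fun _ => abs_nonneg _)
    have h2 : Real.exp (-x) ≤ Real.exp 2 * Real.exp (-|x|) := by
      rw [← Real.exp_add]
      refine Real.exp_le_exp.2 ?_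
      rcases abs_cases x with ⟨h, -⟩ | ⟨h, -⟩ <;> rw [h] <;> linarith
    calc Real.exp (-x) * |∫ η in Iic x, Real.exp η * f η|
        ≤ (Real.exp 2 * Real.exp (-|x|)) * C := by gcongr
      _ = _ := by ring

theorem convRight_decay {f : L2} (hf : ∀ᵐ x, 1 < |x| → f x = 0) :
    ∃ C, ∀ x, |convRight f x| ≤ C * Real.exp (-|x|) := by
  have h1 : ∀ᵐ x, 1 < |x| → reflL2 f x = 0 := by
    filter_upwards [coeFn_reflL2 f, ae_neg hf] with x h1 h2 h3
    rw [h1]; exact h2 (by rwa [abs_neg])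
  obtain ⟨C, hC⟩ := convLeft_decay h1
  refine ⟨C, fun x => ?_⟩
  have := hC (-x)
  rwa [abs_neg] at this

namespace IsPartitionFunction

variable {χ : ℝ → ℝ}

theorem hasDerivAt (hχ : IsPartitionFunction χ) (x : ℝ) : HasDerivAt χ (deriv χ x) x :=
  (hχ.smooth.differentiable (by simp)).differentiableAt.hasDerivAt

theorem contDiff_deriv (hχ : IsPartitionFunction χ) : ContDiff ℝ ∞ (deriv χ) :=
    (contDiff_infty_iff_deriv.1 hχ.smooth).2

theorem hasDerivAt_deriv (hχ : IsPartitionFunction χ) (x : ℝ) :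
    HasDerivAt (deriv χ) (deriv (deriv χ) x) x :=
  (hχ.contDiff_deriv.differentiable (by simp)).differentiableAt.hasDerivAt

theorem continuous (hχ : IsPartitionFunction χ) : Continuous χ := hχ.smooth.continuous

theorem continuous_deriv (hχ : IsPartitionFunction χ) : Continuous (deriv χ) :=
    hχ.contDiff_deriv.continuous

theorem continuous_deriv_deriv (hχ : IsPartitionFunction χ) : Continuous (deriv (deriv χ)) :=
  (contDiff_infty_iff_deriv.1 hχ.contDiff_deriv).2.continuous

theorem deriv_eq_zero (hχ : IsPartitionFunction χ) {x : ℝ} (hx : 1 < |x|) : deriv χ x = 0 := by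
  rcases lt_abs.1 hx with h | h
  · have : χ =ᶠ[𝓝 x] fun _ => 1 := by
      filter_upwards [Ioi_mem_nhds h] with z hz using hχ.eq_one z (le_of_lt hz)
    rw [this.deriv_eq]; simp
  · have : χ =ᶠ[𝓝 x] fun _ => 0 := by
      filter_upwards [Iio_mem_nhds (by linarith : x < 0)] with z hz using hχ.eq_zero z (le_of_lt hz)
    rw [this.deriv_eq]; simp

theorem deriv_deriv_eq_zero (hχ : IsPartitionFunction χ) {x : ℝ} (hx : 1 < |x|) :
    deriv (deriv χ) x = 0 := by
  have : deriv χ =ᶠ[𝓝 x] fun _ => 0 := by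
    filter_upwards [(isOpen_lt continuous_const continuous_abs).mem_nhds hx] with z hz
      using hχ.deriv_eq_zero hz
  rw [this.deriv_eq]; simp

theorem monotone (hχ : IsPartitionFunction χ) : Monotone χ :=
  monotone_of_deriv_nonneg (hχ.smooth.differentiable (by simp)) hχ.deriv_nonneg

theorem nonneg (hχ : IsPartitionFunction χ) (x : ℝ) : 0 ≤ χ x := by
  rw [← hχ.eq_zero (min x 0) (min_le_right _ _)]; exact hχ.monotone (min_le_left _ _)

theorem le_one (hχ : IsPartitionFunction χ) (x : ℝ) : χ x ≤ 1 := by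
  rw [← hχ.eq_one (max x 1) (le_max_right _ _)]; exact hχ.monotone (le_max_left _ _)

theorem abs_le_one (hχ : IsPartitionFunction χ) (x : ℝ) : |χ x| ≤ 1 := by
  rw [abs_of_nonneg (hχ.nonneg x)]; exact hχ.le_one x

theorem decay_of_compact {φ : ℝ → ℝ} (hc : Continuous φ) (h : ∀ x, 1 < |x| → φ x = 0) :
    ∃ C, ∀ x, |φ x| ≤ C * Real.exp (-|x|) := by
  obtain ⟨M, hM⟩ := (isCompact_Icc (a := (-1:ℝ)) (b := 1)).exists_bound_of_continuousOn
    hc.continuousOn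
  refine ⟨|M| * Real.exp 1, fun x => ?_⟩
  rcases lt_or_ge 1 |x| with hx | hx
  · rw [h x hx]; simp; positivity
  · calc |φ x| ≤ |M| * 1 := by
          rw [mul_one]; exact (hM x (abs_le.1 hx)).trans (le_abs_self M)
      _ ≤ |M| * (Real.exp 1 * Real.exp (-|x|)) := by
          gcongr
          rw [← Real.exp_add]; exact Real.one_le_exp (by linarith)
      _ = _ := by ring

theorem memLp_of_decay {φ : ℝ → ℝ} (hc : Continuous φ)
    (h : ∃ C, ∀ x, |φ x| ≤ C * Real.exp (-|x|)) : MemLp φ 2 := by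
  obtain ⟨C, hC⟩ := h
  refine memLp_weight.of_le_mul (c := C) hc.aestronglyMeasurable (Eventually.of_forall fun x => ?_)
  rw [Real.norm_eq_abs, weight_apply, Real.norm_eq_abs, Real.abs_exp]
  exact hC x

theorem decay_deriv (hχ : IsPartitionFunction χ) : ∃ C, ∀ x, |deriv χ x| ≤ C * Real.exp (-|x|) :=
  decay_of_compact hχ.continuous_deriv fun _ => hχ.deriv_eq_zero

/-- The source `(χ²)''`. -/
def source (χ : ℝ → ℝ) (z : ℝ) : ℝ := 2 * deriv χ z ^ 2 + 2 * χ z * deriv (deriv χ) z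

theorem continuous_source (hχ : IsPartitionFunction χ) : Continuous (source χ) := by
  have h1 := hχ.continuous
  have h2 := hχ.continuous_deriv
  have h3 := hχ.continuous_deriv_deriv
  unfold source
  fun_prop

theorem source_eq_zero (hχ : IsPartitionFunction χ) {x : ℝ} (hx : 1 < |x|) : source χ x = 0 := by
  simp [source, hχ.deriv_eq_zero hx, hχ.deriv_deriv_eq_zero hx]

theorem memLp_source (hχ : IsPartitionFunction χ) : MemLp (source χ) 2 :=
  memLp_of_decay hχ.continuous_source
    (decay_of_compact hχ.continuous_source fun _ => hχ.source_eq_zero)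

/-- The source as an element of `L²`. -/
def sourceL2 (hχ : IsPartitionFunction χ) : L2 := hχ.memLp_source.toLp

theorem coeFn_sourceL2 (hχ : IsPartitionFunction χ) : hχ.sourceL2 =ᵐ[volume] source χ :=
    hχ.memLp_source.coeFn_toLp

theorem sourceL2_eq_zero (hχ : IsPartitionFunction χ) : ∀ᵐ x, 1 < |x| → hχ.sourceL2 x = 0 := by
  filter_upwards [hχ.coeFn_sourceL2] with x h hx
  rw [h, hχ.source_eq_zero hx]

/-- `½ e^{-|·|} * (χ²)'' = g''`. -/
def gEven (hχ : IsPartitionFunction χ) (x : ℝ) : ℝ := 1 / 2 * (convLeft hχ.sourceL2 x + convRight hχ.sourceL2 x)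

/-- The derivative of `gEven`. -/
def gOdd (hχ : IsPartitionFunction χ) (x : ℝ) : ℝ := 1 / 2 * (convRight hχ.sourceL2 x - convLeft hχ.sourceL2 x)

theorem hasDerivAt_convLeft (hχ : IsPartitionFunction χ) (x : ℝ) : HasDerivAt (convLeft hχ.sourceL2)
    (source χ x - convLeft hχ.sourceL2 x) x := by
  refine HasPrim.hasDerivAt (f' := fun x => source χ x - convLeft hχ.sourceL2 x)
    ((convLeft_hasPrim hχ.sourceL2).congr_right ?_) ?_ x
  · filter_upwards [hχ.coeFn_sourceL2] with x h; rw [h]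
  · exact hχ.continuous_source.sub (convLeft hχ.sourceL2).continuous

theorem hasDerivAt_convRight (hχ : IsPartitionFunction χ) (x : ℝ) :
    HasDerivAt (convRight hχ.sourceL2)
    (convRight hχ.sourceL2 x - source χ x) x := by
  refine HasPrim.hasDerivAt (f' := fun x => convRight hχ.sourceL2 x - source χ x)
    ((convRight_hasPrim hχ.sourceL2).congr_right ?_) ?_ x
  · filter_upwards [hχ.coeFn_sourceL2] with x h; rw [h]
  · exact (convRight hχ.sourceL2).continuous.sub hχ.continuous_source

theorem hasDerivAt_gEven (hχ : IsPartitionFunction χ) (x : ℝ) :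
    HasDerivAt hχ.gEven (hχ.gOdd x) x := by
  have := ((hχ.hasDerivAt_convLeft x).add (hχ.hasDerivAt_convRight x)).const_mul (1 / 2 : ℝ)
  refine this.congr_deriv ?_
  simp only [gOdd]; ring

theorem hasDerivAt_gOdd (hχ : IsPartitionFunction χ) (x : ℝ) :
    HasDerivAt hχ.gOdd (hχ.gEven x - source χ x) x := by
  have := ((hχ.hasDerivAt_convRight x).sub (hχ.hasDerivAt_convLeft x)).const_mul (1 / 2 : ℝ)
  refine this.congr_deriv ?_
  simp only [gEven]; ring

theorem g_eq (hχ : IsPartitionFunction χ) (x : ℝ) : g χ x = χ x ^ 2 + hχ.gEven x := by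
  have h1 : ∀ x, convLeft hχ.sourceL2 x = ∫ z in Iic x, Real.exp (-|x - z|) * source χ z := by
    intro x
    rw [convLeft_eq]
    refine integral_congr_ae ?_
    filter_upwards [ae_restrict_of_ae hχ.coeFn_sourceL2, ae_restrict_mem measurableSet_Iic]
      with z h hz
    rw [h, abs_of_nonneg (by have : z ≤ x := hz; linarith)]
  have h2 : ∀ x, convRight hχ.sourceL2 x = ∫ z in Ioi x, Real.exp (-|x - z|) * source χ z := by
    intro x
    rw [convRight_eq]
    refine integral_congr_ae ?_
    filter_upwards [ae_restrict_of_ae hχ.coeFn_sourceL2, ae_restrict_mem measurableSet_Ioi]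
      with z h hz
    rw [h, abs_of_nonpos (by have : x < z := hz; linarith), neg_neg]
  have hi : Integrable fun z => Real.exp (-|x - z|) * source χ z := by
    refine Continuous.integrable_of_hasCompactSupport ?_ ?_
    · have := hχ.continuous_source
      fun_prop
    · refine HasCompactSupport.of_support_subset_isCompact (isCompact_closedBall (0:ℝ) 1) ?_
      intro z hz
      by_contra h
      simp at h
      exact hz (by simp only [hχ.source_eq_zero h, mul_zero])
  have h3 : g χ x = χ x ^ 2 + 1 / 2 * ∫ z, Real.exp (-|x - z|) * source χ z := rfl
  rw [h3, gEven, h1, h2]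
  congr 2
  exact (intervalIntegral.integral_Iic_add_Ioi hi.integrableOn hi.integrableOn).symm

/-- The derivative of `g`. -/
def gDeriv (hχ : IsPartitionFunction χ) (x : ℝ) : ℝ := 2 * χ x * deriv χ x + hχ.gOdd x

theorem hasDerivAt_g (hχ : IsPartitionFunction χ) (x : ℝ) : HasDerivAt (g χ) (hχ.gDeriv x) x := by
  have h1 : g χ = fun x => χ x ^ 2 + hχ.gEven x := funext hχ.g_eq
  rw [h1]
  have := ((hχ.hasDerivAt x).pow 2).add (hχ.hasDerivAt_gEven x)
  refine this.congr_deriv ?_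
  simp [gDeriv]

/-- The local terms (χ²)'' cancel, leaving the exponentially decaying `gEven`. Together with `g_eq`
this says g - g'' = χ², the identity that removes the c² χ² term from U_ξt. -/
theorem hasDerivAt_gDeriv (hχ : IsPartitionFunction χ) (x : ℝ) :
    HasDerivAt hχ.gDeriv (hχ.gEven x) x := by
  have := (((hχ.hasDerivAt x).const_mul 2).mul (hχ.hasDerivAt_deriv x)).add (hχ.hasDerivAt_gOdd x)
  refine this.congr_deriv ?_
  simp only [source]; ring

theorem decay_gEven (hχ : IsPartitionFunction χ) : ∃ C, ∀ x,
    |hχ.gEven x| ≤ C * Real.exp (-|x|) := by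
  obtain ⟨C, hC⟩ := convLeft_decay hχ.sourceL2_eq_zero
  obtain ⟨D, hD⟩ := convRight_decay hχ.sourceL2_eq_zero
  refine ⟨C + D, fun x => ?_⟩
  have h1 := abs_add_le (convLeft hχ.sourceL2 x) (convRight hχ.sourceL2 x)
  have h2 := abs_nonneg (convLeft hχ.sourceL2 x + convRight hχ.sourceL2 x)
  rw [gEven, abs_mul, abs_of_pos (by norm_num : (0:ℝ) < 1 / 2)]
  linarith [hC x, hD x]

theorem decay_gOdd (hχ : IsPartitionFunction χ) : ∃ C, ∀ x, |hχ.gOdd x| ≤ C * Real.exp (-|x|) := by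
  obtain ⟨C, hC⟩ := convLeft_decay hχ.sourceL2_eq_zero
  obtain ⟨D, hD⟩ := convRight_decay hχ.sourceL2_eq_zero
  refine ⟨C + D, fun x => ?_⟩
  have h1 := abs_sub (convRight hχ.sourceL2 x) (convLeft hχ.sourceL2 x)
  have h2 := abs_nonneg (convRight hχ.sourceL2 x - convLeft hχ.sourceL2 x)
  rw [gOdd, abs_mul, abs_of_pos (by norm_num : (0:ℝ) < 1 / 2)]
  linarith [hC x, hD x]

theorem decay_gDeriv (hχ : IsPartitionFunction χ) : ∃ C, ∀ x,
    |hχ.gDeriv x| ≤ C * Real.exp (-|x|) := by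
  obtain ⟨C, hC⟩ := hχ.decay_gOdd
  obtain ⟨D, hD⟩ := hχ.decay_deriv
  refine ⟨2 * D + C, fun x => ?_⟩
  have h1 := abs_add_le (2 * χ x * deriv χ x) (hχ.gOdd x)
  have h2 : |2 * χ x * deriv χ x| ≤ 2 * |deriv χ x| := by
    rw [abs_mul, abs_mul, abs_two]
    nlinarith [abs_nonneg (deriv χ x), hχ.abs_le_one x, abs_nonneg (χ x)]
  rw [gDeriv]
  linarith [hC x, hD x]

theorem expDecay_gDeriv (hχ : IsPartitionFunction χ) : ExpDecay hχ.gDeriv hχ.gEven :=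
  ⟨hχ.hasDerivAt_gDeriv, hχ.decay_gDeriv, hχ.decay_gEven⟩

theorem expDecay_gEven (hχ : IsPartitionFunction χ) : ExpDecay hχ.gEven hχ.gOdd :=
  ⟨hχ.hasDerivAt_gEven, hχ.decay_gEven, hχ.decay_gOdd⟩

theorem expDecay_deriv (hχ : IsPartitionFunction χ) : ExpDecay (deriv χ) (deriv (deriv χ)) :=
  ⟨hχ.hasDerivAt_deriv, hχ.decay_deriv,
    decay_of_compact hχ.continuous_deriv_deriv fun _ => hχ.deriv_deriv_eq_zero⟩

theorem bound_of_decay {φ : ℝ → ℝ} (h : ∃ C, ∀ x, |φ x| ≤ C * Real.exp (-|x|)) :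
    ∃ C, ∀ x, |φ x| ≤ C := by
  obtain ⟨C, hC⟩ := h
  refine ⟨|C|, fun x => (hC x).trans ?_⟩
  calc C * Real.exp (-|x|) ≤ |C| * 1 := by
        gcongr
        · exact le_abs_self C
        · simp
    _ = _ := mul_one _

theorem bound_g (hχ : IsPartitionFunction χ) : ∃ C, ∀ x, |g χ x| ≤ C := by
  obtain ⟨C, hC⟩ := bound_of_decay hχ.decay_gEven
  refine ⟨1 + C, fun x => ?_⟩
  rw [hχ.g_eq]
  refine (abs_add_le _ _).trans (add_le_add ?_ (hC x))
  rw [abs_pow]; exact pow_le_one₀ (abs_nonneg _) (hχ.abs_le_one x)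

end IsPartitionFunction

/-! ### The components of a state as bounded linear maps -/

/-- The Banach space `E`, with the normed space structure as the only source of instances. -/
def State : Type := E

instance : NormedAddCommGroup State := inferInstanceAs (NormedAddCommGroup E)

instance : NormedSpace ℝ State := inferInstanceAs (NormedSpace ℝ E)

/-- The underlying element of `E`. -/
def State.toE (X : State) : E := X

namespace E

theorem norm_eq (X : State) : ‖X‖ = max ‖(X : E).1‖ (max ‖(X : E).2.1‖ ‖(X : E).2.2‖) := rfl

theorem norm_fst (v : V) : ‖v‖ = ‖v.1.fst‖ + ‖v.1.snd‖ := WithLp.prod_norm_eq_of_L1 v.1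

theorem norm_hinf (U : HInf) : ‖U‖ = ‖U.fst‖ + ‖U.snd‖ := WithLp.prod_norm_eq_of_L1 U

theorem norm_h1 (u : H1) : ‖u‖ = √(‖u.1.fst‖ ^ 2 + ‖u.1.snd‖ ^ 2) :=
  WithLp.prod_norm_eq_of_L2 u.1

/-- `X ↦ ζ`. -/
def zetaCb : State →L[ℝ] Cb :=
  LinearMap.mkContinuous
    { toFun := fun X : State => (X : E).1.1.fst
      map_add' := fun _ _ => rfl
      map_smul' := fun _ _ => rfl } 1 (fun X => by
    have h1 := le_max_left ‖(X : E).1‖ (max ‖(X : E).2.1‖ ‖(X : E).2.2‖)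
    rw [← norm_eq, norm_fst] at h1
    have h2 := norm_nonneg (X : E).1.1.snd
    change ‖(X : E).1.1.fst‖ ≤ _
    linarith)

/-- `X ↦ ζ_ξ`. -/
def zetaD : State →L[ℝ] L2 :=
  LinearMap.mkContinuous
    { toFun := fun X : State => (X : E).1.1.snd
      map_add' := fun _ _ => rfl
      map_smul' := fun _ _ => rfl } 1 (fun X => by
    have h1 := le_max_left ‖(X : E).1‖ (max ‖(X : E).2.1‖ ‖(X : E).2.2‖)
    rw [← norm_eq, norm_fst] at h1
    have h2 := norm_nonneg (X : E).1.1.fst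
    change ‖(X : E).1.1.snd‖ ≤ _
    linarith)

theorem norm_snd_le (X : State) : ‖(X : E).2.1‖ ≤ ‖X‖ :=
  (le_max_left _ _).trans (le_max_right _ _)

/-- `X ↦ u ∈ H¹`, where `U = u + c χ`. -/
def uH1 : State →L[ℝ] H1 :=
  LinearMap.mkContinuous
    { toFun := fun X : State => (X : E).2.1.fst
      map_add' := fun _ _ => rfl
      map_smul' := fun _ _ => rfl } 1 (fun X => by
    have h1 := norm_snd_le X
    rw [norm_hinf] at h1
    have h2 := norm_nonneg (X : E).2.1.snd
    change ‖(X : E).2.1.fst‖ ≤ _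
    linarith)

/-- `X ↦ c`. -/
def cR : State →L[ℝ] ℝ :=
  LinearMap.mkContinuous
    { toFun := fun X : State => (X : E).2.1.snd
      map_add' := fun _ _ => rfl
      map_smul' := fun _ _ => rfl } 1 (fun X => by
    have h1 := norm_snd_le X
    rw [norm_hinf] at h1
    have h2 := norm_nonneg (X : E).2.1.fst
    change ‖(X : E).2.1.snd‖ ≤ _
    linarith)

/-- `X ↦ h`. -/
def hL2 : State →L[ℝ] L2 :=
  LinearMap.mkContinuous
    { toFun := fun X : State => (X : E).2.2
      map_add' := fun _ _ => rfl
      map_smul' := fun _ _ => rfl } 1 (fun X => by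
    rw [one_mul]
    exact (le_max_right _ _).trans (le_max_right _ _))

/-- `X ↦ u ∈ L²`. -/
def uL2 : State →L[ℝ] L2 := WithLp.fstL 2 ℝ L2 L2 ∘L H1Submodule.subtypeL ∘L uH1

/-- `X ↦ u_ξ`. -/
def uD : State →L[ℝ] L2 := WithLp.sndL 2 ℝ L2 L2 ∘L H1Submodule.subtypeL ∘L uH1

theorem norm_le (X : State) :
    ‖X‖ ≤ ‖zetaCb X‖ + ‖zetaD X‖ + ‖uL2 X‖ + ‖uD X‖ + ‖cR X‖ + ‖hL2 X‖ := by
  have e1 : ‖(X : E).1‖ = ‖zetaCb X‖ + ‖zetaD X‖ := norm_fst _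
  have e2 : ‖(X : E).2.1‖ = ‖uH1 X‖ + ‖cR X‖ := norm_hinf _
  have e3 : ‖uH1 X‖ = √(‖uL2 X‖ ^ 2 + ‖uD X‖ ^ 2) := norm_h1 _
  have e4 : ‖uH1 X‖ ≤ ‖uL2 X‖ + ‖uD X‖ := by
    rw [e3]
    refine Real.sqrt_le_iff.2 ⟨by positivity, ?_⟩
    nlinarith [norm_nonneg (uL2 X), norm_nonneg (uD X)]
  have e5 : ‖(X : E).2.2‖ = ‖hL2 X‖ := rfl
  have p1 := norm_nonneg (zetaCb X)
  have p2 := norm_nonneg (zetaD X)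
  have p3 := norm_nonneg (uL2 X)
  have p4 := norm_nonneg (uD X)
  have p5 := norm_nonneg (cR X)
  have p6 := norm_nonneg (hL2 X)
  rw [norm_eq, e1, e2, e5]
  refine max_le ?_ (max_le ?_ ?_) <;> linarith

theorem zeta_eq (X : State) : X.toE.zeta = zetaCb X := rfl
theorem zetaDeriv_eq (X : State) : X.toE.zetaDeriv = zetaD X := rfl
theorem c_eq (X : State) : X.toE.c = cR X := rfl
theorem h_eq (X : State) : X.toE.h = hL2 X := rfl

theorem zeta_hasPrim (X : State) : HasPrim (zetaCb X) (zetaD X) :=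
  X.1.2.hasPrim (zetaCb X).continuous

/-- The state with prescribed components. -/
def mk' (a : Cb) (a' : L2) (ha : HasWeakDeriv a a') (u u' : L2) (hu : HasWeakDeriv u u') (c : ℝ)
    (h : L2) : State :=
  show E from (⟨WithLp.toLp 1 (a, a'), ha⟩, WithLp.toLp 1 (⟨WithLp.toLp 2 (u, u'), hu⟩, c), h)

theorem ext' {X Y : State} (h1 : zetaCb X = zetaCb Y) (h2 : zetaD X = zetaD Y) (h3 : uL2 X = uL2 Y)
    (h4 : uD X = uD Y) (h5 : cR X = cR Y) (h6 : hL2 X = hL2 Y) : X = Y := by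
  obtain ⟨⟨⟨a, a'⟩, ha⟩, ⟨⟨⟨u, u'⟩, hu⟩, c⟩, h⟩ := X
  obtain ⟨⟨⟨b, b'⟩, hb⟩, ⟨⟨⟨v, v'⟩, hv⟩, d⟩, k⟩ := Y
  change a = b at h1
  change a' = b' at h2
  change u = v at h3
  change u' = v' at h4
  change c = d at h5
  change h = k at h6
  subst h1 h2 h3 h4 h5 h6
  rfl

theorem lipBdd_of_components {A : Type*} [NormedAddCommGroup A] {f : A → State}
    (h1 : LipBdd fun x => zetaCb (f x)) (h2 : LipBdd fun x => zetaD (f x))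
    (h3 : LipBdd fun x => uL2 (f x)) (h4 : LipBdd fun x => uD (f x))
    (h5 : LipBdd fun x => cR (f x)) (h6 : LipBdd fun x => hL2 (f x)) : LipBdd f := by
  intro R
  obtain ⟨K1, p1, H1⟩ := h1 R
  obtain ⟨K2, p2, H2⟩ := h2 R
  obtain ⟨K3, p3, H3⟩ := h3 R
  obtain ⟨K4, p4, H4⟩ := h4 R
  obtain ⟨K5, p5, H5⟩ := h5 R
  obtain ⟨K6, p6, H6⟩ := h6 R
  refine ⟨K1 + K2 + K3 + K4 + K5 + K6, by positivity, fun x y hx hy => ?_⟩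
  refine (norm_le _).trans ?_
  simp only [map_sub]
  have := H1 x y hx hy
  have := H2 x y hx hy
  have := H3 x y hx hy
  have := H4 x y hx hy
  have := H5 x y hx hy
  have := H6 x y hx hy
  linarith

end E

open E

/-! ### The functions U and Ū and the density, both bounded and square integrable -/

namespace IsPartitionFunction

variable {χ : ℝ → ℝ} (hχ : IsPartitionFunction χ) (X : State)

/-- `χ ∈ C_b`. -/
def chiCb : Cb := BoundedContinuousFunction.ofNormedAddCommGroup χ hχ.continuous 1 hχ.abs_le_one

/-- `χ' ∈ L²`. -/
def chiD : L2 := (memLp_of_decay hχ.continuous_deriv hχ.decay_deriv).toLp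

theorem coeFn_chiD : hχ.chiD =ᵐ[volume] deriv χ := MemLp.coeFn_toLp _

/-- `X ↦ U ∈ C_b`. -/
def UC : State →L[ℝ] Cb := sobolev ∘L uH1 + cR.smulRight hχ.chiCb

/-- `X ↦ U_ξ ∈ L²`. -/
def UD : State →L[ℝ] L2 := uD + cR.smulRight hχ.chiD

theorem UC_apply (ξ : ℝ) : hχ.UC X ξ = sobolev (uH1 X) ξ + cR X * χ ξ := rfl

theorem U_ae : X.toE.U χ =ᵐ[volume] hχ.UC X := by
  filter_upwards [sobolev_ae (uH1 X)] with ξ h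
  rw [UC_apply, ← h]; rfl

theorem UDeriv_ae : X.toE.UDeriv χ =ᵐ[volume] hχ.UD X := by
  have e : hχ.UD X = uD X + cR X • hχ.chiD := rfl
  rw [e]
  filter_upwards [Lp.coeFn_add (uD X) (cR X • hχ.chiD), Lp.coeFn_smul (cR X) hχ.chiD,
    hχ.coeFn_chiD] with ξ h1 h2 h3
  rw [h1, Pi.add_apply, h2, Pi.smul_apply, h3]; rfl

theorem U_hasPrim : HasPrim (hχ.UC X) (hχ.UD X) := by
  refine ((sobolev_hasPrim (uH1 X)).add ((HasPrim.of_hasDerivAt hχ.hasDerivAt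
    hχ.continuous_deriv).const_mul (cR X))).congr_right ?_
  filter_upwards [hχ.UDeriv_ae X] with ξ h
  rw [← h]; rfl

/-- `χ ∘ y ∈ C_b`. -/
def chiY : Cb :=
  (shiftKernel χ (deriv χ) hχ.hasDerivAt ⟨1, hχ.abs_le_one⟩ (bound_of_decay hχ.decay_deriv)).op
    (zetaCb X)

theorem chiY_apply (ξ : ℝ) : hχ.chiY X ξ = χ (X.toE.y ξ) := rfl

/-- The kernel `e^{|ξ|} (χ(ξ + s) - χ(ξ))`. -/
def chiDiffKernel : SupKernel := diffKernel χ (deriv χ) hχ.hasDerivAt hχ.decay_deriv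

/-- `e^{|ξ|} (χ ∘ y - χ) ∈ C_b`. -/
def chiDiff : Cb := hχ.chiDiffKernel.op (zetaCb X)

theorem chiDiff_apply (ξ : ℝ) : hχ.chiDiff X ξ = Real.exp |ξ| * (χ (X.toE.y ξ) - χ ξ) := rfl

/-- `Ū ∈ C_b`. -/
def UbarC : Cb := hχ.UC X - cR X • hχ.chiY X

/-- `Ū ∈ L²`. -/
def UbarL : L2 := uL2 X - cR X • mulL2 (hχ.chiDiff X) weightL2

theorem UbarC_apply (ξ : ℝ) : hχ.UbarC X ξ = hχ.UC X ξ - cR X * χ (X.toE.y ξ) := rfl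

theorem UbarC_ae : X.toE.Ubar χ =ᵐ[volume] hχ.UbarC X := by
  filter_upwards [hχ.U_ae X] with ξ h
  rw [UbarC_apply, ← h]; rfl

/-- Ū = u - c (χ∘y - χ), and the difference χ∘y - χ is e^{-|ξ|} times a bounded function; neither
χ∘y nor χ alone is square integrable. -/
theorem UbarL_ae : hχ.UbarL X =ᵐ[volume] hχ.UbarC X := by
  have h0 := sobolev_ae (uH1 X)
  filter_upwards [h0, Lp.coeFn_sub (uL2 X) (cR X • mulL2 (hχ.chiDiff X) weightL2),
    Lp.coeFn_smul (cR X) (mulL2 (hχ.chiDiff X) weightL2), coeFn_mulL2 (hχ.chiDiff X) weightL2,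
    coeFn_weightL2] with ξ h h1 h2 h3 h4
  have h' : uL2 X ξ = sobolev (uH1 X) ξ := h
  rw [UbarL, h1, Pi.sub_apply, h2, Pi.smul_apply, h3, h4, UbarC_apply, UC_apply, h',
    mul_comm (hχ.chiDiff X ξ), chiDiff_apply, weight_mul_exp, smul_eq_mul]
  ring

/-- The density as an element of `L²`. -/
def dens : L2 :=
  (2 : ℝ) • mulL2 (hχ.UC X * hχ.UC X - (cR X * cR X) • (hχ.chiY X * hχ.chiY X)) (zetaD X) + hL2 X +
    (2 : ℝ) • mulL2 (hχ.UC X + cR X • hχ.chiY X) (hχ.UbarL X)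

/-- The factorization 2 Ū² + 4 c Ū χ∘y = 2 (U - c χ∘y)(U + c χ∘y) turns the density into a
difference of squares times y_ξ. In `dens` the constant 1 in y_ξ = 1 + ζ_ξ multiplies the factored
form with Ū in L², while ζ_ξ in L² takes the bounded form. -/
theorem dens_ae' : hχ.dens X =ᵐ[volume] fun ξ =>
    2 * (hχ.UC X ξ ^ 2 - cR X ^ 2 * χ (X.toE.y ξ) ^ 2) * (1 + zetaD X ξ) + hL2 X ξ := by
  set A := hχ.UC X * hχ.UC X - (cR X * cR X) • (hχ.chiY X * hχ.chiY X) with hA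
  set B := hχ.UC X + cR X • hχ.chiY X with hB
  have e : hχ.dens X = ((2 : ℝ) • mulL2 A (zetaD X) + hL2 X) + (2 : ℝ) • mulL2 B (hχ.UbarL X) := rfl
  rw [e]
  filter_upwards [Lp.coeFn_add ((2 : ℝ) • mulL2 A (zetaD X) + hL2 X)
    ((2 : ℝ) • mulL2 B (hχ.UbarL X)), Lp.coeFn_add ((2 : ℝ) • mulL2 A (zetaD X)) (hL2 X),
    Lp.coeFn_smul (2:ℝ) (mulL2 A (zetaD X)), Lp.coeFn_smul (2:ℝ) (mulL2 B (hχ.UbarL X)),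
    coeFn_mulL2 A (zetaD X), coeFn_mulL2 B (hχ.UbarL X), hχ.UbarL_ae X]
    with ξ h1 h2 h3 h4 h5 h6 h7
  rw [h1, Pi.add_apply, h2, Pi.add_apply, h3, h4, Pi.smul_apply, Pi.smul_apply, h5, h6, h7]
  have eA : A ξ = hχ.UC X ξ * hχ.UC X ξ - (cR X * cR X) * (χ (X.toE.y ξ) * χ (X.toE.y ξ)) := rfl
  have eB : B ξ = hχ.UC X ξ + cR X * χ (X.toE.y ξ) := rfl
  rw [eA, eB, UbarC_apply, smul_eq_mul, smul_eq_mul]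
  ring

theorem dens_ae : X.toE.density χ =ᵐ[volume] hχ.dens X := by
  filter_upwards [hχ.dens_ae' X, hχ.UbarC_ae X] with ξ h1 h2
  rw [h1, density, h2, UbarC_apply]
  simp only [yDeriv, zetaDeriv_eq, c_eq, h_eq]
  ring

end IsPartitionFunction

/-! ### Kernel integrals as conjugated exponential convolutions -/

/-- `e^{σ ζ}`. -/
def expZ (σ : ℝ) (X : State) : Cb := (expKernel σ).op (zetaCb X)

theorem expZ_apply (σ : ℝ) (X : State) (ξ : ℝ) : expZ σ X ξ = Real.exp (σ * zetaCb X ξ) := rfl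

theorem lipBdd_expZ (σ : ℝ) : LipBdd fun X : State => expZ σ X :=
    (expKernel σ).lipBdd_op.comp (LipBdd.clm zetaCb)

theorem expZ_hasPrim (σ : ℝ) (X : State) :
    HasPrim (expZ σ X) (fun ξ => σ * expZ σ X ξ * zetaD X ξ) := by
  refine HasPrim.comp (φ := fun s => Real.exp (σ * s)) (φ' := fun s => σ * Real.exp (σ * s))
    (fun x => ?_) (by fun_prop) (zeta_hasPrim X)
  have := ((hasDerivAt_id x).const_mul σ).exp
  simpa [mul_comm] using this

theorem expZ_mul (X : State) (ξ : ℝ) : expZ (-1) X ξ * expZ 1 X ξ = 1 := by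
  rw [expZ_apply, expZ_apply, ← Real.exp_add]; simp

/-- `∫_{-∞}^ξ e^{-(y(ξ)-y(η))} D(η) dη`, as a bounded continuous function. -/
def leftC (X : State) (D : L2) : Cb := expZ (-1) X * convLeft (mulL2 (expZ 1 X) D)

/-- `∫_{-∞}^ξ e^{-(y(ξ)-y(η))} D(η) dη`, as an element of `L²`. -/
def leftL (X : State) (D : L2) : L2 := mulL2 (expZ (-1) X) (convLeftL2 (mulL2 (expZ 1 X) D))

/-- `∫_ξ^∞ e^{-(y(η)-y(ξ))} D(η) dη`, as a bounded continuous function. -/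
def rightC (X : State) (D : L2) : Cb := expZ 1 X * convRight (mulL2 (expZ (-1) X) D)

/-- `∫_ξ^∞ e^{-(y(η)-y(ξ))} D(η) dη`, as an element of `L²`. -/
def rightL (X : State) (D : L2) : L2 := mulL2 (expZ 1 X) (convRightL2 (mulL2 (expZ (-1) X) D))

theorem leftL_ae (X : State) (D : L2) : leftL X D =ᵐ[volume] leftC X D := by
  filter_upwards [coeFn_mulL2 (expZ (-1) X) (convLeftL2 (mulL2 (expZ 1 X) D)),
    coeFn_convLeftL2 (mulL2 (expZ 1 X) D)] with ξ h1 h2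
  rw [leftL, h1, h2]; rfl

theorem rightL_ae (X : State) (D : L2) : rightL X D =ᵐ[volume] rightC X D := by
  filter_upwards [coeFn_mulL2 (expZ 1 X) (convRightL2 (mulL2 (expZ (-1) X) D)),
    coeFn_convRightL2 (mulL2 (expZ (-1) X) D)] with ξ h1 h2
  rw [rightL, h1, h2]; rfl

/-- The factor e^{-ζ} contributes -ζ_ξ and the convolution contributes -1, which combine to -y_ξ; in
front of `D` the factors e^{-ζ} and e^{ζ} cancel. -/
theorem leftC_hasPrim (X : State) (D : L2) :
    HasPrim (leftC X D) (fun ξ => D ξ - (1 + zetaD X ξ) * leftC X D ξ) := by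
  refine ((expZ_hasPrim (-1) X).mul (convLeft_hasPrim (mulL2 (expZ 1 X) D))).congr_right ?_
  filter_upwards [coeFn_mulL2 (expZ 1 X) D] with ξ h
  rw [h]
  have e : leftC X D ξ = expZ (-1) X ξ * convLeft (mulL2 (expZ 1 X) D) ξ := rfl
  rw [e]
  linear_combination (D ξ) * expZ_mul X ξ

theorem rightC_hasPrim (X : State) (D : L2) :
    HasPrim (rightC X D) (fun ξ => (1 + zetaD X ξ) * rightC X D ξ - D ξ) := by
  refine ((expZ_hasPrim 1 X).mul (convRight_hasPrim (mulL2 (expZ (-1) X) D))).congr_right ?_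
  filter_upwards [coeFn_mulL2 (expZ (-1) X) D] with ξ h
  rw [h]
  have e : rightC X D ξ = expZ 1 X ξ * convRight (mulL2 (expZ (-1) X) D) ξ := rfl
  rw [e]
  linear_combination -(D ξ) * expZ_mul X ξ

/-- For η < ξ the kernel splits as e^{-ζ(ξ)} e^{-(ξ-η)} e^{ζ(η)}. No monotonicity of y enters,
because the kernel carries sgn(ξ - η) instead of an absolute value. -/
theorem leftC_eq (X : State) (D : L2) (ξ : ℝ) :
    IntegrableOn (fun η => kernel X.toE.y ξ η * D η) (Iic ξ) ∧
    leftC X D ξ = ∫ η in Iic ξ, kernel X.toE.y ξ η * D η := by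
  have h1 : ∀ᵐ η ∂volume.restrict (Iic ξ), expZ (-1) X ξ *
      (Real.exp (-(ξ - η)) * mulL2 (expZ 1 X) D η) = kernel X.toE.y ξ η * D η := by
    filter_upwards [ae_restrict_of_ae (coeFn_mulL2 (expZ 1 X) D),
      ae_restrict_mem measurableSet_Iic] with η h hη
    rw [h, expZ_apply, expZ_apply, ← mul_assoc, ← mul_assoc, ← Real.exp_add, ← Real.exp_add, kernel]
    congr 2
    rcases eq_or_lt_of_le (mem_Iic.1 hη) with e | e
    · subst e; simp
    · rw [Real.sign_of_pos (by linarith)]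
      simp only [y, zeta_eq]; ring
  refine ⟨((integrableOn_convLeft (mulL2 (expZ 1 X) D) ξ).const_mul (expZ (-1) X ξ)).congr h1, ?_⟩
  rw [← integral_congr_ae h1, integral_const_mul, ← convLeft_eq]; rfl

theorem rightC_eq (X : State) (D : L2) (ξ : ℝ) :
    IntegrableOn (fun η => kernel X.toE.y ξ η * D η) (Ioi ξ) ∧
    rightC X D ξ = ∫ η in Ioi ξ, kernel X.toE.y ξ η * D η := by
  have h1 : ∀ᵐ η ∂volume.restrict (Ioi ξ), expZ 1 X ξ *
      (Real.exp (ξ - η) * mulL2 (expZ (-1) X) D η) = kernel X.toE.y ξ η * D η := by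
    filter_upwards [ae_restrict_of_ae (coeFn_mulL2 (expZ (-1) X) D),
      ae_restrict_mem measurableSet_Ioi] with η h hη
    rw [h, expZ_apply, expZ_apply, ← mul_assoc, ← mul_assoc, ← Real.exp_add, ← Real.exp_add, kernel]
    congr 2
    have e : ξ < η := hη
    rw [Real.sign_of_neg (by linarith)]
    simp only [y, zeta_eq]; ring
  refine ⟨((integrableOn_convRight (mulL2 (expZ (-1) X) D) ξ).const_mul (expZ 1 X ξ)).congr h1, ?_⟩
  rw [← integral_congr_ae h1, integral_const_mul, ← convRight_eq]; rfl

theorem integral_kernel (X : State) (D : L2) (ξ : ℝ) :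
    ∫ η, kernel X.toE.y ξ η * D η = leftC X D ξ + rightC X D ξ := by
  rw [(leftC_eq X D ξ).2, (rightC_eq X D ξ).2]
  exact (intervalIntegral.integral_Iic_add_Ioi (leftC_eq X D ξ).1 (rightC_eq X D ξ).1).symm

theorem integral_sign_kernel (X : State) (D : L2) (ξ : ℝ) :
    ∫ η, Real.sign (ξ - η) * kernel X.toE.y ξ η * D η = leftC X D ξ - rightC X D ξ := by
  have h1 : ∀ᵐ η ∂volume.restrict (Iic ξ), kernel X.toE.y ξ η * D η =
      Real.sign (ξ - η) * kernel X.toE.y ξ η * D η := by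
    filter_upwards [ae_restrict_mem measurableSet_Iic,
      ae_restrict_of_ae (Measure.ae_ne volume ξ)] with η hη hne
    rw [Real.sign_of_pos (by have := lt_of_le_of_ne (mem_Iic.1 hη) hne; linarith), one_mul]
  have h2 : ∀ᵐ η ∂volume.restrict (Ioi ξ), -(kernel X.toE.y ξ η * D η) =
      Real.sign (ξ - η) * kernel X.toE.y ξ η * D η := by
    filter_upwards [ae_restrict_mem measurableSet_Ioi] with η hη
    rw [Real.sign_of_neg (by have : ξ < η := hη; linarith)]; ring
  rw [← intervalIntegral.integral_Iic_add_Ioi (b := ξ) ((leftC_eq X D ξ).1.congr h1)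
    ((rightC_eq X D ξ).1.neg.congr h2), ← integral_congr_ae h1, ← integral_congr_ae h2,
    integral_neg, ← (leftC_eq X D ξ).2, ← (rightC_eq X D ξ).2]
  ring

section LipBdd

variable {D : State → L2}

theorem lipBdd_leftC (h : LipBdd D) : LipBdd fun X : State => leftC X (D X) :=
  (lipBdd_expZ _).mulCb ((LipBdd.clm convLeft).comp (LipBdd.bilin mulL2 (lipBdd_expZ _) h))

theorem lipBdd_leftL (h : LipBdd D) : LipBdd fun X : State => leftL X (D X) :=
  LipBdd.bilin mulL2 (lipBdd_expZ _)
    ((LipBdd.clm convLeftL2).comp (LipBdd.bilin mulL2 (lipBdd_expZ _) h))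

theorem lipBdd_rightC (h : LipBdd D) : LipBdd fun X : State => rightC X (D X) :=
  (lipBdd_expZ _).mulCb ((LipBdd.clm convRight).comp (LipBdd.bilin mulL2 (lipBdd_expZ _) h))

theorem lipBdd_rightL (h : LipBdd D) : LipBdd fun X : State => rightL X (D X) :=
  LipBdd.bilin mulL2 (lipBdd_expZ _)
    ((LipBdd.clm convRightL2).comp (LipBdd.bilin mulL2 (lipBdd_expZ _) h))

end LipBdd

/-! ### P, Q and their derivatives -/

namespace IsPartitionFunction

variable {χ : ℝ → ℝ} (hχ : IsPartitionFunction χ) (X : State)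

/-- `g ∘ y ∈ C_b`. -/
def gY : Cb :=
  (shiftKernel (g χ) hχ.gDeriv hχ.hasDerivAt_g hχ.bound_g (bound_of_decay hχ.decay_gDeriv)).op
    (zetaCb X)

/-- `e^{|ξ|} g' ∘ y ∈ C_b`. -/
def gY1 : Cb := (weightedKernel _ _ hχ.expDecay_gDeriv).op (zetaCb X)

/-- `e^{|ξ|} g'' ∘ y ∈ C_b`. -/
def gY2 : Cb := (weightedKernel _ _ hχ.expDecay_gEven).op (zetaCb X)

/-- `P ∈ C_b`. -/
def PC : Cb :=
  (1 / 4 : ℝ) • (leftC X (hχ.dens X) + rightC X (hχ.dens X)) + (cR X * cR X) • hχ.gY X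

/-- `Q ∈ C_b`. -/
def QC : Cb :=
  (1 / 4 : ℝ) • (rightC X (hχ.dens X) - leftC X (hχ.dens X)) +
    (cR X * cR X) • (weight * hχ.gY1 X)

/-- `Q ∈ L²`. -/
def QL : L2 :=
  (1 / 4 : ℝ) • (rightL X (hχ.dens X) - leftL X (hχ.dens X)) +
    (cR X * cR X) • mulL2 (hχ.gY1 X) weightL2

/-- `Q_ξ ∈ L²`. -/
def QD : L2 :=
  (1 / 4 : ℝ) • (mulL2 (leftC X (hχ.dens X) + rightC X (hχ.dens X)) (zetaD X) +
      (leftL X (hχ.dens X) + rightL X (hχ.dens X))) - (1 / 2 : ℝ) • hχ.dens X +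
    (cR X * cR X) • (mulL2 (weight * hχ.gY2 X) (zetaD X) + mulL2 (hχ.gY2 X) weightL2)

theorem PC_apply (ξ : ℝ) : hχ.PC X ξ =
    1 / 4 * (leftC X (hχ.dens X) ξ + rightC X (hχ.dens X) ξ) + cR X * cR X * g χ (X.toE.y ξ) := rfl

theorem QC_apply (ξ : ℝ) : hχ.QC X ξ =
    1 / 4 * (rightC X (hχ.dens X) ξ - leftC X (hχ.dens X) ξ) + cR X * cR X * hχ.gDeriv (X.toE.y ξ) := by
  have e : hχ.QC X ξ = 1 / 4 * (rightC X (hχ.dens X) ξ - leftC X (hχ.dens X) ξ) +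
    cR X * cR X * (weight ξ * (Real.exp |ξ| * hχ.gDeriv (X.toE.y ξ))) := rfl
  rw [e, weight_mul_exp]

theorem P_eq (ξ : ℝ) : X.toE.P χ ξ = hχ.PC X ξ := by
  have h : ∫ η, kernel X.toE.y ξ η * X.toE.density χ η = ∫ η, kernel X.toE.y ξ η * hχ.dens X η :=
    integral_congr_ae (by filter_upwards [hχ.dens_ae X] with η h; rw [h])
  rw [E.P, h, integral_kernel, PC_apply, c_eq, sq]

theorem Q_eq (ξ : ℝ) : X.toE.Q χ ξ = hχ.QC X ξ := by
  have h : ∫ η, Real.sign (ξ - η) * kernel X.toE.y ξ η * X.toE.density χ η =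
      ∫ η, Real.sign (ξ - η) * kernel X.toE.y ξ η * hχ.dens X η :=
    integral_congr_ae (by filter_upwards [hχ.dens_ae X] with η h; rw [h])
  rw [E.Q, h, integral_sign_kernel, QC_apply, c_eq, (hχ.hasDerivAt_g _).deriv]
  ring

theorem QL_ae : hχ.QL X =ᵐ[volume] hχ.QC X := by
  set a := rightL X (hχ.dens X) - leftL X (hχ.dens X) with ha
  set b := mulL2 (hχ.gY1 X) weightL2 with hb
  have e : hχ.QL X = (1 / 4 : ℝ) • a + (cR X * cR X) • b := rfl
  rw [e]
  filter_upwards [Lp.coeFn_add ((1 / 4 : ℝ) • a) ((cR X * cR X) • b), Lp.coeFn_smul (1 / 4 : ℝ) a,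
    Lp.coeFn_smul (cR X * cR X) b, Lp.coeFn_sub (rightL X (hχ.dens X)) (leftL X (hχ.dens X)),
    coeFn_mulL2 (hχ.gY1 X) weightL2, coeFn_weightL2, leftL_ae X (hχ.dens X),
    rightL_ae X (hχ.dens X)] with ξ h1 h2 h3 h4 h5 h6 h7 h8
  rw [h1, Pi.add_apply, h2, h3, Pi.smul_apply, Pi.smul_apply, ha, hb, h4, Pi.sub_apply, h5, h6, h7,
    h8, smul_eq_mul, smul_eq_mul, mul_comm (hχ.gY1 X ξ)]
  rfl

/-- Each product with y_ξ = 1 + ζ_ξ is split in `QD`: the summand 1 takes the L² version of the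
other factor, and ζ_ξ takes its bounded version. The pointwise formula recombines the two. -/
theorem QD_ae : hχ.QD X =ᵐ[volume] fun ξ =>
    1 / 4 * ((1 + zetaD X ξ) * (leftC X (hχ.dens X) ξ + rightC X (hχ.dens X) ξ)) -
      1 / 2 * hχ.dens X ξ + cR X * cR X * (hχ.gEven (X.toE.y ξ) * (1 + zetaD X ξ)) := by
  set A := leftC X (hχ.dens X) + rightC X (hχ.dens X) with hA
  set B := leftL X (hχ.dens X) + rightL X (hχ.dens X) with hB
  set C := mulL2 (weight * hχ.gY2 X) (zetaD X) with hC
  set D := mulL2 (hχ.gY2 X) weightL2 with hD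
  have e : hχ.QD X = ((1 / 4 : ℝ) • (mulL2 A (zetaD X) + B) - (1 / 2 : ℝ) • hχ.dens X) +
    (cR X * cR X) • (C + D) := rfl
  rw [e]
  filter_upwards [Lp.coeFn_add ((1 / 4 : ℝ) • (mulL2 A (zetaD X) + B) - (1 / 2 : ℝ) • hχ.dens X)
    ((cR X * cR X) • (C + D)), Lp.coeFn_sub ((1 / 4 : ℝ) • (mulL2 A (zetaD X) + B))
    ((1 / 2 : ℝ) • hχ.dens X), Lp.coeFn_smul (1 / 4 : ℝ) (mulL2 A (zetaD X) + B),
    Lp.coeFn_smul (1 / 2 : ℝ) (hχ.dens X), Lp.coeFn_smul (cR X * cR X) (C + D),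
    Lp.coeFn_add C D, Lp.coeFn_add (mulL2 A (zetaD X)) B, coeFn_mulL2 A (zetaD X),
    Lp.coeFn_add (leftL X (hχ.dens X)) (rightL X (hχ.dens X)), leftL_ae X (hχ.dens X),
    rightL_ae X (hχ.dens X), coeFn_mulL2 (weight * hχ.gY2 X) (zetaD X),
    coeFn_mulL2 (hχ.gY2 X) weightL2, coeFn_weightL2]
    with ξ h1 h2 h3 h4 h5 h6 h7 h8 h9 h10 h11 h12 h13 h14
  rw [h1, Pi.add_apply, h2, Pi.sub_apply, h3, h4, h5, Pi.smul_apply, Pi.smul_apply, Pi.smul_apply,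
    h6, Pi.add_apply, h7, Pi.add_apply, h8, hB, h9, Pi.add_apply, h10, h11, hC, hD, h12, h13, h14]
  have hw := weight_mul_exp ξ (hχ.gEven (X.toE.y ξ))
  have e1 : (weight * hχ.gY2 X) ξ = weight ξ * (Real.exp |ξ| * hχ.gEven (X.toE.y ξ)) := rfl
  have e2 : hχ.gY2 X ξ = Real.exp |ξ| * hχ.gEven (X.toE.y ξ) := rfl
  have e3 : A ξ = leftC X (hχ.dens X) ξ + rightC X (hχ.dens X) ξ := rfl
  rw [e1, hw, e2, mul_comm (Real.exp |ξ| * _), hw, e3]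
  simp only [smul_eq_mul]
  ring

theorem y_hasPrim : HasPrim X.toE.y (fun ξ => 1 + zetaD X ξ) :=
  HasPrim.id.add (zeta_hasPrim X)

theorem QC_hasPrim : HasPrim (hχ.QC X) (hχ.QD X) := by
  have h1 := ((rightC_hasPrim X (hχ.dens X)).sub (leftC_hasPrim X (hχ.dens X))).const_mul (1 / 4)
  have hc : Continuous hχ.gEven :=
    continuous_iff_continuousAt.2 fun x => (hχ.hasDerivAt_gEven x).continuousAt
  have h2 := (HasPrim.comp hχ.hasDerivAt_gDeriv hc (y_hasPrim X)).const_mul (cR X * cR X)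
  have h3 := h1.add h2
  have e : (hχ.QC X : ℝ → ℝ) = fun ξ =>
    1 / 4 * (rightC X (hχ.dens X) ξ - leftC X (hχ.dens X) ξ) +
      cR X * cR X * hχ.gDeriv (X.toE.y ξ) := funext (hχ.QC_apply X)
  rw [e]
  refine h3.congr_right ?_
  filter_upwards [hχ.QD_ae X] with ξ h
  rw [h]; ring

theorem Q_hasWeakDeriv : HasWeakDeriv (hχ.QL X) (hχ.QD X) :=
  (hχ.QC_hasPrim X).hasWeakDeriv.congr (hχ.QL_ae X).symm (ae_eq_refl _)

/-- The densities cancel between the left and right integrals, so P_ξ = Q y_ξ. This relation makes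
the energy balance a conservation law up to the transition terms. -/
theorem PC_hasPrim : HasPrim (hχ.PC X) (fun ξ => hχ.QC X ξ * (1 + zetaD X ξ)) := by
  have h1 := ((leftC_hasPrim X (hχ.dens X)).add (rightC_hasPrim X (hχ.dens X))).const_mul (1 / 4)
  have hc : Continuous hχ.gDeriv :=
    continuous_iff_continuousAt.2 fun x => (hχ.hasDerivAt_gDeriv x).continuousAt
  have h2 := (HasPrim.comp hχ.hasDerivAt_g hc (y_hasPrim X)).const_mul (cR X * cR X)
  refine (h1.add h2).congr_right (Eventually.of_forall fun ξ => ?_)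
  simp only [hχ.QC_apply X]; ring

end IsPartitionFunction

open E

theorem HasWeakDeriv.neg {f k : ℝ → ℝ} (h : HasWeakDeriv f k) : HasWeakDeriv (-f) (-k) := by
  simpa using h.const_smul (-1)

namespace IsPartitionFunction

variable {χ : ℝ → ℝ} (hχ : IsPartitionFunction χ)

/-! ### The vector field -/

/-- The right-hand side of the system, as a vector field on the state space. -/
def field (X : State) : State :=
  E.mk' (hχ.UC X) (hχ.UD X) (hχ.U_hasPrim X).hasWeakDeriv (-hχ.QL X) (-hχ.QD X)
    ((hχ.Q_hasWeakDeriv X).neg.congr (Lp.coeFn_neg _).symm (Lp.coeFn_neg _).symm) 0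
    ((2 : ℝ) • mulL2 (hχ.UC X * hχ.UC X - hχ.PC X) (hχ.UD X))

theorem zetaCb_field (X : State) : zetaCb (hχ.field X) = hχ.UC X := rfl
theorem zetaD_field (X : State) : zetaD (hχ.field X) = hχ.UD X := rfl
theorem uL2_field (X : State) : uL2 (hχ.field X) = -hχ.QL X := rfl
theorem uD_field (X : State) : uD (hχ.field X) = -hχ.QD X := rfl
theorem cR_field (X : State) : cR (hχ.field X) = 0 := rfl
theorem hL2_field (X : State) : hL2 (hχ.field X) =
    (2 : ℝ) • mulL2 (hχ.UC X * hχ.UC X - hχ.PC X) (hχ.UD X) := rfl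

theorem lipBdd_UC : LipBdd fun X : State => hχ.UC X := LipBdd.clm hχ.UC

theorem lipBdd_UD : LipBdd fun X : State => hχ.UD X := LipBdd.clm hχ.UD

theorem lipBdd_op (Ψ : SupKernel) : LipBdd fun X : State => Ψ.op (zetaCb X) :=
  Ψ.lipBdd_op.comp (LipBdd.clm zetaCb)

theorem lipBdd_cR : LipBdd fun X : State => cR X := LipBdd.clm cR

theorem lipBdd_cR_sq : LipBdd fun X : State => cR X * cR X := lipBdd_cR.mulReal lipBdd_cR

theorem lipBdd_chiY : LipBdd fun X : State => hχ.chiY X := lipBdd_op _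

theorem lipBdd_UbarC : LipBdd fun X : State => hχ.UbarC X :=
  hχ.lipBdd_UC.sub (lipBdd_cR.smul hχ.lipBdd_chiY)

theorem lipBdd_UbarL : LipBdd fun X : State => hχ.UbarL X :=
  (LipBdd.clm uL2).sub
    (lipBdd_cR.smul (LipBdd.bilin mulL2 (lipBdd_op hχ.chiDiffKernel) (LipBdd.const weightL2)))

theorem lipBdd_dens : LipBdd fun X : State => hχ.dens X := by
  refine (LipBdd.add (LipBdd.const_smul 2 (LipBdd.bilin mulL2 ?_ (LipBdd.clm zetaD)))
    (LipBdd.clm hL2)).add (LipBdd.const_smul 2 (LipBdd.bilin mulL2 ?_ hχ.lipBdd_UbarL))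
  · exact (hχ.lipBdd_UC.mulCb hχ.lipBdd_UC).sub
      (lipBdd_cR_sq.smul (hχ.lipBdd_chiY.mulCb hχ.lipBdd_chiY))
  · exact hχ.lipBdd_UC.add (lipBdd_cR.smul hχ.lipBdd_chiY)

theorem lipBdd_PC : LipBdd fun X : State => hχ.PC X :=
  (LipBdd.const_smul (1 / 4) ((lipBdd_leftC hχ.lipBdd_dens).add
    (lipBdd_rightC hχ.lipBdd_dens))).add (lipBdd_cR_sq.smul (lipBdd_op _))

theorem lipBdd_QL : LipBdd fun X : State => hχ.QL X :=
  (LipBdd.const_smul (1 / 4) ((lipBdd_rightL hχ.lipBdd_dens).sub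
    (lipBdd_leftL hχ.lipBdd_dens))).add
    (lipBdd_cR_sq.smul (LipBdd.bilin mulL2 (lipBdd_op _) (LipBdd.const weightL2)))

theorem lipBdd_QD : LipBdd fun X : State => hχ.QD X := by
  refine (LipBdd.sub (LipBdd.const_smul (1 / 4) (LipBdd.add (LipBdd.bilin mulL2
    ((lipBdd_leftC hχ.lipBdd_dens).add (lipBdd_rightC hχ.lipBdd_dens)) (LipBdd.clm zetaD))
    ((lipBdd_leftL hχ.lipBdd_dens).add (lipBdd_rightL hχ.lipBdd_dens))))
    (LipBdd.const_smul (1 / 2) hχ.lipBdd_dens)).add (lipBdd_cR_sq.smul (LipBdd.add ?_ ?_))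
  · exact LipBdd.bilin mulL2 ((LipBdd.const weight).mulCb (lipBdd_op _)) (LipBdd.clm zetaD)
  · exact LipBdd.bilin mulL2 (lipBdd_op _) (LipBdd.const weightL2)

theorem lipBdd_coeff : LipBdd fun X : State => hχ.UC X * hχ.UC X - hχ.PC X :=
  (hχ.lipBdd_UC.mulCb hχ.lipBdd_UC).sub hχ.lipBdd_PC

theorem lipBdd_field : LipBdd hχ.field :=
  lipBdd_of_components hχ.lipBdd_UC hχ.lipBdd_UD hχ.lipBdd_QL.neg hχ.lipBdd_QD.neg
    (LipBdd.const 0) (LipBdd.const_smul 2 (LipBdd.bilin mulL2 hχ.lipBdd_coeff hχ.lipBdd_UD))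

theorem U_sq_sub_P_ae (X : State) :
    (fun ξ => 2 * (X.toE.U χ ξ ^ 2 - X.toE.P χ ξ) * X.toE.UDeriv χ ξ) =ᵐ[volume] hL2 (hχ.field X) := by
  rw [hL2_field]
  filter_upwards [hχ.U_ae X, hχ.UDeriv_ae X,
    Lp.coeFn_smul (2:ℝ) (mulL2 (hχ.UC X * hχ.UC X - hχ.PC X) (hχ.UD X)),
    coeFn_mulL2 (hχ.UC X * hχ.UC X - hχ.PC X) (hχ.UD X)] with ξ h1 h2 h3 h4
  rw [h1, h2, h3, Pi.smul_apply, h4, hχ.P_eq]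
  simp only [smul_eq_mul, BoundedContinuousFunction.coe_sub, BoundedContinuousFunction.coe_mul,
    Pi.sub_apply, Pi.mul_apply]
  ring

/-- A square integrable multiple of `χ` modulo `L²` vanishes. -/
theorem eq_zero_of_memLp (hχ : IsPartitionFunction χ) {c : ℝ} {f : L2} (h : ∀ᵐ ξ, c * χ ξ = f ξ) :
    c = 0 := by
  by_contra hc
  have h1 : Integrable fun ξ => (c * χ ξ) ^ 2 :=
    (L2.integrable_sq f).congr (by filter_upwards [h] with ξ h; rw [h])
  obtain ⟨b, hb, h2⟩ := exists_abs_le_atTop h1 (ε := |c| / 2) (by positivity) 1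
  rw [hχ.eq_one b hb, mul_one] at h2
  have : 0 < |c| := abs_pos.2 hc
  linarith

/-- The almost everywhere equations determine every component of the velocity: weak derivatives are
unique, and χ is not in L², so the equation for U_t forces the χ-coefficient of the velocity to
vanish. Uniqueness among all C¹ solutions thereby becomes uniqueness for the vector field. -/
theorem isVelocity_iff (X X' : State) : IsVelocity χ X.toE X'.toE ↔ X' = hχ.field X := by
  constructor
  · rintro ⟨h1, h2, h3⟩
    have e1 : zetaCb X' = hχ.UC X := by
      apply Cb.ext_of_ae
      filter_upwards [h1, hχ.U_ae X] with ξ a b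
      rw [← b, ← a]; rfl
    have e2 : zetaD X' = hχ.UD X := by
      apply Lp.ext
      refine (E.zeta_hasPrim X').hasWeakDeriv.unique (hχ.U_hasPrim X).hasWeakDeriv ?_
      rw [e1]
    have h2' : ∀ᵐ ξ, uL2 X' ξ + cR X' * χ ξ = -hχ.QL X ξ := by
      filter_upwards [h2, hχ.QL_ae X] with ξ a b
      rw [b, ← hχ.Q_eq, ← a]; rfl
    have e5 : cR X' = 0 := by
      refine hχ.eq_zero_of_memLp (f := -hχ.QL X - uL2 X') ?_
      filter_upwards [h2', Lp.coeFn_sub (-hχ.QL X) (uL2 X'), Lp.coeFn_neg (hχ.QL X)] with ξ a b c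
      rw [b, Pi.sub_apply, c, Pi.neg_apply]; linarith
    have e3 : uL2 X' = -hχ.QL X := by
      apply Lp.ext
      filter_upwards [h2', Lp.coeFn_neg (hχ.QL X)] with ξ a b
      rw [b, Pi.neg_apply, ← a, e5]; ring
    have e4 : uD X' = -hχ.QD X := by
      apply Lp.ext
      refine HasWeakDeriv.unique (uH1 X').2 (uH1 (hχ.field X)).2 ?_
      exact Eventually.of_forall fun ξ => congrArg (fun f : L2 => f ξ) e3
    refine E.ext' e1 e2 e3 e4 e5 ?_
    apply Lp.ext
    filter_upwards [h3, hχ.U_sq_sub_P_ae X] with ξ a b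
    rw [← b, ← a]; rfl
  · rintro rfl
    refine ⟨?_, ?_, ?_⟩
    · filter_upwards [hχ.U_ae X] with ξ a
      rw [a]; rfl
    · filter_upwards [hχ.QL_ae X, Lp.coeFn_neg (hχ.QL X)] with ξ a b
      have : (hχ.field X).toE.U χ ξ = (-hχ.QL X : L2) ξ + 0 * χ ξ := rfl
      rw [this, b, Pi.neg_apply, a, hχ.Q_eq]; ring
    · filter_upwards [hχ.U_sq_sub_P_ae X] with ξ a
      rw [a]; rfl

end IsPartitionFunction

/-! ### Completeness of the state space -/

/-- For each fixed test function the defining identity equates two continuous functions of the pair,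
so the condition is an intersection of closed sets. Completeness of H¹ and V follows. -/
theorem isClosed_hasWeakDeriv {A : Type*} [TopologicalSpace A] {f f' : A → ℝ → ℝ}
    (hf : ∀ x, LocallyIntegrable (f x)) (hf' : ∀ x, LocallyIntegrable (f' x))
    (h : ∀ φ : ℝ → ℝ, Continuous φ → HasCompactSupport φ → Continuous fun x => ∫ t, f x t * φ t)
    (h' : ∀ φ : ℝ → ℝ, Continuous φ → HasCompactSupport φ → Continuous fun x => ∫ t, f' x t * φ t) :
    IsClosed {x | HasWeakDeriv (f x) (f' x)} := by
  have : {x | HasWeakDeriv (f x) (f' x)} = ⋂ φ : {φ : ℝ → ℝ // ContDiff ℝ ∞ φ ∧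
    HasCompactSupport φ},
      {x | ∫ t, f x t * deriv φ.1 t = -∫ t, f' x t * φ.1 t} := by
    ext x
    simp only [mem_ofPred_eq, mem_iInter]
    exact ⟨fun hx φ => hx.2.2 φ.1 φ.2.1 φ.2.2, fun hx => ⟨hf x, hf' x, fun φ h1 h2 => hx ⟨φ, h1,
      h2⟩⟩⟩
  rw [this]
  exact isClosed_iInter fun φ => isClosed_eq
    (h _ (φ.2.1.continuous_deriv (by simp)) φ.2.2.deriv) (h' _ φ.2.1.continuous φ.2.2).neg

theorem continuous_integral_L2 {φ : ℝ → ℝ} (hφ : Continuous φ) (hc : HasCompactSupport φ) :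
    Continuous fun f : L2 => ∫ t, f t * φ t := by
  have hm : MemLp φ 2 := hφ.memLp_of_hasCompactSupport hc
  have e : (fun f : L2 => ∫ t, f t * φ t) = fun f : L2 => inner ℝ f hm.toLp := by
    funext f
    rw [L2.inner_eq]
    exact integral_congr_ae (by filter_upwards [hm.coeFn_toLp] with t h; rw [h])
  rw [e]
  fun_prop

theorem continuous_integral_Cb {φ : ℝ → ℝ} (hφ : Continuous φ) (hc : HasCompactSupport φ) :
    Continuous fun f : Cb => ∫ t, f t * φ t := by
  have hi : Integrable φ := hφ.integrable_of_hasCompactSupport hc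
  have hfi : ∀ f : Cb, Integrable fun t => f t * φ t := fun f =>
    hi.bdd_mul f.continuous.aestronglyMeasurable (Eventually.of_forall f.norm_coe_le_norm)
  refine LipschitzWith.continuous (K := Real.toNNReal (∫ t, |φ t|)) (LipschitzWith.of_dist_le_mul
    fun f k => ?_)
  rw [Real.coe_toNNReal _ (integral_nonneg fun _ => abs_nonneg _), Real.dist_eq,
    ← integral_sub (hfi f) (hfi k), dist_eq_norm, mul_comm, ← integral_const_mul]
  refine (abs_integral_le_integral_abs).trans (integral_mono ((hfi f).sub (hfi k)).abs
    (hi.abs.const_mul _) fun t => ?_)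
  simp only
  rw [← sub_mul, abs_mul]
  exact mul_le_mul_of_nonneg_right ((f - k).norm_coe_le_norm t) (abs_nonneg _)

instance : CompleteSpace H1 := by
  suffices h : IsClosed (H1Submodule : Set (WithLp 2 (L2 × L2))) from h.isComplete.completeSpace_coe
  refine isClosed_hasWeakDeriv (f := fun p : WithLp 2 (L2 × L2) => p.fst)
    (f' := fun p : WithLp 2 (L2 × L2) => p.snd) (fun p => L2.locallyIntegrable _)
    (fun p => L2.locallyIntegrable _) (fun φ h1 h2 => ?_) (fun φ h1 h2 => ?_)
  · exact (continuous_integral_L2 h1 h2).comp (WithLp.fstL 2 ℝ L2 L2).continuous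
  · exact (continuous_integral_L2 h1 h2).comp (WithLp.sndL 2 ℝ L2 L2).continuous

instance : CompleteSpace V := by
  suffices h : IsClosed (VSubmodule : Set (WithLp 1 (Cb × L2))) from h.isComplete.completeSpace_coe
  refine isClosed_hasWeakDeriv (f := fun p : WithLp 1 (Cb × L2) => p.fst)
    (f' := fun p : WithLp 1 (Cb × L2) => p.snd) (fun p => p.fst.continuous.locallyIntegrable)
    (fun p => L2.locallyIntegrable _) (fun φ h1 h2 => ?_) (fun φ h1 h2 => ?_)
  · exact (continuous_integral_Cb h1 h2).comp (WithLp.fstL 1 ℝ Cb L2).continuous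
  · exact (continuous_integral_L2 h1 h2).comp (WithLp.sndL 1 ℝ Cb L2).continuous

instance : CompleteSpace State := inferInstanceAs (CompleteSpace (V × HInf × L2))

/-! ### Autonomous differential equations with vector fields Lipschitz on bounded sets -/

section ODE

variable {S : Type*} [NormedAddCommGroup S] [NormedSpace ℝ S] {F : S → S}

/-- `X` solves `X' = F(X)` on `[0, T]`. -/
def SolvesOn (F : S → S) (X : ℝ → S) (T : ℝ) : Prop :=
  ∀ t ∈ Icc 0 T, HasDerivWithinAt X (F (X t)) (Icc 0 T) t

/-- `X` solves `X' = F(X)` on `[0, ∞)`. -/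
def Solves (F : S → S) (X : ℝ → S) : Prop :=
  ∀ t, 0 ≤ t → HasDerivWithinAt X (F (X t)) (Ici 0) t

theorem Solves.solvesOn {X : ℝ → S} (h : Solves F X) (T : ℝ) : SolvesOn F X T := fun t ht =>
  (h t ht.1).mono Icc_subset_Ici_self

namespace SolvesOn

variable {X Z : ℝ → S} {T a b : ℝ}

theorem continuousOn (h : SolvesOn F X T) : ContinuousOn X (Icc 0 T) := fun t ht =>
  (h t ht).continuousWithinAt

theorem hasDerivWithinAt_Ici (h : SolvesOn F X T) {t : ℝ} (ht : t ∈ Ico 0 T) :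
    HasDerivWithinAt X (F (X t)) (Ici t) t := by
  refine ((h t ⟨ht.1, ht.2.le⟩).mono_of_mem_nhdsWithin ?_)
  filter_upwards [Icc_mem_nhdsGE ht.2] with z hz using ⟨ht.1.trans hz.1, hz.2⟩

theorem mono (h : SolvesOn F X T) (hab : a ≤ T) : SolvesOn F X a := fun t ht =>
  (h t ⟨ht.1, ht.2.trans hab⟩).mono (Icc_subset_Icc le_rfl hab)

theorem congr (h : SolvesOn F X T) (e : ∀ t ∈ Icc 0 T, Z t = X t) : SolvesOn F Z T := fun t ht => by
  rw [e t ht]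
  exact (h t ht).congr e (e t ht)

theorem exists_bound (h : SolvesOn F X T) : ∃ R, ∀ t ∈ Icc 0 T, ‖X t‖ ≤ R :=
  isCompact_Icc.exists_bound_of_continuousOn h.continuousOn

/-- Gronwall's inequality on a ball where `F` is `K`-Lipschitz. It serves both uniqueness and
continuous dependence. -/
theorem dist_le {R K : ℝ} (hK : 0 ≤ K)
    (hF : ∀ x y, ‖x‖ ≤ R → ‖y‖ ≤ R → ‖F x - F y‖ ≤ K * ‖x - y‖)
    (hX : SolvesOn F X T) (hZ : SolvesOn F Z T) (bX : ∀ t ∈ Icc 0 T, ‖X t‖ ≤ R)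
    (bZ : ∀ t ∈ Icc 0 T, ‖Z t‖ ≤ R) :
    ∀ t ∈ Icc 0 T, ‖X t - Z t‖ ≤ ‖X 0 - Z 0‖ * Real.exp (K * t) := by
  intro t ht
  have h := dist_le_of_trajectories_ODE_of_mem (v := fun _ => F) (K := ⟨K, hK⟩)
    (s := fun _ => Metric.closedBall 0 R) (f := X) (g := Z) (a := 0) (b := T) (δ := ‖X 0 - Z 0‖)
    (fun t _ => LipschitzOnWith.of_dist_le_mul fun x hx y hy => by
      rw [dist_eq_norm, dist_eq_norm]
      exact hF x y (by simpa using hx) (by simpa using hy))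
    hX.continuousOn (fun t ht => hX.hasDerivWithinAt_Ici ht)
    (fun t ht => by simpa using bX t ⟨ht.1, ht.2.le⟩)
    hZ.continuousOn (fun t ht => hZ.hasDerivWithinAt_Ici ht)
    (fun t ht => by simpa using bZ t ⟨ht.1, ht.2.le⟩) (by rw [dist_eq_norm]) t ht
  rw [dist_eq_norm, sub_zero] at h
  exact h

theorem unique (hF : LipBdd F) (hX : SolvesOn F X T) (hZ : SolvesOn F Z T) (h0 : X 0 = Z 0) :
    ∀ t ∈ Icc 0 T, X t = Z t := by
  obtain ⟨R, hR⟩ := hX.exists_bound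
  obtain ⟨R', hR'⟩ := hZ.exists_bound
  obtain ⟨K, hK, H⟩ := hF (max R R')
  intro t ht
  have := dist_le hK H hX hZ (fun t ht => (hR t ht).trans (le_max_left _ _))
    (fun t ht => (hR' t ht).trans (le_max_right _ _)) t ht
  rw [h0, sub_self, norm_zero, zero_mul] at this
  exact sub_eq_zero.1 (norm_le_zero_iff.1 this)

/-- Concatenation of two solutions. -/
theorem concat (ha : 0 ≤ a) (hb : 0 ≤ b) (hX : SolvesOn F X a) (hZ : SolvesOn F Z b)
    (h : Z 0 = X a) : SolvesOn F (fun t => if t ≤ a then X t else Z (t - a)) (a + b) := by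
  set W : ℝ → S := fun t => if t ≤ a then X t else Z (t - a)
  have e1 : ∀ t ∈ Icc 0 a, W t = X t := fun t ht => if_pos ht.2
  have e2 : ∀ t ∈ Icc a (a + b), W t = Z (t - a) := fun t ht => by
    rcases eq_or_lt_of_le ht.1 with e | e
    · subst e; simp [W, h]
    · exact if_neg (not_le.2 e)
  have d2 : ∀ t ∈ Icc a (a + b), HasDerivWithinAt W (F (W t)) (Icc a (a + b)) t := fun t ht => by
    have h1 := hZ (t - a) ⟨by linarith [ht.1], by linarith [ht.2]⟩
    have h2 := h1.scomp (h := fun t => t - a) (s := Icc a (a + b)) t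
      ((hasDerivAt_id t).sub_const a).hasDerivWithinAt
      (fun z hz => ⟨by linarith [hz.1], by linarith [hz.2]⟩)
    rw [one_smul] at h2
    rw [e2 t ht]
    exact h2.congr e2 (e2 t ht)
  have d1 : ∀ t ∈ Icc 0 a, HasDerivWithinAt W (F (W t)) (Icc 0 a) t := fun t ht => by
    rw [e1 t ht]
    exact (hX t ht).congr e1 (e1 t ht)
  have eU : Icc 0 a ∪ Icc a (a + b) = Icc 0 (a + b) :=
    Icc_union_Icc_eq_Icc ha (by linarith)
  intro t ht
  rcases lt_trichotomy t a with hlt | heq | hgt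
  · refine (d1 t ⟨ht.1, hlt.le⟩).mono_of_mem_nhdsWithin ?_
    rw [← eU]
    refine mem_nhdsWithin.2 ⟨Iio a, isOpen_Iio, hlt, ?_⟩
    rintro z ⟨hz, hz' | hz'⟩
    · exact hz'
    · exact absurd hz (not_lt.2 hz'.1)
  · rw [← eU]
    exact (d1 t ⟨ht.1, heq.le⟩).union (d2 t ⟨heq.ge, ht.2⟩)
  · refine (d2 t ⟨hgt.le, ht.2⟩).mono_of_mem_nhdsWithin ?_
    rw [← eU]
    refine mem_nhdsWithin.2 ⟨Ioi a, isOpen_Ioi, hgt, ?_⟩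
    rintro z ⟨hz, hz' | hz'⟩
    · exact absurd hz (not_lt.2 hz'.2)
    · exact hz'

end SolvesOn

/-- Local existence, uniformly on bounded sets. -/
theorem LipBdd.exists_solvesOn [CompleteSpace S] (hF : LipBdd F) (R : ℝ) :
    ∃ δ, 0 < δ ∧ ∀ x₀, ‖x₀‖ ≤ R → ∃ X : ℝ → S, X 0 = x₀ ∧ SolvesOn F X δ := by
  obtain ⟨K, hK, H⟩ := hF (R + 1)
  obtain ⟨L, hL, HL⟩ := hF.bdd (R + 1)
  -- `L` bounds the speed on the ball of radius R + 1, so during time 1/(L + 1) a curve cannot leave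
  -- the unit ball about its starting point. The time depends on `R` only.
  have hδ : (0:ℝ) < 1 / (L + 1) := by positivity
  refine ⟨1 / (L + 1), hδ, fun x₀ hx₀ => ?_⟩
  have hball : ∀ x ∈ Metric.closedBall x₀ ((1 : NNReal) : ℝ), ‖x‖ ≤ R + 1 := fun x hx => by
    rw [mem_closedBall_iff_norm] at hx
    have := norm_add_le x₀ (x - x₀)
    rw [add_sub_cancel] at this
    simp at hx
    linarith
  have hp : IsPicardLindelof (fun _ => F) (tmin := 0) (tmax := 1 / (L + 1))
      ⟨0, le_rfl, hδ.le⟩ x₀ 1 0 ⟨L, hL⟩ ⟨K, hK⟩ := by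
    refine IsPicardLindelof.of_time_independent (fun x hx => HL x (hball x hx)) ?_ ?_
    · exact LipschitzOnWith.of_dist_le_mul fun x hx y hy => by
        rw [dist_eq_norm, dist_eq_norm]
        exact H x y (hball x hx) (hball y hy)
    · simp only [sub_zero, NNReal.coe_one, NNReal.coe_zero]
      rw [max_eq_left (by simpa using hδ.le), mul_one_div, div_le_one (by positivity)]
      change L ≤ L + 1
      linarith
  obtain ⟨X, h0, hX⟩ := hp.exists_eq_forall_mem_Icc_hasDerivWithinAt₀
  exact ⟨X, h0, hX⟩

/-- Continuation of local solutions in an invariant set under an a priori bound. -/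
theorem exists_solves_of_apriori (hF : LipBdd F) {G : Set S}
    (hloc : ∀ R, ∃ δ, 0 < δ ∧ ∀ x₀ ∈ G, ‖x₀‖ ≤ R →
      ∃ X : ℝ → S, X 0 = x₀ ∧ SolvesOn F X δ ∧ ∀ t ∈ Icc 0 δ, X t ∈ G)
    (hb : ∀ T R, ∃ B, ∀ (X : ℝ → S) (τ : ℝ), τ ≤ T → SolvesOn F X τ → (∀ t ∈ Icc 0 τ, X t ∈ G) →
      ‖X 0‖ ≤ R → ∀ t ∈ Icc 0 τ, ‖X t‖ ≤ B) {x₀ : S} (hx₀ : x₀ ∈ G) :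
    ∃ X : ℝ → S, X 0 = x₀ ∧ Solves F X ∧ ∀ t, 0 ≤ t → X t ∈ G := by
  have hT : ∀ T : ℝ, 0 ≤ T → ∃ X : ℝ → S, X 0 = x₀ ∧ SolvesOn F X T ∧ ∀ t ∈ Icc 0 T, X t ∈ G := by
    intro T hT
    obtain ⟨B, hB⟩ := hb T ‖x₀‖
    -- The a priori bound `B` holds up to time `T`, so a single step length δ works at every restart
    -- and finitely many steps reach `T`. The partial times are truncated at `T` because `B` is
    -- guaranteed only up to there.
    obtain ⟨δ, hδ, hstep⟩ := hloc B
    have key : ∀ n : ℕ, ∃ X : ℝ → S, X 0 = x₀ ∧ SolvesOn F X (min (n * δ) T) ∧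
        ∀ t ∈ Icc 0 (min (n * δ) T), X t ∈ G := by
      intro n
      induction n with
      | zero =>
        have e : min (((0:ℕ):ℝ) * δ) T = 0 := by simp [hT]
        refine ⟨fun _ => x₀, rfl, ?_, fun _ _ => hx₀⟩
        rw [e]
        intro t ht
        rw [Icc_self] at ht ⊢
        rw [mem_singleton_iff.1 ht]
        exact HasFDerivWithinAt.of_subsingleton subsingleton_singleton
      | succ n ih =>
        obtain ⟨X, h0, hX, hG⟩ := ih
        set a := min (n * δ) T with ha
        have ha0 : 0 ≤ a := le_min (by positivity) hT
        obtain ⟨Z, z0, hZ, zG⟩ := hstep (X a) (hG a ⟨ha0, le_rfl⟩)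
          (hB X a (min_le_right _ _) hX hG (by rw [h0]) a ⟨ha0, le_rfl⟩)
        have hle : min (((n + 1 : ℕ) : ℝ) * δ) T ≤ a + δ := by
          push_cast
          rw [ha, ← min_add_add_right]
          exact min_le_min (by ring_nf; rfl) (by linarith)
        refine ⟨fun t => if t ≤ a then X t else Z (t - a), by simp [ha0, h0],
          (hX.concat ha0 hδ.le hZ z0).mono hle, fun t ht => ?_⟩
        by_cases hta : t ≤ a
        · simp only [if_pos hta]; exact hG t ⟨ht.1, hta⟩
        · simp only [if_neg hta]
          exact zG _ ⟨by linarith, by linarith [ht.2.trans hle]⟩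
    obtain ⟨n, hn⟩ := exists_nat_gt (T / δ)
    obtain ⟨X, h0, hX, hG⟩ := key n
    rw [min_eq_right (by rw [div_lt_iff₀ hδ] at hn; exact hn.le)] at hX hG
    exact ⟨X, h0, hX, hG⟩
  choose! Y hY0 hYs hYG using hT
  have hcons : ∀ a b t, 0 ≤ t → t ≤ a → a ≤ b → Y a t = Y b t := fun a b t h0 h1 h2 =>
    SolvesOn.unique hF (hYs a (h0.trans h1)) ((hYs b (h0.trans (h1.trans h2))).mono h2)
      (by rw [hY0 a (h0.trans h1), hY0 b (h0.trans (h1.trans h2))]) t ⟨h0, h1⟩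
  -- Evaluating at time t the solution on [0, t + 1] leaves room to the right of t; consistency
  -- makes the glued curve agree with one fixed solution near t.
  refine ⟨fun t => Y (t + 1) t, by simpa using hY0 1 zero_le_one, fun t ht => ?_,
    fun t ht => hYG (t + 1) (by linarith) t ⟨ht, by linarith⟩⟩
  have e : ∀ s ∈ Icc 0 (t + 1), Y (s + 1) s = Y (t + 2) s := fun s hs =>
    hcons _ _ s hs.1 (by linarith) (by linarith [hs.2])
  have h1 : SolvesOn F (fun t => Y (t + 1) t) (t + 1) :=
    ((hYs (t + 2) (by linarith)).mono (by linarith)).congr e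
  refine (h1 t ⟨ht, by linarith⟩).mono_of_mem_nhdsWithin ?_
  refine mem_nhdsWithin.2 ⟨Iio (t + 1), isOpen_Iio, by simp, ?_⟩
  rintro z ⟨hz, hz'⟩
  exact ⟨hz', le_of_lt hz⟩

theorem Solves.unique {X Z : ℝ → S} (hF : LipBdd F) (hX : Solves F X) (hZ : Solves F Z)
    (h0 : X 0 = Z 0) (t : ℝ) (ht : 0 ≤ t) : X t = Z t :=
  SolvesOn.unique hF (hX.solvesOn t) (hZ.solvesOn t) h0 t ⟨ht, le_rfl⟩

theorem Solves.shift {X : ℝ → S} (hX : Solves F X) {s : ℝ} (hs : 0 ≤ s) :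
    Solves F fun t => X (t + s) := fun t ht => by
  have h1 := hX (t + s) (by linarith)
  have h2 := h1.scomp (h := fun t => t + s) (s := Ici 0) t
    ((hasDerivAt_id t).add_const s).hasDerivWithinAt
    (fun z hz => mem_Ici.2 (by have := mem_Ici.1 hz; linarith))
  rwa [one_smul] at h2

/-- Joint continuity of the flow of an equation with a priori bounds. -/
theorem continuous_flow (hF : LipBdd F) {G : Set S} {φ : G → ℝ → S}
    (hφ0 : ∀ x : G, φ x 0 = x) (hφ : ∀ x, Solves F (φ x))
    (hb : ∀ T R, ∃ B, ∀ x : G, ‖(x : S)‖ ≤ R → ∀ t ∈ Icc 0 T, ‖φ x t‖ ≤ B) :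
    Continuous fun p : G × NNReal => φ p.1 p.2 := by
  rw [continuous_iff_continuousAt]
  rintro ⟨x, t⟩
  -- The margins 1 in time and in norm cover a neighbourhood of (x, t), on which all trajectories
  -- share the bound `B` and hence one Lipschitz constant.
  obtain ⟨B, hB⟩ := hb (t + 1) (‖(x : S)‖ + 1)
  obtain ⟨K, hK, H⟩ := hF B
  have hc : ContinuousWithinAt (φ x) (Ici 0) t := (hφ x t t.2).continuousWithinAt
  have hc' : Tendsto (fun p : G × NNReal => φ x p.2) (𝓝 (x, t)) (𝓝 (φ x t)) := by
    refine hc.tendsto.comp (tendsto_nhdsWithin_iff.2 ⟨?_, Eventually.of_forall fun p => p.2.2⟩)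
    exact (NNReal.continuous_coe.comp continuous_snd).tendsto (x, t)
  have h1 : Tendsto (fun p : G × NNReal => ‖(p.1 : S) - x‖ * Real.exp (K * (t + 1))) (𝓝 (x, t))
      (𝓝 0) := by
    have : Continuous fun p : G × NNReal => ‖(p.1 : S) - x‖ * Real.exp (K * (t + 1)) := by fun_prop
    simpa using this.tendsto (x, t)
  have h2 : Tendsto (fun p : G × NNReal => φ p.1 p.2 - φ x p.2) (𝓝 (x, t)) (𝓝 0) := by
    refine squeeze_zero_norm' ?_ h1
    have n1 : ∀ᶠ p : G × NNReal in 𝓝 (x, t), ‖(p.1 : S) - x‖ < 1 := by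
      have : Continuous fun p : G × NNReal => ‖(p.1 : S) - x‖ := by fun_prop
      exact this.continuousAt.eventually_lt continuousAt_const (by simp)
    have n2 : ∀ᶠ p : G × NNReal in 𝓝 (x, t), (p.2 : ℝ) < t + 1 := by
      have : Continuous fun p : G × NNReal => (p.2 : ℝ) := by fun_prop
      exact this.continuousAt.eventually_lt continuousAt_const (by simp)
    filter_upwards [n1, n2] with p hp1 hp2
    have hpn : ‖(p.1 : S)‖ ≤ ‖(x : S)‖ + 1 := by
      have := norm_add_le (x : S) ((p.1 : S) - x)
      rw [add_sub_cancel] at this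
      linarith
    have h := SolvesOn.dist_le hK H ((hφ p.1).solvesOn (t + 1)) ((hφ x).solvesOn (t + 1))
      (hB p.1 hpn) (hB x (by linarith)) p.2 ⟨p.2.2, hp2.le⟩
    rw [hφ0, hφ0] at h
    refine h.trans ?_
    gcongr
  have h3 := h2.add hc'
  simpa [ContinuousAt] using h3

end ODE

open E

/-! ### Invariance of `𝒢` -/

theorem mulL2_mulL2 (a b : Cb) (f : L2) : mulL2 a (mulL2 b f) = mulL2 (a * b) f := by
  apply Lp.ext
  filter_upwards [coeFn_mulL2 a (mulL2 b f), coeFn_mulL2 b f, coeFn_mulL2 (a * b) f] with x h1 h2 h3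
  rw [h1, h2, h3, BoundedContinuousFunction.mul_apply, mul_assoc]

theorem memLp_top_Cb (a : Cb) : MemLp a ⊤ (volume : Measure ℝ) :=
  memLp_top_of_bound a.continuous.aestronglyMeasurable ‖a‖ (Eventually.of_forall a.norm_coe_le_norm)

/-- `x p + y q + z r`. -/
def comb (p q r : L2) (x y z : Cb) : L2 := mulL2 x p + mulL2 y q + mulL2 z r

section comb

variable (p q r : L2) (x y z x' y' z' a : Cb)

theorem comb_add : comb p q r x y z + comb p q r x' y' z' = comb p q r (x + x') (y + y') (z + z') := by
  simp only [comb, map_add, _root_.add_apply]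
  abel

theorem smul_comb (k : ℝ) : k • comb p q r x y z = comb p q r (k • x) (k • y) (k • z) := by
  simp only [comb, map_smul, _root_.smul_apply, smul_add]

theorem mulL2_comb : mulL2 a (comb p q r x y z) = comb p q r (a * x) (a * y) (a * z) := by
  simp only [comb, map_add, mulL2_mulL2]

theorem comb_ae : comb p q r x y z =ᵐ[volume] fun ξ => x ξ * p ξ + y ξ * q ξ + z ξ * r ξ := by
  filter_upwards [Lp.coeFn_add (mulL2 x p + mulL2 y q) (mulL2 z r),
    Lp.coeFn_add (mulL2 x p) (mulL2 y q), coeFn_mulL2 x p, coeFn_mulL2 y q, coeFn_mulL2 z r]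
    with ξ h1 h2 h3 h4 h5
  rw [comb, h1, Pi.add_apply, h2, Pi.add_apply, h3, h4, h5]

theorem hasDerivWithinAt_comb {x y z : ℝ → Cb} {s : Set ℝ} {t : ℝ} (hx : HasDerivWithinAt x x' s t)
    (hy : HasDerivWithinAt y y' s t) (hz : HasDerivWithinAt z z' s t) :
    HasDerivWithinAt (fun t => comb p q r (x t) (y t) (z t)) (comb p q r x' y' z') s t :=
  (((mulL2.flip p).hasFDerivAt.comp_hasDerivWithinAt t hx).add
    ((mulL2.flip q).hasFDerivAt.comp_hasDerivWithinAt t hy)).add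
    ((mulL2.flip r).hasFDerivAt.comp_hasDerivWithinAt t hz)

end comb

namespace IsPartitionFunction

variable {χ : ℝ → ℝ} (hχ : IsPartitionFunction χ)

/-- `U² - P`. -/
def coeff (X : State) : Cb := hχ.UC X * hχ.UC X - hχ.PC X

/-- The weighted `y_ξ`. -/
def wY (X : State) : L2 := weightL2 + mulL2 weight (zetaD X)

/-- The weighted `U_ξ`. -/
def wU (X : State) : L2 := mulL2 weight (hχ.UD X)

/-- The weighted `h`. -/
def wH (X : State) : L2 := mulL2 weight (hL2 X)

theorem wY_ae (X : State) : wY X =ᵐ[volume] fun ξ => weight ξ * (1 + zetaD X ξ) := by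
  filter_upwards [Lp.coeFn_add weightL2 (mulL2 weight (zetaD X)), coeFn_weightL2,
    coeFn_mulL2 weight (zetaD X)] with ξ h1 h2 h3
  rw [wY, h1, Pi.add_apply, h2, h3]; ring

theorem wU_ae (X : State) : hχ.wU X =ᵐ[volume] fun ξ => weight ξ * hχ.UD X ξ :=
  coeFn_mulL2 weight (hχ.UD X)

theorem wH_ae (X : State) : wH X =ᵐ[volume] fun ξ => weight ξ * hL2 X ξ :=
  coeFn_mulL2 weight (hL2 X)

/-- The evolution `U_{ξt} = ½ h + (U² - P) y_ξ`. -/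
theorem UD_field_ae (X : State) : hχ.UD (hχ.field X) =ᵐ[volume] fun ξ =>
    1 / 2 * hL2 X ξ + hχ.coeff X ξ * (1 + zetaD X ξ) := by
  have e : hχ.UD (hχ.field X) = -hχ.QD X := by
    change uD (hχ.field X) + cR (hχ.field X) • hχ.chiD = _
    rw [uD_field, cR_field, zero_smul, add_zero]
  rw [e]
  filter_upwards [Lp.coeFn_neg (hχ.QD X), hχ.QD_ae X, hχ.dens_ae' X] with ξ h1 h2 h3
  have e2 : hχ.coeff X ξ = hχ.UC X ξ * hχ.UC X ξ - hχ.PC X ξ := rfl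
  rw [h1, Pi.neg_apply, h2, h3, e2, PC_apply, hχ.g_eq]
  ring

/-- The function y_ξ = 1 + ζ_ξ is not in L², but its product with e^{-|ξ|} is. Multiplication
operators commute, so the weighted unknowns satisfy the same linear evolution, now inside L². -/
theorem wU_field (X : State) : mulL2 weight (hχ.UD (hχ.field X)) =
    (1 / 2 : ℝ) • wH X + mulL2 (hχ.coeff X) (wY X) := by
  apply Lp.ext
  filter_upwards [coeFn_mulL2 weight (hχ.UD (hχ.field X)), hχ.UD_field_ae X,
    Lp.coeFn_add ((1 / 2 : ℝ) • wH X) (mulL2 (hχ.coeff X) (wY X)),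
    Lp.coeFn_smul (1 / 2 : ℝ) (wH X), coeFn_mulL2 (hχ.coeff X) (wY X), wY_ae X,
    wH_ae X] with ξ h1 h2 h3 h4 h5 h6 h7
  rw [h1, h2, h3, Pi.add_apply, h4, Pi.smul_apply, h5, h6, h7, smul_eq_mul]
  ring

theorem wH_field (X : State) : mulL2 weight (hL2 (hχ.field X)) =
    (2 : ℝ) • mulL2 (hχ.coeff X) (hχ.wU X) := by
  rw [hL2_field, map_smul, wU, mulL2_mulL2, mulL2_mulL2, mul_comm]; rfl

/-- The system for the state and its weighted derivatives. -/
def liftField (p : State × L2 × L2 × L2) : State × L2 × L2 × L2 :=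
  (hχ.field p.1, p.2.2.1, (1 / 2 : ℝ) • p.2.2.2 + mulL2 (hχ.coeff p.1) p.2.1,
    (2 : ℝ) • mulL2 (hχ.coeff p.1) p.2.2.1)

/-- The system for the state and a fundamental solution of `α' = β / 2`, `β' = (U² - P) α`. -/
def augField (p : State × Cb × Cb × Cb × Cb) : State × Cb × Cb × Cb × Cb :=
  (hχ.field p.1, (1 / 2 : ℝ) • p.2.2.1, hχ.coeff p.1 * p.2.1,
    (1 / 2 : ℝ) • p.2.2.2.2, hχ.coeff p.1 * p.2.2.2.1)

theorem lipBdd_liftField : LipBdd hχ.liftField := by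
  have h1 : LipBdd fun p : State × L2 × L2 × L2 => p.1 :=
    LipBdd.clm (ContinuousLinearMap.fst ℝ State (L2 × L2 × L2))
  have h2 : LipBdd fun p : State × L2 × L2 × L2 => p.2 :=
    LipBdd.clm (ContinuousLinearMap.snd ℝ State (L2 × L2 × L2))
  have h3 : LipBdd fun p : State × L2 × L2 × L2 => p.2.1 :=
    LipBdd.comp (LipBdd.clm (ContinuousLinearMap.fst ℝ L2 (L2 × L2))) h2
  have h4 : LipBdd fun p : State × L2 × L2 × L2 => p.2.2 :=
    LipBdd.comp (LipBdd.clm (ContinuousLinearMap.snd ℝ L2 (L2 × L2))) h2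
  have h5 : LipBdd fun p : State × L2 × L2 × L2 => p.2.2.1 :=
    LipBdd.comp (LipBdd.clm (ContinuousLinearMap.fst ℝ L2 L2)) h4
  have h6 : LipBdd fun p : State × L2 × L2 × L2 => p.2.2.2 :=
    LipBdd.comp (LipBdd.clm (ContinuousLinearMap.snd ℝ L2 L2)) h4
  have ha : LipBdd fun p : State × L2 × L2 × L2 => hχ.coeff p.1 := LipBdd.comp hχ.lipBdd_coeff h1
  exact (hχ.lipBdd_field.comp h1).prodMk (h5.prodMk (((LipBdd.const_smul _ h6).add
    (LipBdd.bilin mulL2 ha h3)).prodMk (LipBdd.const_smul _ (LipBdd.bilin mulL2 ha h5))))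

theorem lipBdd_augField : LipBdd hχ.augField := by
  have h1 : LipBdd fun p : State × Cb × Cb × Cb × Cb => p.1 :=
    LipBdd.clm (ContinuousLinearMap.fst ℝ State (Cb × Cb × Cb × Cb))
  have h2 : LipBdd fun p : State × Cb × Cb × Cb × Cb => p.2 :=
    LipBdd.clm (ContinuousLinearMap.snd ℝ State (Cb × Cb × Cb × Cb))
  have k1 : LipBdd fun p : State × Cb × Cb × Cb × Cb => p.2.1 :=
    LipBdd.comp (LipBdd.clm (ContinuousLinearMap.fst ℝ Cb (Cb × Cb × Cb))) h2
  have h3 : LipBdd fun p : State × Cb × Cb × Cb × Cb => p.2.2 :=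
    LipBdd.comp (LipBdd.clm (ContinuousLinearMap.snd ℝ Cb (Cb × Cb × Cb))) h2
  have k2 : LipBdd fun p : State × Cb × Cb × Cb × Cb => p.2.2.1 :=
    LipBdd.comp (LipBdd.clm (ContinuousLinearMap.fst ℝ Cb (Cb × Cb))) h3
  have h4 : LipBdd fun p : State × Cb × Cb × Cb × Cb => p.2.2.2 :=
    LipBdd.comp (LipBdd.clm (ContinuousLinearMap.snd ℝ Cb (Cb × Cb))) h3
  have k3 : LipBdd fun p : State × Cb × Cb × Cb × Cb => p.2.2.2.1 :=
    LipBdd.comp (LipBdd.clm (ContinuousLinearMap.fst ℝ Cb Cb)) h4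
  have k4 : LipBdd fun p : State × Cb × Cb × Cb × Cb => p.2.2.2.2 :=
    LipBdd.comp (LipBdd.clm (ContinuousLinearMap.snd ℝ Cb Cb)) h4
  have ha : LipBdd fun p : State × Cb × Cb × Cb × Cb => hχ.coeff p.1 :=
    LipBdd.comp hχ.lipBdd_coeff h1
  exact (hχ.lipBdd_field.comp h1).prodMk ((LipBdd.const_smul _ k2).prodMk ((ha.mulCb k1).prodMk
    ((LipBdd.const_smul _ k4).prodMk (ha.mulCb k3))))

/-- The linear system for the derivatives has coefficients depending on `X`. Adjoining `X` makes the
whole autonomous, so the general uniqueness theorem applies to it. -/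
theorem solvesOn_liftField {X : ℝ → State} {T : ℝ} (hX : SolvesOn hχ.field X T) :
    SolvesOn hχ.liftField (fun t => (X t, wY (X t), hχ.wU (X t), wH (X t))) T := by
  intro t ht
  have h := hX t ht
  have d1 : HasDerivWithinAt (fun t => wY (X t)) (hχ.wU (X t)) (Icc 0 T) t :=
    (((mulL2 weight) ∘L zetaD).hasFDerivAt.comp_hasDerivWithinAt t h).const_add weightL2
  have d2 : HasDerivWithinAt (fun t => hχ.wU (X t))
      ((1 / 2 : ℝ) • wH (X t) + mulL2 (hχ.coeff (X t)) (wY (X t))) (Icc 0 T) t := by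
    rw [← hχ.wU_field]
    exact ((mulL2 weight) ∘L hχ.UD).hasFDerivAt.comp_hasDerivWithinAt t h
  have d3 : HasDerivWithinAt (fun t => wH (X t))
      ((2 : ℝ) • mulL2 (hχ.coeff (X t)) (hχ.wU (X t))) (Icc 0 T) t := by
    rw [← hχ.wH_field]
    exact ((mulL2 weight) ∘L hL2).hasFDerivAt.comp_hasDerivWithinAt t h
  exact h.prodMk (d1.prodMk (d2.prodMk d3))

/-- The derivatives of the state are quadratic in a fundamental solution. -/
theorem exists_quadratic (R : ℝ) : ∃ δ, 0 < δ ∧ ∀ X₀ : State, ‖X₀‖ ≤ R → ∃ X : ℝ → State,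
    X 0 = X₀ ∧ SolvesOn hχ.field X δ ∧ ∀ t ∈ Icc 0 δ, ∃ α₁ β₁ α₂ β₂ : Cb,
      α₁ * β₂ - α₂ * β₁ = 1 ∧
      wY (X t) = comb (wY X₀) (hχ.wU X₀) (wH X₀) (α₁ * α₁) (α₁ * α₂ + α₁ * α₂) (α₂ * α₂) ∧
      hχ.wU (X t) = comb (wY X₀) (hχ.wU X₀) (wH X₀) (α₁ * β₁) (α₁ * β₂ + α₂ * β₁) (α₂ * β₂) ∧
      wH (X t) = comb (wY X₀) (hχ.wU X₀) (wH X₀) (β₁ * β₁) (β₁ * β₂ + β₁ * β₂) (β₂ * β₂) := by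
  -- The initial value consists of X₀ and the identity matrix, whose entries have norm at most 1.
  obtain ⟨δ, hδ, H⟩ := hχ.lipBdd_augField.exists_solvesOn (max R 1)
  refine ⟨δ, hδ, fun X₀ hX₀ => ?_⟩
  obtain ⟨Z, hZ0, hZ⟩ := H (X₀, 1, 0, 0, 1) (by
    refine max_le (hX₀.trans (le_max_left _ _)) (le_trans ?_ (le_max_right R 1))
    simp [Prod.norm_mk])
  set X : ℝ → State := fun t => (Z t).1 with hX
  set A₁ : ℝ → Cb := fun t => (Z t).2.1 with hA₁
  set B₁ : ℝ → Cb := fun t => (Z t).2.2.1 with hB₁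
  set A₂ : ℝ → Cb := fun t => (Z t).2.2.2.1 with hA₂
  set B₂ : ℝ → Cb := fun t => (Z t).2.2.2.2 with hB₂
  have iX : X 0 = X₀ := by simp only [hX, hZ0]
  have i1 : A₁ 0 = 1 := by simp only [hA₁, hZ0]
  have i2 : B₁ 0 = 0 := by simp only [hB₁, hZ0]
  have i3 : A₂ 0 = 0 := by simp only [hA₂, hZ0]
  have i4 : B₂ 0 = 1 := by simp only [hB₂, hZ0]
  have dX : SolvesOn hχ.field X δ := fun t ht => (hZ t ht).fst
  have d1 : ∀ t ∈ Icc 0 δ, HasDerivWithinAt A₁ ((1 / 2 : ℝ) • B₁ t) (Icc 0 δ) t := fun t ht =>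
    (hZ t ht).snd.fst
  have d2 : ∀ t ∈ Icc 0 δ, HasDerivWithinAt B₁ (hχ.coeff (X t) * A₁ t) (Icc 0 δ) t := fun t ht =>
    (hZ t ht).snd.snd.fst
  have d3 : ∀ t ∈ Icc 0 δ, HasDerivWithinAt A₂ ((1 / 2 : ℝ) • B₂ t) (Icc 0 δ) t := fun t ht =>
    (hZ t ht).snd.snd.snd.fst
  have d4 : ∀ t ∈ Icc 0 δ, HasDerivWithinAt B₂ (hχ.coeff (X t) * A₂ t) (Icc 0 δ) t := fun t ht =>
    (hZ t ht).snd.snd.snd.snd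
  -- The Wronskian is constant because the planar system has trace zero.
  have hW : ∀ t ∈ Icc 0 δ, A₁ t * B₂ t - A₂ t * B₁ t = 1 := by
    have hd : ∀ t ∈ Icc 0 δ, HasDerivWithinAt (fun t => A₁ t * B₂ t - A₂ t * B₁ t) 0 (Icc 0 δ) t := by
      intro t ht
      refine (((d1 t ht).mul (d4 t ht)).sub ((d3 t ht).mul (d2 t ht))).congr_deriv ?_
      ext ξ
      simp only [BoundedContinuousFunction.coe_sub, BoundedContinuousFunction.coe_add,
        BoundedContinuousFunction.coe_mul, BoundedContinuousFunction.coe_smul, Pi.sub_apply,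
        Pi.add_apply, Pi.mul_apply, smul_eq_mul, BoundedContinuousFunction.coe_zero, Pi.zero_apply]
      ring
    intro t ht
    have := (convex_Icc 0 δ).norm_image_sub_le_of_norm_hasDerivWithin_le (C := 0) hd
      (fun _ _ => by simp) (left_mem_Icc.2 hδ.le) ht
    rw [zero_mul] at this
    have h := sub_eq_zero.1 (norm_le_zero_iff.1 this)
    rw [h, i1, i2, i3, i4]; simp
  set p := wY X₀
  set q := hχ.wU X₀
  set r := wH X₀
  -- The symmetric square of the fundamental matrix, applied to the initial triple, solves the same
  -- system as the weighted derivatives of `X t`, with the same initial value; uniqueness identifies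
  -- the two.
  have hlin : SolvesOn hχ.liftField (fun t => (X t,
      comb p q r (A₁ t * A₁ t) (A₁ t * A₂ t + A₁ t * A₂ t) (A₂ t * A₂ t),
      comb p q r (A₁ t * B₁ t) (A₁ t * B₂ t + A₂ t * B₁ t) (A₂ t * B₂ t),
      comb p q r (B₁ t * B₁ t) (B₁ t * B₂ t + B₁ t * B₂ t) (B₂ t * B₂ t))) δ := by
    intro t ht
    have e1 := d1 t ht
    have e2 := d2 t ht
    have e3 := d3 t ht
    have e4 := d4 t ht
    refine (dX t ht).prodMk (HasDerivWithinAt.prodMk ?_ (HasDerivWithinAt.prodMk ?_ ?_))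
    · refine (hasDerivWithinAt_comb p q r _ _ _ (e1.mul e1) ((e1.mul e3).add (e1.mul e3))
        (e3.mul e3)).congr_deriv ?_
      congr 1 <;> ext ξ <;> simp <;> ring
    · refine (hasDerivWithinAt_comb p q r _ _ _ (e1.mul e2) ((e1.mul e4).add (e3.mul e2))
        (e3.mul e4)).congr_deriv ?_
      simp only [smul_comb, mulL2_comb, comb_add]
      congr 1 <;> ext ξ <;> simp <;> ring
    · refine (hasDerivWithinAt_comb p q r _ _ _ (e2.mul e2) ((e2.mul e4).add (e2.mul e4))
        (e4.mul e4)).congr_deriv ?_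
      simp only [smul_comb, mulL2_comb]
      congr 1 <;> ext ξ <;> simp <;> ring
  have h0 : ∀ x : L2, mulL2 1 x = x := fun x => by
    apply Lp.ext
    filter_upwards [coeFn_mulL2 1 x] with ξ h
    rw [h]; simp
  have hu := SolvesOn.unique hχ.lipBdd_liftField (hχ.solvesOn_liftField dX) hlin (by
    simp only [i1, i2, i3, i4, iX, comb]
    simp [h0, p, q, r])
  refine ⟨X, iX, dX, fun t ht => ⟨A₁ t, B₁ t, A₂ t, B₂ t, hW t ht, ?_⟩⟩
  have h := hu t ht
  simp only [Prod.mk.injEq, true_and] at h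
  exact h

/-- The sup bounds on ζ and U hold for every state, by the definition of V and the Sobolev
embedding, so only the derivatives and h carry genuine L^∞ conditions. -/
theorem mem_setG_iff (X : State) : X.toE ∈ setG χ ↔
    (MemLp (zetaD X) ⊤ ∧ MemLp (hχ.UD X) ⊤ ∧ MemLp (hL2 X) ⊤) ∧ ∀ᵐ ξ, 0 ≤ 1 + zetaD X ξ ∧
      0 ≤ hL2 X ξ ∧ 0 < 1 + zetaD X ξ + hL2 X ξ ∧ (1 + zetaD X ξ) * hL2 X ξ = hχ.UD X ξ ^ 2 := by
  constructor
  · rintro ⟨⟨-, h2⟩, ⟨-, h4⟩, h5, h6, h7, h8, h9⟩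
    refine ⟨⟨h2, h4.ae_eq (hχ.UDeriv_ae X), h5⟩, ?_⟩
    filter_upwards [h6, h7, h8, h9, hχ.UDeriv_ae X] with ξ a b c d e
    rw [← e]
    exact ⟨a, b, c, d⟩
  · rintro ⟨⟨h2, h4, h5⟩, h⟩
    refine ⟨⟨memLp_top_Cb _, h2⟩, ⟨(memLp_top_Cb (hχ.UC X)).ae_eq (hχ.U_ae X).symm,
      h4.ae_eq (hχ.UDeriv_ae X).symm⟩, h5, ?_, ?_, ?_, ?_⟩
    · filter_upwards [h] with ξ h using h.1
    · filter_upwards [h] with ξ h using h.2.1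
    · filter_upwards [h] with ξ h using h.2.2.1
    · filter_upwards [h, hχ.UDeriv_ae X] with ξ h e
      rw [e]; exact h.2.2.2

end IsPartitionFunction

/-- The cone of degenerate positive quadratic forms is invariant under unimodular substitutions. -/
theorem quadratic_cone {p q r a b c d : ℝ} (hpr : 0 < p + r)
    (hq : p * r = q ^ 2) (hW : a * d - c * b = 1) :
    0 ≤ a * a * p + (a * c + a * c) * q + c * c * r ∧
    0 ≤ b * b * p + (b * d + b * d) * q + d * d * r ∧
    0 < a * a * p + (a * c + a * c) * q + c * c * r + (b * b * p + (b * d + b * d) * q + d * d * r) ∧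
    (a * a * p + (a * c + a * c) * q + c * c * r) * (b * b * p + (b * d + b * d) * q + d * d * r) =
      (a * b * p + (a * d + c * b) * q + c * d * r) ^ 2 := by
  -- Degeneracy p r = q² turns p + r times the form into a sum of two squares, so p + r > 0 yields
  -- nonnegativity.
  have key : ∀ x y : ℝ, (p + r) * (x * x * p + (x * y + x * y) * q + y * y * r) =
      (x * p + y * q) ^ 2 + (x * q + y * r) ^ 2 := fun x y => by
    linear_combination (x ^ 2 + y ^ 2) * hq
  have pos : ∀ x y : ℝ, 0 ≤ x * x * p + (x * y + x * y) * q + y * y * r := fun x y => by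
    refine nonneg_of_mul_nonneg_right ?_ hpr
    rw [key]; positivity
  have hdet : (a * a * p + (a * c + a * c) * q + c * c * r) *
      (b * b * p + (b * d + b * d) * q + d * d * r) =
      (a * b * p + (a * d + c * b) * q + c * d * r) ^ 2 := by
    linear_combination (a * d - c * b) ^ 2 * hq
  refine ⟨pos a c, pos b d, ?_, hdet⟩
  -- If both new diagonal coefficients vanished, the sums of squares would vanish too; inverting the
  -- unimodular matrix then gives p = r = 0, against p + r > 0.
  refine lt_of_le_of_ne (add_nonneg (pos a c) (pos b d)) fun h => ?_
  have h1 : a * a * p + (a * c + a * c) * q + c * c * r = 0 := by linarith [pos a c, pos b d]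
  have h2 : b * b * p + (b * d + b * d) * q + d * d * r = 0 := by linarith [pos a c, pos b d]
  have k1 := key a c
  have k2 := key b d
  rw [h1, mul_zero] at k1
  rw [h2, mul_zero] at k2
  have z1 : a * p + c * q = 0 := by
    nlinarith [sq_nonneg (a * p + c * q), sq_nonneg (a * q + c * r)]
  have z2 : a * q + c * r = 0 := by
    nlinarith [sq_nonneg (a * p + c * q), sq_nonneg (a * q + c * r)]
  have z3 : b * p + d * q = 0 := by
    nlinarith [sq_nonneg (b * p + d * q), sq_nonneg (b * q + d * r)]
  have z4 : b * q + d * r = 0 := by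
    nlinarith [sq_nonneg (b * p + d * q), sq_nonneg (b * q + d * r)]
  have zp : p = 0 := by linear_combination (-p) * hW + d * z1 - c * z3
  have zr : r = 0 := by linear_combination (-r) * hW + a * z4 - b * z2
  linarith

theorem memLp_top_comb {p q r : ℝ → ℝ} (hp : MemLp p ⊤) (hq : MemLp q ⊤) (hr : MemLp r ⊤)
    (x y z : Cb) : MemLp (fun ξ => x ξ * p ξ + y ξ * q ξ + z ξ * r ξ) ⊤ := by
  have h : ∀ {f : ℝ → ℝ} (x : Cb), MemLp f ⊤ → MemLp (fun ξ => x ξ * f ξ) ⊤ := fun x hf =>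
    MemLp.mul (p := ⊤) (q := ⊤) (r := ⊤) hf (memLp_top_Cb x)
  exact ((h x hp).add (h y hq)).add (h z hr)

namespace IsPartitionFunction

variable {χ : ℝ → ℝ} (hχ : IsPartitionFunction χ)

/-- Short time existence in `𝒢`. -/
theorem exists_solvesOn_setG (R : ℝ) : ∃ δ, 0 < δ ∧ ∀ X₀ ∈ {X : State | X.toE ∈ setG χ},
    ‖X₀‖ ≤ R → ∃ X : ℝ → State, X 0 = X₀ ∧ SolvesOn hχ.field X δ ∧
      ∀ t ∈ Icc 0 δ, X t ∈ {X : State | X.toE ∈ setG χ} := by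
  obtain ⟨δ, hδ, H⟩ := hχ.exists_quadratic R
  refine ⟨δ, hδ, fun X₀ hG hR => ?_⟩
  obtain ⟨X, h0, hX, hq⟩ := H X₀ hR
  refine ⟨X, h0, hX, fun t ht => ?_⟩
  obtain ⟨a, b, c, d, hW, e1, e2, e3⟩ := hq t ht
  obtain ⟨⟨m1, m2, m3⟩, hG⟩ := (hχ.mem_setG_iff X₀).1 hG
  have m1' : MemLp (fun ξ => 1 + zetaD X₀ ξ) ⊤ := (memLp_top_Cb 1).add m1
  have key : ∀ᵐ ξ, (1 + zetaD (X t) ξ = a ξ * a ξ * (1 + zetaD X₀ ξ) +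
        (a ξ * c ξ + a ξ * c ξ) * hχ.UD X₀ ξ + c ξ * c ξ * hL2 X₀ ξ) ∧
      (hχ.UD (X t) ξ = a ξ * b ξ * (1 + zetaD X₀ ξ) +
        (a ξ * d ξ + c ξ * b ξ) * hχ.UD X₀ ξ + c ξ * d ξ * hL2 X₀ ξ) ∧
      (hL2 (X t) ξ = b ξ * b ξ * (1 + zetaD X₀ ξ) +
        (b ξ * d ξ + b ξ * d ξ) * hχ.UD X₀ ξ + d ξ * d ξ * hL2 X₀ ξ) := by
    have g1 := comb_ae (wY X₀) (hχ.wU X₀) (wH X₀) (a * a) (a * c + a * c) (c * c)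
    have g2 := comb_ae (wY X₀) (hχ.wU X₀) (wH X₀) (a * b) (a * d + c * b) (c * d)
    have g3 := comb_ae (wY X₀) (hχ.wU X₀) (wH X₀) (b * b) (b * d + b * d) (d * d)
    rw [← e1] at g1
    rw [← e2] at g2
    rw [← e3] at g3
    filter_upwards [g1, g2, g3, wY_ae X₀, wY_ae (X t), hχ.wU_ae X₀, hχ.wU_ae (X t),
      wH_ae X₀, wH_ae (X t)] with ξ k1 k2 k3 k4 k5 k6 k7 k8 k9
    -- The weight is nowhere zero, so it cancels and the identities hold for the unweighted
    -- derivatives.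
    have hw : weight ξ ≠ 0 := by rw [weight_apply]; positivity
    rw [k4, k6, k8] at k1 k2 k3
    rw [k5] at k1
    rw [k7] at k2
    rw [k9] at k3
    simp only [BoundedContinuousFunction.coe_add, BoundedContinuousFunction.coe_mul, Pi.add_apply,
      Pi.mul_apply] at k1 k2 k3
    refine ⟨mul_left_cancel₀ hw ?_, mul_left_cancel₀ hw ?_, mul_left_cancel₀ hw ?_⟩
    · rw [k1]; ring
    · rw [k2]; ring
    · rw [k3]; ring
  refine (hχ.mem_setG_iff (X t)).2 ⟨⟨?_, ?_, ?_⟩, ?_⟩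
  · have h := (memLp_top_comb m1' m2 m3 (a * a) (a * c + a * c) (c * c)).sub (memLp_top_Cb 1)
    refine h.ae_eq ?_
    filter_upwards [key] with ξ k
    simp only [BoundedContinuousFunction.coe_add, BoundedContinuousFunction.coe_mul, Pi.add_apply,
      Pi.mul_apply, Pi.sub_apply, BoundedContinuousFunction.coe_one, Pi.one_apply]
    linarith [k.1]
  · refine (memLp_top_comb m1' m2 m3 (a * b) (a * d + c * b) (c * d)).ae_eq ?_
    filter_upwards [key] with ξ k using k.2.1.symm
  · refine (memLp_top_comb m1' m2 m3 (b * b) (b * d + b * d) (d * d)).ae_eq ?_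
    filter_upwards [key] with ξ k using k.2.2.symm
  · filter_upwards [key, hG] with ξ k g
    have hW' : a ξ * d ξ - c ξ * b ξ = 1 := DFunLike.congr_fun hW ξ
    rw [k.1, k.2.1, k.2.2]
    exact quadratic_cone g.2.2.1 g.2.2.2 hW'

end IsPartitionFunction

open E

/-! ### The energy and its consequences -/

theorem integral_le_of_nonneg {f : ℝ → ℝ} (hf : Integrable f) (h0 : ∀ᵐ ξ, 0 ≤ f ξ) {a b : ℝ}
    (hab : a ≤ b) : ∫ ξ in a..b, f ξ ≤ ∫ ξ, f ξ := by
  rw [intervalIntegral.integral_of_le hab]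
  exact setIntegral_le_integral hf h0

theorem HasPrim.monotone {f f' : ℝ → ℝ} (h : HasPrim f f') (h0 : ∀ᵐ ξ, 0 ≤ f' ξ) : Monotone f := by
  intro a b hab
  have := intervalIntegral.integral_nonneg_of_ae_restrict (μ := volume) hab
    (ae_restrict_of_ae h0 : 0 ≤ᵐ[volume.restrict (Icc a b)] f')
  linarith [h.2 a b]

section Kernel

variable (X : State) {D : L2} {w : ℝ → ℝ} {K : ℝ}

/-- For nondecreasing y the kernel times y_ξ is the derivative of e^{y(η)-y(ξ)} in η and integrates
to at most 1, while against `w` the kernel is bounded by 1. The resulting bound is free of ‖ζ‖, as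
the energy argument requires. -/
theorem abs_leftC_le (hw : Integrable w) (w0 : ∀ᵐ ξ, 0 ≤ w ξ) (hK : 0 ≤ K)
    (hy : ∀ᵐ ξ, 0 ≤ 1 + zetaD X ξ) (hD : ∀ᵐ ξ, |D ξ| ≤ w ξ + K * (1 + zetaD X ξ)) (ξ : ℝ) :
    |leftC X D ξ| ≤ (∫ η, w η) + K := by
  have hp := IsPartitionFunction.y_hasPrim X
  have hm := hp.monotone hy
  obtain ⟨h1, h2⟩ := leftC_eq X D ξ
  have hE : HasPrim (fun η => Real.exp (X.toE.y η - X.toE.y ξ))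
      (fun η => Real.exp (X.toE.y η - X.toE.y ξ) * (1 + zetaD X η)) :=
    HasPrim.comp (φ := fun s => Real.exp (s - X.toE.y ξ)) (φ' := fun s => Real.exp (s - X.toE.y ξ))
      (fun s => by simpa using ((hasDerivAt_id s).sub_const (X.toE.y ξ)).exp) (by fun_prop) hp
  rw [h2]
  refine le_of_tendsto (intervalIntegral_tendsto_integral_Iic ξ h1 tendsto_id).abs ?_
  filter_upwards [eventually_le_atBot ξ] with a ha
  rw [← Real.norm_eq_abs, id]
  refine (intervalIntegral.norm_integral_le_of_norm_le
    (g := fun η => w η + K * (Real.exp (X.toE.y η - X.toE.y ξ) * (1 + zetaD X η))) ha ?_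
    (hw.intervalIntegrable.add ((hE.intervalIntegrable a ξ).const_mul K))).trans ?_
  · filter_upwards [hD, hy, w0] with η d1 d2 d3 hη
    have hle := hm hη.2
    have e : kernel X.toE.y ξ η = Real.exp (X.toE.y η - X.toE.y ξ) := by
      rw [kernel_eq_of_monotone hm, abs_of_nonneg (by linarith)]; ring_nf
    have e1 : Real.exp (X.toE.y η - X.toE.y ξ) ≤ 1 := Real.exp_le_one_iff.2 (by linarith)
    have e0 := Real.exp_nonneg (X.toE.y η - X.toE.y ξ)
    rw [e, Real.norm_eq_abs, abs_mul, Real.abs_exp]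
    calc _ ≤ Real.exp (X.toE.y η - X.toE.y ξ) * (w η + K * (1 + zetaD X η)) := by gcongr
      _ ≤ 1 * w η + K * (Real.exp (X.toE.y η - X.toE.y ξ) * (1 + zetaD X η)) := by
        nlinarith [mul_le_mul_of_nonneg_right e1 d3]
      _ = _ := by ring
  · rw [intervalIntegral.integral_add hw.intervalIntegrable
      ((hE.intervalIntegrable a ξ).const_mul K), intervalIntegral.integral_const_mul, ← hE.2 a ξ]
    simp only [sub_self, Real.exp_zero]
    have := integral_le_of_nonneg hw w0 ha
    have := Real.exp_nonneg (X.toE.y a - X.toE.y ξ)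
    nlinarith

theorem abs_rightC_le (hw : Integrable w) (w0 : ∀ᵐ ξ, 0 ≤ w ξ) (hK : 0 ≤ K)
    (hy : ∀ᵐ ξ, 0 ≤ 1 + zetaD X ξ) (hD : ∀ᵐ ξ, |D ξ| ≤ w ξ + K * (1 + zetaD X ξ)) (ξ : ℝ) :
    |rightC X D ξ| ≤ (∫ η, w η) + K := by
  have hp := IsPartitionFunction.y_hasPrim X
  have hm := hp.monotone hy
  obtain ⟨h1, h2⟩ := rightC_eq X D ξ
  have hE : HasPrim (fun η => Real.exp (X.toE.y ξ - X.toE.y η))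
      (fun η => -Real.exp (X.toE.y ξ - X.toE.y η) * (1 + zetaD X η)) :=
    HasPrim.comp (φ := fun s => Real.exp (X.toE.y ξ - s)) (φ' := fun s => -Real.exp (X.toE.y ξ - s))
      (fun s => by simpa using ((hasDerivAt_id s).const_sub (X.toE.y ξ)).exp) (by fun_prop) hp
  rw [h2]
  refine le_of_tendsto (intervalIntegral_tendsto_integral_Ioi ξ h1 tendsto_id).abs ?_
  filter_upwards [eventually_ge_atTop ξ] with b hb
  rw [← Real.norm_eq_abs, id]
  refine (intervalIntegral.norm_integral_le_of_norm_le
    (g := fun η => w η + (-K) * (-Real.exp (X.toE.y ξ - X.toE.y η) * (1 + zetaD X η))) hb ?_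
    (hw.intervalIntegrable.add ((hE.intervalIntegrable ξ b).const_mul (-K)))).trans ?_
  · filter_upwards [hD, hy, w0] with η d1 d2 d3 hη
    have hle := hm hη.1.le
    have e : kernel X.toE.y ξ η = Real.exp (X.toE.y ξ - X.toE.y η) := by
      rw [kernel_eq_of_monotone hm, abs_of_nonpos (by linarith)]; ring_nf
    have e1 : Real.exp (X.toE.y ξ - X.toE.y η) ≤ 1 := Real.exp_le_one_iff.2 (by linarith)
    have e0 := Real.exp_nonneg (X.toE.y ξ - X.toE.y η)
    rw [e, Real.norm_eq_abs, abs_mul, Real.abs_exp]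
    calc _ ≤ Real.exp (X.toE.y ξ - X.toE.y η) * (w η + K * (1 + zetaD X η)) := by gcongr
      _ ≤ 1 * w η + K * (Real.exp (X.toE.y ξ - X.toE.y η) * (1 + zetaD X η)) := by
        nlinarith [mul_le_mul_of_nonneg_right e1 d3]
      _ = _ := by ring
  · rw [intervalIntegral.integral_add hw.intervalIntegrable
      ((hE.intervalIntegrable ξ b).const_mul (-K)), intervalIntegral.integral_const_mul,
      ← hE.2 ξ b]
    simp only [sub_self, Real.exp_zero]
    have := integral_le_of_nonneg hw w0 hb
    have := Real.exp_nonneg (X.toE.y ξ - X.toE.y b)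
    nlinarith

end Kernel

namespace IsPartitionFunction

variable {χ : ℝ → ℝ}

theorem chiY_hasPrim (hχ : IsPartitionFunction χ) (X : State) : HasPrim (fun ξ => χ (X.toE.y ξ))
    (fun ξ => deriv χ (X.toE.y ξ) * (1 + zetaD X ξ)) :=
  HasPrim.comp hχ.hasDerivAt hχ.continuous_deriv (y_hasPrim X)

variable (hχ : IsPartitionFunction χ) (X : State)

/-- The sign conditions and the algebraic relation in the definition of `𝒢`. -/
def Admissible : Prop :=
  ∀ᵐ ξ, 0 ≤ 1 + zetaD X ξ ∧ 0 ≤ hL2 X ξ ∧ (1 + zetaD X ξ) * hL2 X ξ = hχ.UD X ξ ^ 2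

/-- The energy; on `𝒢` it is `∫ Ū² y_ξ + h`. -/
def energy : ℝ :=
  inner ℝ (hχ.UbarL X) (hχ.UbarL X) + inner ℝ (mulL2 (hχ.UbarC X) (hχ.UbarL X)) (zetaD X) +
    inner ℝ (hχ.UD X) (hχ.UD X) - inner ℝ (hL2 X) (zetaD X)

theorem lipBdd_energy : LipBdd hχ.energy :=
  (((LipBdd.bilin (innerSL ℝ) hχ.lipBdd_UbarL hχ.lipBdd_UbarL).add
    (LipBdd.bilin (innerSL ℝ) (LipBdd.bilin mulL2 hχ.lipBdd_UbarC hχ.lipBdd_UbarL)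
      (LipBdd.clm zetaD))).add (LipBdd.bilin (innerSL ℝ) hχ.lipBdd_UD hχ.lipBdd_UD)).sub
    (LipBdd.bilin (innerSL ℝ) (LipBdd.clm hL2) (LipBdd.clm zetaD))

theorem UbarC_hasPrim : HasPrim (hχ.UbarC X)
    (fun ξ => hχ.UD X ξ - cR X * (deriv χ (X.toE.y ξ) * (1 + zetaD X ξ))) :=
  (hχ.U_hasPrim X).sub ((hχ.chiY_hasPrim X).const_mul (cR X))

theorem integrable_Ubar_sq : Integrable fun ξ => hχ.UbarC X ξ ^ 2 :=
  (L2.integrable_sq (hχ.UbarL X)).congr (by filter_upwards [hχ.UbarL_ae X] with ξ h; rw [h])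

variable {X}

/-- The bound for the transition region. -/
theorem abs_integral_transition_le (hX : hχ.Admissible X) {w : ℝ → ℝ} {M : ℝ}
    (hw : ∀ ξ, |w ξ| ≤ M) {a b : ℝ} (hab : a ≤ b) :
    |∫ ξ in a..b, deriv χ (X.toE.y ξ) * (1 + zetaD X ξ) * w ξ| ≤ M := by
  have hM : 0 ≤ M := (abs_nonneg _).trans (hw 0)
  rw [← Real.norm_eq_abs]
  refine (intervalIntegral.norm_integral_le_of_norm_le
    (g := fun ξ => M * (deriv χ (X.toE.y ξ) * (1 + zetaD X ξ))) hab ?_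
    (((hχ.chiY_hasPrim X).intervalIntegrable a b).const_mul M)).trans ?_
  · filter_upwards [hX] with ξ h _
    have h1 := mul_nonneg (hχ.deriv_nonneg (X.toE.y ξ)) h.1
    rw [Real.norm_eq_abs, abs_mul, abs_of_nonneg h1, mul_comm]
    exact mul_le_mul_of_nonneg_right (hw ξ) h1
  · rw [intervalIntegral.integral_const_mul, ← (hχ.chiY_hasPrim X).2 a b]
    have h1 := hχ.le_one (X.toE.y b)
    have h2 := hχ.nonneg (X.toE.y a)
    nlinarith

/-- The relation y_ξ h = U_ξ² rewrites h as U_ξ² - h ζ_ξ, and y_ξ = 1 + ζ_ξ splits the other term.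
Thus the energy is a sum of L² inner products: it is defined on the whole state space and
differentiable along solutions, and h is integrable although only h in L² is assumed. -/
theorem energy_spec (hX : hχ.Admissible X) :
    Integrable (fun ξ => hχ.UbarC X ξ ^ 2 * (1 + zetaD X ξ) + hL2 X ξ) ∧
    ∫ ξ, (hχ.UbarC X ξ ^ 2 * (1 + zetaD X ξ) + hL2 X ξ) = hχ.energy X := by
  have i1 := L2.integrable_mul (hχ.UbarL X) (hχ.UbarL X)
  have i2 := L2.integrable_mul (mulL2 (hχ.UbarC X) (hχ.UbarL X)) (zetaD X)
  have i3 := L2.integrable_mul (hχ.UD X) (hχ.UD X)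
  have i4 := L2.integrable_mul (hL2 X) (zetaD X)
  have e : (fun ξ => hχ.UbarL X ξ * hχ.UbarL X ξ +
      mulL2 (hχ.UbarC X) (hχ.UbarL X) ξ * zetaD X ξ + hχ.UD X ξ * hχ.UD X ξ -
      hL2 X ξ * zetaD X ξ) =ᵐ[volume]
      fun ξ => hχ.UbarC X ξ ^ 2 * (1 + zetaD X ξ) + hL2 X ξ := by
    filter_upwards [hX, hχ.UbarL_ae X, coeFn_mulL2 (hχ.UbarC X) (hχ.UbarL X)] with ξ h1 h2 h3
    rw [h3, h2]
    linear_combination -h1.2.2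
  have i12 : Integrable fun ξ => hχ.UbarL X ξ * hχ.UbarL X ξ +
      mulL2 (hχ.UbarC X) (hχ.UbarL X) ξ * zetaD X ξ := i1.add i2
  have i123 : Integrable fun ξ => hχ.UbarL X ξ * hχ.UbarL X ξ +
      mulL2 (hχ.UbarC X) (hχ.UbarL X) ξ * zetaD X ξ + hχ.UD X ξ * hχ.UD X ξ := i12.add i3
  refine ⟨(i123.sub i4).congr e, ?_⟩
  rw [← integral_congr_ae e, integral_sub i123 i4, integral_add i12 i3, integral_add i1 i2, energy,
    L2.inner_eq, L2.inner_eq, L2.inner_eq, L2.inner_eq]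

theorem energyDensity_nonneg (hX : hχ.Admissible X) :
    ∀ᵐ ξ, 0 ≤ hχ.UbarC X ξ ^ 2 * (1 + zetaD X ξ) + hL2 X ξ := by
  filter_upwards [hX] with ξ h
  exact add_nonneg (mul_nonneg (sq_nonneg _) h.1) h.2.1

theorem energy_nonneg (hX : hχ.Admissible X) : 0 ≤ hχ.energy X := by
  rw [← (hχ.energy_spec hX).2]
  exact integral_nonneg_of_ae (hχ.energyDensity_nonneg hX)

/-- In (Ū²)_ξ the term 2 Ū U_ξ is at most Ū² y_ξ + h, by the arithmetic-geometric mean inequality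
and U_ξ² = y_ξ h. The other term carries χ'(y) y_ξ, whose integral is an increment of χ∘y and so at
most 1. -/
theorem Ubar_sq_le (hX : hχ.Admissible X) (ξ : ℝ) :
    hχ.UbarC X ξ ^ 2 ≤ hχ.energy X + 2 * |cR X| * ‖hχ.UbarC X‖ := by
  refine le_of_forall_pos_le_add fun ε hε => ?_
  obtain ⟨a, haξ, ha⟩ := exists_abs_le_atBot (hχ.integrable_Ubar_sq X) (Real.sqrt_pos.2 hε) ξ
  have ha2 : hχ.UbarC X a ^ 2 ≤ ε := by
    rw [← sq_abs, ← Real.sq_sqrt hε.le]; gcongr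
  have hp := (hχ.UbarC_hasPrim X).sq
  obtain ⟨i1, e1⟩ := hχ.energy_spec hX
  have i2 := (hχ.chiY_hasPrim X).intervalIntegrable a ξ
  have h1 : ‖∫ t in a..ξ, 2 * hχ.UbarC X t *
      (hχ.UD X t - cR X * (deriv χ (X.toE.y t) * (1 + zetaD X t)))‖ ≤
      ∫ t in a..ξ, ((hχ.UbarC X t ^ 2 * (1 + zetaD X t) + hL2 X t) +
        2 * |cR X| * ‖hχ.UbarC X‖ * (deriv χ (X.toE.y t) * (1 + zetaD X t))) := by
    refine intervalIntegral.norm_integral_le_of_norm_le haξ ?_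
      (i1.intervalIntegrable.add (i2.const_mul _))
    filter_upwards [hX] with t h _
    have k1 := mul_nonneg (hχ.deriv_nonneg (X.toE.y t)) h.1
    have k2 : |2 * hχ.UbarC X t * hχ.UD X t| ≤ hχ.UbarC X t ^ 2 * (1 + zetaD X t) + hL2 X t := by
      refine abs_le_of_sq_le_sq ?_ (add_nonneg (mul_nonneg (sq_nonneg _) h.1) h.2.1)
      have : (2 * hχ.UbarC X t * hχ.UD X t) ^ 2 =
        4 * hχ.UbarC X t ^ 2 * ((1 + zetaD X t) * hL2 X t) := by rw [h.2.2]; ring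
      rw [this]
      nlinarith [sq_nonneg (hχ.UbarC X t ^ 2 * (1 + zetaD X t) - hL2 X t)]
    have k3 : |2 * hχ.UbarC X t * (cR X * (deriv χ (X.toE.y t) * (1 + zetaD X t)))| ≤
        2 * |cR X| * ‖hχ.UbarC X‖ * (deriv χ (X.toE.y t) * (1 + zetaD X t)) := by
      rw [abs_mul, abs_mul, abs_mul, abs_of_nonneg k1, abs_two]
      have := (hχ.UbarC X).norm_coe_le_norm t
      rw [Real.norm_eq_abs] at this
      calc _ = 2 * |cR X| * |hχ.UbarC X t| * (deriv χ (X.toE.y t) * (1 + zetaD X t)) := by ring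
        _ ≤ _ := by gcongr
    rw [Real.norm_eq_abs, mul_sub]
    exact (abs_sub _ _).trans (add_le_add k2 k3)
  rw [intervalIntegral.integral_add i1.intervalIntegrable (i2.const_mul _),
    intervalIntegral.integral_const_mul, ← (hχ.chiY_hasPrim X).2 a ξ, ← hp.2 a ξ] at h1
  have h2 := integral_le_of_nonneg i1 (hχ.energyDensity_nonneg hX) haξ
  rw [e1] at h2
  have h3 : 2 * |cR X| * ‖hχ.UbarC X‖ * (χ (X.toE.y ξ) - χ (X.toE.y a)) ≤
      2 * |cR X| * ‖hχ.UbarC X‖ * 1 := by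
    gcongr
    linarith [hχ.le_one (X.toE.y ξ), hχ.nonneg (X.toE.y a)]
  have h4 := (le_abs_self _).trans h1
  linarith

/-- The linear term 2 |c| ‖Ū‖ is absorbed as ‖Ū‖²/2 + 2 c². -/
theorem norm_Ubar_sq_le (hX : hχ.Admissible X) :
    ‖hχ.UbarC X‖ ^ 2 ≤ 2 * hχ.energy X + 4 * cR X ^ 2 := by
  have h0 := hχ.energy_nonneg hX
  have h1 : ‖hχ.UbarC X‖ ≤ √(hχ.energy X + 2 * |cR X| * ‖hχ.UbarC X‖) :=
    (BoundedContinuousFunction.norm_le (Real.sqrt_nonneg _)).2 fun ξ =>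
      Real.abs_le_sqrt (hχ.Ubar_sq_le hX ξ)
  have h2 := (Real.le_sqrt (norm_nonneg _) (by positivity)).1 h1
  have h3 := sq_abs (cR X)
  nlinarith [sq_nonneg (2 * |cR X| - ‖hχ.UbarC X‖)]

/-- Only the cross term in c escapes the energy density; it is a bounded multiple of y_ξ, which is
the shape the kernel estimates accept. -/
theorem abs_dens_le (hX : hχ.Admissible X) : ∀ᵐ ξ, |hχ.dens X ξ| ≤
    2 * (hχ.UbarC X ξ ^ 2 * (1 + zetaD X ξ) + hL2 X ξ) +
      4 * |cR X| * ‖hχ.UbarC X‖ * (1 + zetaD X ξ) := by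
  filter_upwards [hX, hχ.dens_ae' X] with ξ h1 h2
  have e : hχ.dens X ξ = 2 * hχ.UbarC X ξ ^ 2 * (1 + zetaD X ξ) + hL2 X ξ +
      4 * (cR X * hχ.UbarC X ξ * χ (X.toE.y ξ)) * (1 + zetaD X ξ) := by
    rw [h2, UbarC_apply]; ring
  have k : |cR X * hχ.UbarC X ξ * χ (X.toE.y ξ)| ≤ |cR X| * ‖hχ.UbarC X‖ := by
    rw [abs_mul, abs_mul]
    have k1 := (hχ.UbarC X).norm_coe_le_norm ξ
    rw [Real.norm_eq_abs] at k1
    calc _ ≤ |cR X| * ‖hχ.UbarC X‖ * 1 := by gcongr; exact hχ.abs_le_one _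
      _ = _ := mul_one _
  have p1 : 0 ≤ 2 * hχ.UbarC X ξ ^ 2 * (1 + zetaD X ξ) + hL2 X ξ :=
    add_nonneg (mul_nonneg (by positivity) h1.1) h1.2.1
  rw [e]
  refine (abs_add_le _ _).trans ?_
  rw [abs_of_nonneg p1, abs_mul, abs_mul, abs_of_nonneg h1.1,
    abs_of_nonneg (by norm_num : (0:ℝ) ≤ 4)]
  have := mul_le_mul_of_nonneg_right k h1.1
  nlinarith [h1.2.1]

theorem norm_leftC_add_rightC_le (hX : hχ.Admissible X) :
    ‖leftC X (hχ.dens X) + rightC X (hχ.dens X)‖ ≤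
      4 * hχ.energy X + 8 * |cR X| * ‖hχ.UbarC X‖ := by
  have h0 := hχ.energy_nonneg hX
  obtain ⟨i1, e1⟩ := hχ.energy_spec hX
  have w0 : ∀ᵐ ξ, 0 ≤ 2 * (hχ.UbarC X ξ ^ 2 * (1 + zetaD X ξ) + hL2 X ξ) := by
    filter_upwards [hχ.energyDensity_nonneg hX] with ξ h
    linarith
  have hy : ∀ᵐ ξ, 0 ≤ 1 + zetaD X ξ := by filter_upwards [hX] with ξ h using h.1
  have hK : 0 ≤ 4 * |cR X| * ‖hχ.UbarC X‖ := by positivity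
  refine (BoundedContinuousFunction.norm_le (by positivity)).2 fun ξ => ?_
  have l := abs_leftC_le X (i1.const_mul 2) w0 hK hy (hχ.abs_dens_le hX) ξ
  have r := abs_rightC_le X (i1.const_mul 2) w0 hK hy (hχ.abs_dens_le hX) ξ
  rw [integral_const_mul, e1] at l r
  have := abs_add_le (leftC X (hχ.dens X) ξ) (rightC X (hχ.dens X) ξ)
  change |leftC X (hχ.dens X) ξ + rightC X (hχ.dens X) ξ| ≤ _
  linarith

/-- Bounds for `‖Ū‖`, `‖P‖` and the kernel integrals in terms of the energy. -/
theorem exists_bounds (C : ℝ) : ∃ K, 0 ≤ K ∧ ∀ X : State, hχ.Admissible X → |cR X| ≤ C →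
    ‖hχ.UbarC X‖ ^ 2 ≤ K * (1 + hχ.energy X) ∧
    ‖leftC X (hχ.dens X) + rightC X (hχ.dens X)‖ ≤ K * (1 + hχ.energy X) ∧
    ‖hχ.PC X‖ ≤ K * (1 + hχ.energy X) ∧ ‖hχ.UC X‖ ≤ ‖hχ.UbarC X‖ + C := by
  obtain ⟨M, hM⟩ := hχ.bound_g
  -- Bounding C ‖Ū‖ by 2 energy + 5 C² makes the kernel sum at most 20 energy + 40 C²; a quarter of
  -- it plus C² |M|, from g, bounds P. The constant dominates all these coefficients.
  refine ⟨20 + (40 + |M|) * C ^ 2, by positivity, fun X hX hc => ?_⟩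
  have hC : 0 ≤ C := (abs_nonneg _).trans hc
  have h0 := hχ.energy_nonneg hX
  have h1 := hχ.norm_Ubar_sq_le hX
  have h2 := hχ.norm_leftC_add_rightC_le hX
  have hc2 : cR X ^ 2 ≤ C ^ 2 := by rw [← sq_abs]; gcongr
  have n0 := norm_nonneg (hχ.UbarC X)
  have h3 : |cR X| * ‖hχ.UbarC X‖ ≤ C * ‖hχ.UbarC X‖ := by gcongr
  have h4 : C * ‖hχ.UbarC X‖ ≤ 2 * hχ.energy X + 5 * C ^ 2 := by
    nlinarith [sq_nonneg (C - ‖hχ.UbarC X‖)]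
  have hJ : ‖leftC X (hχ.dens X) + rightC X (hχ.dens X)‖ ≤ 20 * hχ.energy X + 40 * C ^ 2 := by
    nlinarith
  have hg : ‖hχ.gY X‖ ≤ |M| := (BoundedContinuousFunction.norm_le (abs_nonneg _)).2 fun ξ =>
    (hM _).trans (le_abs_self M)
  have hP : ‖hχ.PC X‖ ≤ 5 * hχ.energy X + 10 * C ^ 2 + C ^ 2 * |M| := by
    have a1 : ‖hχ.PC X‖ ≤ ‖(1 / 4 : ℝ) • (leftC X (hχ.dens X) + rightC X (hχ.dens X))‖ +
      ‖(cR X * cR X) • hχ.gY X‖ := norm_add_le _ _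
    rw [norm_smul, norm_smul, Real.norm_of_nonneg (by norm_num), ← sq,
      Real.norm_of_nonneg (sq_nonneg _)] at a1
    have a2 : cR X ^ 2 * ‖hχ.gY X‖ ≤ C ^ 2 * |M| := by gcongr
    linarith
  have hCM : 0 ≤ C ^ 2 * |M| := by positivity
  have hr : 20 * hχ.energy X + 40 * C ^ 2 + C ^ 2 * |M| ≤
      (20 + (40 + |M|) * C ^ 2) * (1 + hχ.energy X) := by
    have : 0 ≤ ((40 + |M|) * C ^ 2) * hχ.energy X := by positivity
    nlinarith
  refine ⟨by nlinarith, by linarith, by nlinarith [sq_nonneg C], ?_⟩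
  have e : hχ.UC X = hχ.UbarC X + cR X • hχ.chiY X := by rw [UbarC]; abel
  have n1 : ‖hχ.chiY X‖ ≤ 1 := (BoundedContinuousFunction.norm_le zero_le_one).2 fun ξ =>
    hχ.abs_le_one _
  rw [e]
  refine (norm_add_le _ _).trans ?_
  rw [norm_smul]
  have : ‖cR X‖ * ‖hχ.chiY X‖ ≤ C * 1 := by gcongr; exact hc
  linarith

end IsPartitionFunction

open E

/-! ### Evolution of the energy -/

/-- `f` is integrable with integral `r`. -/
def HasIntegral (f : ℝ → ℝ) (r : ℝ) : Prop := Integrable f ∧ ∫ ξ, f ξ = r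

namespace HasIntegral

variable {f k : ℝ → ℝ} {r s : ℝ}

theorem add (h : HasIntegral f r) (h' : HasIntegral k s) :
    HasIntegral (fun ξ => f ξ + k ξ) (r + s) :=
  ⟨h.1.add h'.1, by rw [integral_add h.1 h'.1, h.2, h'.2]⟩

theorem sub (h : HasIntegral f r) (h' : HasIntegral k s) :
    HasIntegral (fun ξ => f ξ - k ξ) (r - s) :=
  ⟨h.1.sub h'.1, by rw [integral_sub h.1 h'.1, h.2, h'.2]⟩

theorem congr (h : HasIntegral f r) (e : f =ᵐ[volume] k) : HasIntegral k r :=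
  ⟨h.1.congr e, by rw [← integral_congr_ae e, h.2]⟩

theorem inner (f k : L2) : HasIntegral (fun ξ => f ξ * k ξ) (inner ℝ f k) :=
  ⟨L2.integrable_mul f k, (L2.inner_eq f k).symm⟩

/-- The integral of a total derivative plus a remainder. -/
theorem abs_le {Φ Φ' w : ℝ → ℝ} (h : HasIntegral (fun ξ => Φ' ξ + w ξ) r) (hΦ : HasPrim Φ Φ')
    (hw : LocallyIntegrable w) {A M : ℝ} (hA : ∀ N, ∃ a ≤ N, |Φ a| ≤ A)
    (hA' : ∀ N, ∃ b ≥ N, |Φ b| ≤ A) (hM : ∀ a b, a ≤ b → |∫ ξ in a..b, w ξ| ≤ M) :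
    |r| ≤ 2 * A + M := by
  choose a ha ha' using fun n : ℕ => hA (-n)
  choose b hb hb' using fun n : ℕ => hA' n
  have ta : Tendsto a atTop atBot :=
    tendsto_atBot_mono ha (tendsto_neg_atTop_atBot.comp tendsto_natCast_atTop_atTop)
  have tb : Tendsto b atTop atTop := tendsto_atTop_mono hb tendsto_natCast_atTop_atTop
  rw [← h.2]
  refine le_of_tendsto (intervalIntegral_tendsto_integral h.1 ta tb).abs
    (Eventually.of_forall fun n => ?_)
  have hab : a n ≤ b n := by
    have : (0:ℝ) ≤ n := n.cast_nonneg
    linarith [ha n, hb n]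
  rw [intervalIntegral.integral_add (hΦ.intervalIntegrable _ _) 
    (hw.integrableOn_isCompact isCompact_uIcc).intervalIntegrable, ← hΦ.2]
  have h1 := abs_add_le (Φ (b n) - Φ (a n)) (∫ ξ in a n..b n, w ξ)
  have h2 := abs_sub (Φ (b n)) (Φ (a n))
  linarith [ha' n, hb' n, hM _ _ hab]

end HasIntegral

namespace IsPartitionFunction

variable {χ : ℝ → ℝ} (hχ : IsPartitionFunction χ)

/-- `e^{|ξ|} χ' ∘ y ∈ C_b`. -/
def chiD1 (X : State) : Cb := (weightedKernel _ _ hχ.expDecay_deriv).op (zetaCb X)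

theorem weight_mul_chiD1 (X : State) (ξ : ℝ) : weight ξ * hχ.chiD1 X ξ = deriv χ (X.toE.y ξ) :=
  weight_mul_exp ξ _

/-- Only the weighted difference e^{|ξ|} (χ∘y - χ) then needs to be differentiated in time; it
serves both the C_b and the L² version of Ū. -/
theorem chiY_eq (X : State) : hχ.chiY X = hχ.chiCb + weight * hχ.chiDiff X := by
  ext ξ
  have e : hχ.chiDiff X ξ = Real.exp |ξ| * (χ (X.toE.y ξ) - χ ξ) := rfl
  rw [BoundedContinuousFunction.add_apply, BoundedContinuousFunction.mul_apply, chiY_apply, e,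
    weight_mul_exp]
  exact (add_sub_cancel (χ ξ) _).symm

/-- The velocity of `Ū` in `C_b`. -/
def velC (X : State) : Cb :=
  hχ.UC (hχ.field X) - cR X • (weight * (hχ.chiD1 X * hχ.UC X))

/-- The velocity of `Ū` in `L²`. -/
def velL (X : State) : L2 := -hχ.QL X - cR X • mulL2 (hχ.chiD1 X * hχ.UC X) weightL2

theorem velC_ae (X : State) : hχ.velC X =ᵐ[volume] fun ξ =>
    -hχ.QC X ξ - cR X * (deriv χ (X.toE.y ξ) * hχ.UC X ξ) := by
  filter_upwards [hχ.U_ae (hχ.field X), hχ.QL_ae X, Lp.coeFn_neg (hχ.QL X)] with ξ h1 h2 h3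
  have e1 : (hχ.field X).toE.U χ ξ = (-hχ.QL X : L2) ξ + 0 * χ ξ := rfl
  have e2 : hχ.velC X ξ = hχ.UC (hχ.field X) ξ - cR X * (weight ξ * (hχ.chiD1 X ξ * hχ.UC X ξ)) :=
    rfl
  rw [e2, ← h1, e1, h3, Pi.neg_apply, h2, ← hχ.weight_mul_chiD1]
  ring

theorem velL_ae (X : State) : hχ.velL X =ᵐ[volume] fun ξ =>
    -hχ.QC X ξ - cR X * (deriv χ (X.toE.y ξ) * hχ.UC X ξ) := by
  filter_upwards [Lp.coeFn_sub (-hχ.QL X) (cR X • mulL2 (hχ.chiD1 X * hχ.UC X) weightL2),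
    Lp.coeFn_neg (hχ.QL X), hχ.QL_ae X, Lp.coeFn_smul (cR X) (mulL2 (hχ.chiD1 X * hχ.UC X) weightL2),
    coeFn_mulL2 (hχ.chiD1 X * hχ.UC X) weightL2, coeFn_weightL2] with ξ h1 h2 h3 h4 h5 h6
  rw [velL, h1, Pi.sub_apply, h2, Pi.neg_apply, h3, h4, Pi.smul_apply, h5, h6,
    BoundedContinuousFunction.mul_apply, ← hχ.weight_mul_chiD1, smul_eq_mul]
  ring

section Derivative

variable {X : ℝ → State} {s : Set ℝ} {t : ℝ}

theorem hasDerivWithinAt_chiDiff (h : HasDerivWithinAt X (hχ.field (X t)) s t) :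
    HasDerivWithinAt (fun t => hχ.chiDiff (X t)) (hχ.chiD1 (X t) * hχ.UC (X t)) s t := by
  have hd : ∀ ξ r, HasDerivAt (hχ.chiDiffKernel.toFun ξ)
      ((weightedKernel _ _ hχ.expDecay_deriv).toFun ξ r) r := fun ξ r =>
    ((hasDerivAt_comp_add hχ.hasDerivAt ξ r).sub_const _).const_mul _
  exact (SupKernel.hasFDerivAt_op hd (zetaCb (X t))).comp_hasDerivWithinAt t
    (zetaCb.hasFDerivAt.comp_hasDerivWithinAt t h)

theorem hasDerivWithinAt_UbarC (h : HasDerivWithinAt X (hχ.field (X t)) s t) :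
    HasDerivWithinAt (fun t => hχ.UbarC (X t)) (hχ.velC (X t)) s t := by
  have h1 : HasDerivWithinAt (fun t => hχ.UC (X t)) (hχ.UC (hχ.field (X t))) s t :=
    hχ.UC.hasFDerivAt.comp_hasDerivWithinAt t h
  have h2 : HasDerivWithinAt (fun t => cR (X t)) 0 s t := cR.hasFDerivAt.comp_hasDerivWithinAt t h
  have h3 : HasDerivWithinAt (fun t => hχ.chiY (X t))
      (weight * (hχ.chiD1 (X t) * hχ.UC (X t))) s t := by
    simp only [chiY_eq]
    exact ((hχ.hasDerivWithinAt_chiDiff h).const_mul weight).const_add _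
  refine (h1.sub (h2.smul h3)).congr_deriv ?_
  rw [zero_smul, add_zero]; rfl

theorem hasDerivWithinAt_UbarL (h : HasDerivWithinAt X (hχ.field (X t)) s t) :
    HasDerivWithinAt (fun t => hχ.UbarL (X t)) (hχ.velL (X t)) s t := by
  have h1 : HasDerivWithinAt (fun t => uL2 (X t)) (-hχ.QL (X t)) s t :=
    uL2.hasFDerivAt.comp_hasDerivWithinAt t h
  have h2 : HasDerivWithinAt (fun t => cR (X t)) 0 s t := cR.hasFDerivAt.comp_hasDerivWithinAt t h
  have h3 : HasDerivWithinAt (fun t => mulL2 (hχ.chiDiff (X t)) weightL2)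
      (mulL2 (hχ.chiD1 (X t) * hχ.UC (X t)) weightL2) s t :=
    (mulL2.flip weightL2).hasFDerivAt.comp_hasDerivWithinAt t (hχ.hasDerivWithinAt_chiDiff h)
  refine (h1.sub (h2.smul h3)).congr_deriv ?_
  rw [zero_smul, add_zero]; rfl

/-- The rate of change of the energy. -/
def energyRate (X : State) : ℝ :=
  (inner ℝ (hχ.UbarL X) (hχ.velL X) + inner ℝ (hχ.velL X) (hχ.UbarL X)) +
    (inner ℝ (mulL2 (hχ.UbarC X) (hχ.UbarL X)) (hχ.UD X) +
      inner ℝ (mulL2 (hχ.UbarC X) (hχ.velL X) + mulL2 (hχ.velC X) (hχ.UbarL X)) (zetaD X)) +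
    (inner ℝ (hχ.UD X) (hχ.UD (hχ.field X)) + inner ℝ (hχ.UD (hχ.field X)) (hχ.UD X)) -
    (inner ℝ (hL2 X) (hχ.UD X) + inner ℝ (hL2 (hχ.field X)) (zetaD X))

theorem hasDerivWithinAt_energy (h : HasDerivWithinAt X (hχ.field (X t)) s t) :
    HasDerivWithinAt (fun t => hχ.energy (X t)) (hχ.energyRate (X t)) s t := by
  have h1 := hχ.hasDerivWithinAt_UbarL h
  have h2 : HasDerivWithinAt (fun t => mulL2 (hχ.UbarC (X t)) (hχ.UbarL (X t)))
      (mulL2 (hχ.UbarC (X t)) (hχ.velL (X t)) + mulL2 (hχ.velC (X t)) (hχ.UbarL (X t))) s t :=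
    mulL2.hasDerivWithinAt_of_bilinear (hχ.hasDerivWithinAt_UbarC h) h1
  have h3 : HasDerivWithinAt (fun t => zetaD (X t)) (hχ.UD (X t)) s t :=
    zetaD.hasFDerivAt.comp_hasDerivWithinAt t h
  have h4 : HasDerivWithinAt (fun t => hχ.UD (X t)) (hχ.UD (hχ.field (X t))) s t :=
    hχ.UD.hasFDerivAt.comp_hasDerivWithinAt t h
  have h5 : HasDerivWithinAt (fun t => hL2 (X t)) (hL2 (hχ.field (X t))) s t :=
    hL2.hasFDerivAt.comp_hasDerivWithinAt t h
  exact (((h1.inner ℝ h1).add (h2.inner ℝ h3)).add (h4.inner ℝ h4)).sub (h5.inner ℝ h3)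

end Derivative

variable (X : State)

/-- The density of `energyRate`. -/
def rateDensity (ξ : ℝ) : ℝ :=
  2 * (-hχ.QC X ξ - cR X * (deriv χ (X.toE.y ξ) * hχ.UC X ξ)) * hχ.UbarC X ξ * (1 + zetaD X ξ) +
    hχ.UbarC X ξ ^ 2 * hχ.UD X ξ + 2 * (hχ.UC X ξ ^ 2 - hχ.PC X ξ) * hχ.UD X ξ

/-- The terms with h U_ξ and with (U² - P) U_ξ ζ_ξ cancel after inserting U_ξt = h/2 + (U² - P) y_ξ.
The algebraic relation of 𝒢 is not involved. -/
theorem energyRate_spec : HasIntegral (hχ.rateDensity X) (hχ.energyRate X) := by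
  refine HasIntegral.congr ((((HasIntegral.inner _ _).add (HasIntegral.inner _ _)).add
    ((HasIntegral.inner _ _).add (HasIntegral.inner _ _))).add
    ((HasIntegral.inner _ _).add (HasIntegral.inner _ _)) |>.sub
    ((HasIntegral.inner _ _).add (HasIntegral.inner _ _))) ?_
  filter_upwards [hχ.velL_ae X, hχ.velC_ae X, hχ.UbarL_ae X,
    coeFn_mulL2 (hχ.UbarC X) (hχ.UbarL X), coeFn_mulL2 (hχ.UbarC X) (hχ.velL X),
    coeFn_mulL2 (hχ.velC X) (hχ.UbarL X), hχ.UD_field_ae X, hχ.U_sq_sub_P_ae X, hχ.U_ae X,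
    hχ.UDeriv_ae X, Lp.coeFn_add (mulL2 (hχ.UbarC X) (hχ.velL X)) (mulL2 (hχ.velC X) (hχ.UbarL X))]
    with ξ h1 h2 h3 h4 h5 h6 h7 h8 h9 h10 h11
  have e : hχ.coeff X ξ = hχ.UC X ξ * hχ.UC X ξ - hχ.PC X ξ := rfl
  rw [h11, Pi.add_apply, h4, h5, h6, h7, ← h8, h9, h10, hχ.P_eq, h1, h2, h3, e, rateDensity]
  ring

/-- The antiderivative in the balance law of the energy. -/
def flux (ξ : ℝ) : ℝ :=
  -2 * (hχ.UbarC X ξ * hχ.PC X ξ) + (2 / 3 * hχ.UC X ξ ^ 3 + 1 / 3 * hχ.UbarC X ξ ^ 3)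

/-- The coefficient of the source in the balance law of the energy. -/
def sourceCoeff (ξ : ℝ) : ℝ :=
  cR X * (-2 * hχ.PC X ξ + hχ.UbarC X ξ ^ 2 - 2 * hχ.UbarC X ξ * hχ.UC X ξ)

/-- The derivative of `flux`. -/
def fluxDeriv (ξ : ℝ) : ℝ :=
  hχ.rateDensity X ξ - deriv χ (X.toE.y ξ) * (1 + zetaD X ξ) * hχ.sourceCoeff X ξ

/-- By P_ξ = Q y_ξ, the terms of the rate density not containing χ'(y) y_ξ form the exact derivative
of -2 Ū P + (2/3) U³ + (1/3) Ū³, up to multiples of χ'(y) y_ξ arising from Ū_ξ = U_ξ - c χ'(y) y_ξ.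
-/
theorem flux_hasPrim : HasPrim (hχ.flux X) (hχ.fluxDeriv X) := by
  have hcube : ∀ x : ℝ, HasDerivAt (fun s : ℝ => s ^ 3) (3 * x ^ 2) x := fun x => by
    simpa using hasDerivAt_pow 3 x
  have c3 : Continuous fun x : ℝ => 3 * x ^ 2 := by fun_prop
  have h1 := (((hχ.UbarC_hasPrim X).mul (hχ.PC_hasPrim X)).const_mul (-2)).add
    (((HasPrim.comp hcube c3 (hχ.U_hasPrim X)).const_mul (2 / 3)).add
      ((HasPrim.comp hcube c3 (hχ.UbarC_hasPrim X)).const_mul (1 / 3)))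
  refine h1.congr_right (Eventually.of_forall fun ξ => ?_)
  simp only [fluxDeriv, rateDensity, sourceCoeff]
  ring

variable {X}

/-- The threshold 1/(1 + ‖P‖) makes both Ū and Ū P at most 1 in absolute value, so the flux there is
bounded in terms of `C` alone, whatever the energy. -/
theorem abs_flux_le {C : ℝ} (hc : |cR X| ≤ C) {ξ : ℝ} (h : |hχ.UbarC X ξ| ≤ 1 / (1 + ‖hχ.PC X‖)) :
    |hχ.flux X ξ| ≤ 3 + (1 + C) ^ 3 := by
  have hP := (hχ.PC X).norm_coe_le_norm ξ
  have hP0 := norm_nonneg (hχ.PC X)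
  rw [Real.norm_eq_abs] at hP
  have hC : 0 ≤ C := (abs_nonneg _).trans hc
  have h1 : |hχ.UbarC X ξ| ≤ 1 := h.trans (by rw [div_le_one (by positivity)]; linarith)
  have h2 : |hχ.UbarC X ξ * hχ.PC X ξ| ≤ 1 := by
    rw [abs_mul]
    calc _ ≤ 1 / (1 + ‖hχ.PC X‖) * (1 + ‖hχ.PC X‖) := by gcongr; linarith
      _ = 1 := by field_simp
  have h3 : |hχ.UC X ξ| ≤ 1 + C := by
    have e : hχ.UC X ξ = hχ.UbarC X ξ + cR X * χ (X.toE.y ξ) := by rw [UbarC_apply]; ring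
    rw [e]
    refine (abs_add_le _ _).trans (add_le_add h1 ?_)
    rw [abs_mul]
    calc _ ≤ C * 1 := by gcongr; exact hχ.abs_le_one _
      _ = C := mul_one C
  have h4 : |hχ.UC X ξ ^ 3| ≤ (1 + C) ^ 3 := by rw [abs_pow]; gcongr
  have h5 : |hχ.UbarC X ξ ^ 3| ≤ 1 := by rw [abs_pow]; exact pow_le_one₀ (abs_nonneg _) h1
  have p : 0 ≤ (1 + C) ^ 3 := by positivity
  rw [abs_le] at *
  simp only [flux]
  constructor <;> linarith [h2.1, h2.2, h4.1, h4.2, h5.1, h5.2]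

/-- The flux is evaluated at points tending to ±∞ where the square integrable function Ū is small;
the remaining source is weighted by χ'(y) y_ξ, of mass at most 1, so only its sup norm counts. -/
theorem abs_energyRate_le {C : ℝ} (hX : hχ.Admissible X) (hc : |cR X| ≤ C) :
    |hχ.energyRate X| ≤ 2 * (3 + (1 + C) ^ 3) +
      C * (2 * ‖hχ.PC X‖ + ‖hχ.UbarC X‖ ^ 2 + 2 * ‖hχ.UbarC X‖ * ‖hχ.UC X‖) := by
  have hC : 0 ≤ C := (abs_nonneg _).trans hc
  have hP := norm_nonneg (hχ.PC X)
  have h1 : HasIntegral (fun ξ => hχ.fluxDeriv X ξ +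
      deriv χ (X.toE.y ξ) * (1 + zetaD X ξ) * hχ.sourceCoeff X ξ) (hχ.energyRate X) := by
    simpa only [fluxDeriv, sub_add_cancel] using hχ.energyRate_spec X
  have hε : 0 < 1 / (1 + ‖hχ.PC X‖) := by positivity
  have hcont : Continuous (hχ.sourceCoeff X) := by
    have a1 := (hχ.PC X).continuous
    have a2 := (hχ.UbarC X).continuous
    have a3 := (hχ.UC X).continuous
    unfold sourceCoeff
    fun_prop
  have hw : LocallyIntegrable fun ξ =>
      deriv χ (X.toE.y ξ) * (1 + zetaD X ξ) * hχ.sourceCoeff X ξ := by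
    simpa [smul_eq_mul] using (hχ.chiY_hasPrim X).1.mul_continuous hcont
  refine h1.abs_le (hχ.flux_hasPrim X) hw (fun N => ?_) (fun N => ?_) fun a b hab =>
    hχ.abs_integral_transition_le hX (fun ξ => ?_) hab
  · obtain ⟨a, ha, h⟩ := exists_abs_le_atBot (hχ.integrable_Ubar_sq X) hε N
    exact ⟨a, ha, hχ.abs_flux_le hc h⟩
  · obtain ⟨a, ha, h⟩ := exists_abs_le_atTop (hχ.integrable_Ubar_sq X) hε N
    exact ⟨a, ha, hχ.abs_flux_le hc h⟩
  · have b1 := (hχ.PC X).norm_coe_le_norm ξ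
    have b2 := (hχ.UbarC X).norm_coe_le_norm ξ
    have b3 := (hχ.UC X).norm_coe_le_norm ξ
    rw [Real.norm_eq_abs] at b1 b2 b3
    rw [sourceCoeff, abs_mul]
    have b4 : |hχ.UbarC X ξ ^ 2| ≤ ‖hχ.UbarC X‖ ^ 2 := by rw [abs_pow]; gcongr
    have b5 : |hχ.UbarC X ξ * hχ.UC X ξ| ≤ ‖hχ.UbarC X‖ * ‖hχ.UC X‖ := by rw [abs_mul]; gcongr
    gcongr
    rw [abs_le] at b1 b4 b5 ⊢
    constructor <;> linarith [b1.1, b1.2, b4.1, b4.2, b5.1, b5.2]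

theorem exists_energyRate_bound (C : ℝ) : ∃ K, 0 ≤ K ∧ ∀ X : State, hχ.Admissible X → |cR X| ≤ C →
    |hχ.energyRate X| ≤ K * (1 + hχ.energy X) := by
  obtain ⟨K, hK, H⟩ := hχ.exists_bounds C
  refine ⟨|2 * (3 + (1 + C) ^ 3) + C ^ 3| + |C| * (6 * K), by positivity, fun X hX hc => ?_⟩
  have hC : 0 ≤ C := (abs_nonneg _).trans hc
  have h0 := hχ.energy_nonneg hX
  obtain ⟨h1, -, h2, h3⟩ := H X hX hc
  have h4 := hχ.abs_energyRate_le hX hc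
  have n := norm_nonneg (hχ.UbarC X)
  set k := K * (1 + hχ.energy X)
  have h5 : ‖hχ.UbarC X‖ * ‖hχ.UC X‖ ≤ ‖hχ.UbarC X‖ * (‖hχ.UbarC X‖ + C) := by gcongr
  -- Both ‖P‖ and ‖Ū‖² are at most k, and 2 C ‖Ū‖ ≤ ‖Ū‖² + C²; the multiples of k add up to 2 + 1 +
  -- 2 + 1.
  have h6 : 2 * ‖hχ.PC X‖ + ‖hχ.UbarC X‖ ^ 2 + 2 * ‖hχ.UbarC X‖ * ‖hχ.UC X‖ ≤ 6 * k + C ^ 2 := by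
    nlinarith [sq_nonneg (C - ‖hχ.UbarC X‖)]
  have h7 : C * (2 * ‖hχ.PC X‖ + ‖hχ.UbarC X‖ ^ 2 + 2 * ‖hχ.UbarC X‖ * ‖hχ.UC X‖) ≤
      C * (6 * k + C ^ 2) := by gcongr
  have h8 : (|2 * (3 + (1 + C) ^ 3) + C ^ 3| + |C| * (6 * K)) * (1 + hχ.energy X) =
      (2 * (3 + (1 + C) ^ 3) + C ^ 3) * (1 + hχ.energy X) + C * (6 * k) := by
    rw [abs_of_nonneg (by positivity), abs_of_nonneg hC]; ring
  have h9 : 0 ≤ (2 * (3 + (1 + C) ^ 3) + C ^ 3) * hχ.energy X := by positivity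
  rw [h8]
  nlinarith

theorem cR_eq {X : ℝ → State} {τ : ℝ} (hX : SolvesOn hχ.field X τ) :
    ∀ t ∈ Icc 0 τ, cR (X t) = cR (X 0) := fun t ht => by
  have hd : ∀ t ∈ Icc 0 τ, HasDerivWithinAt (fun t => cR (X t)) 0 (Icc 0 τ) t := fun t ht =>
    cR.hasFDerivAt.comp_hasDerivWithinAt t (hX t ht)
  have := (convex_Icc 0 τ).norm_image_sub_le_of_norm_hasDerivWithin_le (C := 0) hd
    (fun _ _ => by simp) (left_mem_Icc.2 (ht.1.trans ht.2)) ht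
  rw [zero_mul] at this
  exact sub_eq_zero.1 (norm_le_zero_iff.1 this)

theorem abs_cR_le (X : State) : |cR X| ≤ ‖X‖ := by
  have h := cR.le_opNorm X
  have h1 : ‖cR‖ ≤ 1 := LinearMap.mkContinuous_norm_le _ zero_le_one _
  have h2 : ‖cR‖ * ‖X‖ ≤ 1 * ‖X‖ := by gcongr
  rw [Real.norm_eq_abs] at h
  linarith

/-- The energy stays bounded on bounded time intervals. -/
theorem exists_energy_bound (T R : ℝ) : ∃ B, 0 ≤ B ∧ ∀ (X : ℝ → State) (τ : ℝ), τ ≤ T →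
    SolvesOn hχ.field X τ → (∀ t ∈ Icc 0 τ, hχ.Admissible (X t)) → ‖X 0‖ ≤ R →
    ∀ t ∈ Icc 0 τ, hχ.energy (X t) ≤ B := by
  obtain ⟨K, hK, H⟩ := hχ.exists_energyRate_bound R
  obtain ⟨M, hM, HM⟩ := hχ.lipBdd_energy.bdd R
  refine ⟨(1 + M) * Real.exp (K * T), by positivity, fun X τ hτ hX hG h0 t ht => ?_⟩
  have hd := fun t (ht : t ∈ Ico 0 τ) =>
    (hχ.hasDerivWithinAt_energy (hX.hasDerivWithinAt_Ici ht)).const_add 1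
  have hc : ContinuousOn (fun t => 1 + hχ.energy (X t)) (Icc 0 τ) := fun t ht =>
    ((hχ.hasDerivWithinAt_energy (hX t ht)).const_add 1).continuousWithinAt
  -- Gronwall for 1 + energy, so that the inequality is homogeneous and ε = 0.
  have key := norm_le_gronwallBound_of_norm_deriv_right_le (δ := 1 + M) (K := K) (ε := 0) hc hd ?_
    ?_ t ht
  · rw [gronwallBound_ε0, sub_zero, Real.norm_eq_abs] at key
    have h1 := (le_abs_self _).trans key
    have h2 : (1 + M) * Real.exp (K * t) ≤ (1 + M) * Real.exp (K * T) := by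
      gcongr
      exact ht.2.trans hτ
    linarith
  · have := HM (X 0) h0
    rw [Real.norm_eq_abs] at this ⊢
    refine (abs_add_le _ _).trans ?_
    rw [abs_one]; linarith
  · intro s hs
    have hs' : s ∈ Icc 0 τ := ⟨hs.1, hs.2.le⟩
    have hn := hχ.energy_nonneg (hG s hs')
    rw [add_zero, Real.norm_eq_abs, Real.norm_of_nonneg (by linarith)]
    refine H _ (hG s hs') ?_
    rw [hχ.cR_eq hX s hs']
    exact (abs_cR_le _).trans h0

end IsPartitionFunction

open E

/-! ### Linear growth of the vector field where the energy is bounded -/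

section Growth

variable {A B C D : Type*} [NormedAddCommGroup B] [NormedAddCommGroup C] [NormedAddCommGroup D]
  {S : Set A}

/-- `f` is bounded on `S`. -/
def BddOn (S : Set A) (f : A → B) : Prop := ∃ K, 0 ≤ K ∧ ∀ x ∈ S, ‖f x‖ ≤ K

namespace BddOn

theorem of_le {f : A → B} {K : ℝ} (h : ∀ x ∈ S, ‖f x‖ ≤ K) : BddOn S f :=
  ⟨|K|, abs_nonneg _, fun x hx => (h x hx).trans (le_abs_self K)⟩

theorem const (b : B) : BddOn S fun _ : A => b := ⟨‖b‖, norm_nonneg _, fun _ _ => le_rfl⟩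

theorem comp_lipBdd {f : A → B} {k : B → C} (hk : LipBdd k) (hf : BddOn S f) :
    BddOn S fun x => k (f x) := by
  obtain ⟨K, -, H⟩ := hf
  obtain ⟨M, hM, H'⟩ := hk.bdd K
  exact ⟨M, hM, fun x hx => H' _ (H x hx)⟩

theorem add {f k : A → B} (hf : BddOn S f) (hk : BddOn S k) : BddOn S fun x => f x + k x := by
  obtain ⟨K, hK, H⟩ := hf
  obtain ⟨L, hL, H'⟩ := hk
  exact ⟨K + L, by positivity, fun x hx => (norm_add_le _ _).trans (add_le_add (H x hx) (H' x hx))⟩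

theorem sub {f k : A → B} (hf : BddOn S f) (hk : BddOn S k) : BddOn S fun x => f x - k x := by
  obtain ⟨K, hK, H⟩ := hf
  obtain ⟨L, hL, H'⟩ := hk
  exact ⟨K + L, by positivity, fun x hx => (norm_sub_le _ _).trans (add_le_add (H x hx) (H' x hx))⟩

variable [NormedSpace ℝ B] [NormedSpace ℝ C] [NormedSpace ℝ D]

theorem bilin (b : B →L[ℝ] C →L[ℝ] D) {f : A → B} {k : A → C} (hf : BddOn S f) (hk : BddOn S k) :
    BddOn S fun x => b (f x) (k x) := by
  obtain ⟨K, hK, H⟩ := hf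
  obtain ⟨L, hL, H'⟩ := hk
  refine ⟨‖b‖ * K * L, by positivity, fun x hx => (b.le_opNorm₂ _ _).trans ?_⟩
  gcongr
  exacts [H x hx, H' x hx]

theorem smul {f : A → ℝ} {k : A → B} (hf : BddOn S f) (hk : BddOn S k) :
    BddOn S fun x => f x • k x :=
  bilin (ContinuousLinearMap.lsmul ℝ ℝ) hf hk

theorem mulCb {f k : A → Cb} (hf : BddOn S f) (hk : BddOn S k) : BddOn S fun x => f x * k x :=
  bilin (ContinuousLinearMap.mul ℝ Cb) hf hk

end BddOn

variable [NormedAddCommGroup A]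

/-- `f` grows at most linearly on `S`. -/
def LinGrowth (S : Set A) (f : A → B) : Prop := ∃ K, 0 ≤ K ∧ ∀ x ∈ S, ‖f x‖ ≤ K * (1 + ‖x‖)

theorem BddOn.linGrowth {f : A → B} (hf : BddOn S f) : LinGrowth S f := by
  obtain ⟨K, hK, H⟩ := hf
  refine ⟨K, hK, fun x hx => (H x hx).trans ?_⟩
  have := mul_nonneg hK (norm_nonneg x)
  linarith

namespace LinGrowth

theorem add {f k : A → B} (hf : LinGrowth S f) (hk : LinGrowth S k) :
    LinGrowth S fun x => f x + k x := by
  obtain ⟨K, hK, H⟩ := hf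
  obtain ⟨L, hL, H'⟩ := hk
  refine ⟨K + L, by positivity, fun x hx => (norm_add_le _ _).trans ?_⟩
  rw [add_mul]
  exact add_le_add (H x hx) (H' x hx)

theorem neg {f : A → B} (hf : LinGrowth S f) : LinGrowth S fun x => -f x := by
  obtain ⟨K, hK, H⟩ := hf
  exact ⟨K, hK, fun x hx => by rw [norm_neg]; exact H x hx⟩

theorem sub {f k : A → B} (hf : LinGrowth S f) (hk : LinGrowth S k) :
    LinGrowth S fun x => f x - k x := by
  simpa only [sub_eq_add_neg] using hf.add hk.neg

variable [NormedSpace ℝ B] [NormedSpace ℝ C] [NormedSpace ℝ D]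

theorem clm [NormedSpace ℝ A] (f : A →L[ℝ] B) : LinGrowth S f := by
  refine ⟨‖f‖, norm_nonneg _, fun x _ => (f.le_opNorm x).trans ?_⟩
  gcongr
  linarith

theorem clm_comp (k : B →L[ℝ] C) {f : A → B} (hf : LinGrowth S f) :
    LinGrowth S fun x => k (f x) := by
  obtain ⟨K, hK, H⟩ := hf
  refine ⟨‖k‖ * K, by positivity, fun x hx => (k.le_opNorm _).trans ?_⟩
  rw [mul_assoc]
  gcongr
  exact H x hx

theorem bilin (b : B →L[ℝ] C →L[ℝ] D) {f : A → B} {k : A → C} (hf : BddOn S f)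
    (hk : LinGrowth S k) : LinGrowth S fun x => b (f x) (k x) := by
  obtain ⟨K, hK, H⟩ := hf
  obtain ⟨L, hL, H'⟩ := hk
  refine ⟨‖b‖ * K * L, by positivity, fun x hx => (b.le_opNorm₂ _ _).trans ?_⟩
  rw [mul_assoc _ L]
  gcongr
  exacts [H x hx, H' x hx]

theorem const_smul (r : ℝ) {f : A → B} (hf : LinGrowth S f) : LinGrowth S fun x => r • f x :=
  clm_comp (r • ContinuousLinearMap.id ℝ B) hf

theorem smul {f : A → ℝ} {k : A → B} (hf : BddOn S f) (hk : LinGrowth S k) :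
    LinGrowth S fun x => f x • k x :=
  bilin (ContinuousLinearMap.lsmul ℝ ℝ) hf hk

end LinGrowth

end Growth

namespace IsPartitionFunction

variable {χ : ℝ → ℝ} (hχ : IsPartitionFunction χ)

/-- The states with prescribed bounds on the quantities controlled by the energy. -/
def region (M : ℝ) : Set State :=
  {X | ‖zetaCb X‖ ≤ M ∧ ‖hχ.UC X‖ ≤ M ∧ ‖leftC X (hχ.dens X) + rightC X (hχ.dens X)‖ ≤ M ∧
    ‖cR X‖ ≤ M}

variable {hχ} in
theorem bddOn_op (M : ℝ) (Ψ : SupKernel) : BddOn (hχ.region M) fun X : State => Ψ.op (zetaCb X) :=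
  BddOn.comp_lipBdd Ψ.lipBdd_op (BddOn.of_le fun _ hX => hX.1)

/-- In this region every coefficient built from ζ, U, c and the kernel integrals is bounded, and
each component of the field is either bounded or linear in the remaining L² quantities. The one
product that looks quadratic, the kernel sum times ζ_ξ in Q_ξ, is linear because the sup norm of the
kernel sum is already controlled. -/
theorem linGrowth_field (M : ℝ) : LinGrowth (hχ.region M) hχ.field := by
  set S := hχ.region M with hS
  have bU : BddOn S fun X => hχ.UC X := BddOn.of_le fun X hX => hX.2.1
  have bJ : BddOn S fun X => leftC X (hχ.dens X) + rightC X (hχ.dens X) :=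
    BddOn.of_le fun X hX => hX.2.2.1
  have bc : BddOn S fun X => cR X := BddOn.of_le fun X hX => hX.2.2.2
  have bc2 : BddOn S fun X => cR X * cR X := bc.smul bc
  have bχ : BddOn S fun X => hχ.chiY X := bddOn_op M _
  have be : ∀ σ, BddOn S fun X => expZ σ X := fun σ => bddOn_op M _
  have bP : BddOn S fun X => hχ.PC X :=
    (BddOn.smul (BddOn.const (1 / 4 : ℝ)) bJ).add (bc2.smul (bddOn_op M _))
  have gD : LinGrowth S fun X => zetaD X := LinGrowth.clm zetaD
  have gU : LinGrowth S fun X => hχ.UD X := LinGrowth.clm hχ.UD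
  have gL : LinGrowth S fun X => hχ.UbarL X :=
    (LinGrowth.clm uL2).sub (LinGrowth.smul bc
      (BddOn.bilin mulL2 (bddOn_op M hχ.chiDiffKernel) (BddOn.const weightL2)).linGrowth)
  have gd : LinGrowth S fun X => hχ.dens X :=
    ((LinGrowth.const_smul 2 (LinGrowth.bilin mulL2
      ((bU.mulCb bU).sub (bc2.smul (bχ.mulCb bχ))) gD)).add (LinGrowth.clm hL2)).add
      (LinGrowth.const_smul 2 (LinGrowth.bilin mulL2 (bU.add (bc.smul bχ)) gL))
  have gl : LinGrowth S fun X => leftL X (hχ.dens X) :=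
    LinGrowth.bilin mulL2 (be (-1)) (LinGrowth.clm_comp convLeftL2 (LinGrowth.bilin mulL2 (be 1) gd))
  have gr : LinGrowth S fun X => rightL X (hχ.dens X) :=
    LinGrowth.bilin mulL2 (be 1) (LinGrowth.clm_comp convRightL2 (LinGrowth.bilin mulL2 (be (-1)) gd))
  have gQ : LinGrowth S fun X => hχ.QL X :=
    (LinGrowth.const_smul (1 / 4) (gr.sub gl)).add (LinGrowth.smul bc2
      (BddOn.bilin mulL2 (bddOn_op M _) (BddOn.const weightL2)).linGrowth)
  have gQD : LinGrowth S fun X => hχ.QD X :=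
    ((LinGrowth.const_smul (1 / 4) ((LinGrowth.bilin mulL2 bJ gD).add (gl.add gr))).sub
      (LinGrowth.const_smul (1 / 2) gd)).add (LinGrowth.smul bc2
        ((LinGrowth.bilin mulL2 ((BddOn.const weight).mulCb (bddOn_op M _)) gD).add
          (BddOn.bilin mulL2 (bddOn_op M _) (BddOn.const weightL2)).linGrowth))
  have gh : LinGrowth S fun X => hL2 (hχ.field X) :=
    LinGrowth.const_smul 2 (LinGrowth.bilin mulL2 ((bU.mulCb bU).sub bP) gU)
  obtain ⟨K1, p1, H1⟩ := bU.linGrowth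
  obtain ⟨K2, p2, H2⟩ := gU
  obtain ⟨K3, p3, H3⟩ := gQ
  obtain ⟨K4, p4, H4⟩ := gQD
  obtain ⟨K5, p5, H5⟩ := gh
  refine ⟨K1 + K2 + K3 + K4 + K5, by positivity, fun X hX => (norm_le _).trans ?_⟩
  rw [zetaCb_field, zetaD_field, uL2_field, uD_field, cR_field, norm_neg, norm_neg, norm_zero]
  have := H1 X hX
  have := H2 X hX
  have := H3 X hX
  have := H4 X hX
  have := H5 X hX
  linarith

theorem admissible_of_mem_setG {X : State} (h : X.toE ∈ setG χ) : hχ.Admissible X := by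
  filter_upwards [((hχ.mem_setG_iff X).1 h).2] with ξ h
  exact ⟨h.1, h.2.1, h.2.2.2⟩

theorem norm_zetaCb_le (X : State) : ‖zetaCb X‖ ≤ ‖X‖ := by
  have h := zetaCb.le_opNorm X
  have h1 : ‖zetaCb‖ ≤ 1 := LinearMap.mkContinuous_norm_le _ zero_le_one _
  have h2 : ‖zetaCb‖ * ‖X‖ ≤ 1 * ‖X‖ := by gcongr
  linarith

/-- Solutions in `𝒢` stay in a region where the vector field grows linearly. -/
theorem exists_region (T R : ℝ) : ∃ M, ∀ (X : ℝ → State) (τ : ℝ), τ ≤ T →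
    SolvesOn hχ.field X τ → (∀ t ∈ Icc 0 τ, hχ.Admissible (X t)) → ‖X 0‖ ≤ R →
    ∀ t ∈ Icc 0 τ, X t ∈ hχ.region M := by
  obtain ⟨B, hB, HB⟩ := hχ.exists_energy_bound T R
  obtain ⟨K, hK, HK⟩ := hχ.exists_bounds R
  set k := K * (1 + B) with hk
  -- The summands bound in turn ζ (initial size plus time times speed), U, the kernel sum and c.
  refine ⟨R + |T| * (1 + k + R) + (1 + k + R) + k + R, fun X τ hτ hX hG h0 t ht => ?_⟩
  have hR : 0 ≤ R := (norm_nonneg _).trans h0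
  have hk0 : 0 ≤ k := by positivity
  have hc : ∀ t ∈ Icc 0 τ, |cR (X t)| ≤ R := fun t ht => by
    rw [hχ.cR_eq hX t ht]; exact (abs_cR_le _).trans h0
  have hE : ∀ t ∈ Icc 0 τ, K * (1 + hχ.energy (X t)) ≤ k := fun t ht => by
    exact mul_le_mul_of_nonneg_left (by linarith [HB X τ hτ hX hG h0 t ht]) hK
  have hU : ∀ t ∈ Icc 0 τ, ‖hχ.UC (X t)‖ ≤ 1 + k + R := fun t ht => by
    obtain ⟨h1, -, -, h2⟩ := HK _ (hG t ht) (hc t ht)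
    have := hE t ht
    nlinarith [sq_nonneg (‖hχ.UbarC (X t)‖ - 1)]
  have hζ : ‖zetaCb (X t)‖ ≤ R + |T| * (1 + k + R) := by
    have hd : ∀ t ∈ Icc 0 τ, HasDerivWithinAt (fun t => zetaCb (X t)) (hχ.UC (X t)) (Icc 0 τ) t :=
      fun t ht => zetaCb.hasFDerivAt.comp_hasDerivWithinAt t (hX t ht)
    have h1 := (convex_Icc 0 τ).norm_image_sub_le_of_norm_hasDerivWithin_le hd hU
      (left_mem_Icc.2 (ht.1.trans ht.2)) ht
    have h2 : ‖t - 0‖ ≤ |T| := by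
      rw [sub_zero, Real.norm_of_nonneg ht.1]
      exact (ht.2.trans hτ).trans (le_abs_self T)
    have h3 := norm_add_le (zetaCb (X 0)) (zetaCb (X t) - zetaCb (X 0))
    rw [add_sub_cancel] at h3
    have h4 : (1 + k + R) * ‖t - 0‖ ≤ (1 + k + R) * |T| := by gcongr
    have h5 := norm_zetaCb_le (X 0)
    linarith
  have hT : 0 ≤ |T| * (1 + k + R) := by positivity
  obtain ⟨-, h2, -, -⟩ := HK _ (hG t ht) (hc t ht)
  have h3 := hE t ht
  have h4 := hU t ht
  have h5 := hc t ht
  refine ⟨by linarith, by linarith, by linarith, ?_⟩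
  rw [Real.norm_eq_abs]; linarith

/-- The a priori bound for solutions in `𝒢`. -/
theorem exists_apriori_bound (T R : ℝ) : ∃ B, ∀ (X : ℝ → State) (τ : ℝ), τ ≤ T →
    SolvesOn hχ.field X τ → (∀ t ∈ Icc 0 τ, X t ∈ {X : State | X.toE ∈ setG χ}) → ‖X 0‖ ≤ R →
    ∀ t ∈ Icc 0 τ, ‖X t‖ ≤ B := by
  obtain ⟨M, HM⟩ := hχ.exists_region T R
  obtain ⟨K, hK, H⟩ := hχ.linGrowth_field M
  refine ⟨gronwallBound R K K T, fun X τ hτ hX hG h0 t ht => ?_⟩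
  have hR : 0 ≤ R := (norm_nonneg _).trans h0
  have hreg := HM X τ hτ hX (fun t ht => hχ.admissible_of_mem_setG (hG t ht)) h0
  -- Linear growth K (1 + ‖X‖) supplies both Gronwall constants.
  have key := norm_le_gronwallBound_of_norm_deriv_right_le hX.continuousOn
    (fun t ht => hX.hasDerivWithinAt_Ici ht) h0 (K := K) (ε := K) (fun s hs => by
      have := H _ (hreg s ⟨hs.1, hs.2.le⟩)
      linarith) t ht
  rw [sub_zero] at key
  exact key.trans (gronwallBound_mono hR hK hK (ht.2.trans hτ))

end IsPartitionFunction

open E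

/-! ### Global solutions -/

theorem contDiffOn_and_derivWithin_iff {X : ℝ → State} {F : State → State} (hF : Continuous F) :
    (ContDiffOn ℝ 1 X (Ici 0) ∧ ∀ t ∈ Ici (0 : ℝ), derivWithin X (Ici 0) t = F (X t)) ↔
      Solves F X := by
  constructor
  · rintro ⟨h1, h2⟩ t ht
    rw [← h2 t ht]
    exact (h1.differentiableOn one_ne_zero t ht).hasDerivWithinAt
  · intro h
    have e : ∀ t ∈ Ici (0 : ℝ), derivWithin X (Ici 0) t = F (X t) := fun t ht =>
      (h t ht).derivWithin (uniqueDiffOn_Ici 0 t ht)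
    refine ⟨(contDiffOn_one_iff_derivWithin (uniqueDiffOn_Ici 0)).2 ⟨fun t ht =>
      (h t ht).differentiableWithinAt, ?_⟩, e⟩
    exact ContinuousOn.congr (fun t ht => hF.continuousAt.comp_continuousWithinAt
      (h t ht).continuousWithinAt) e

namespace IsPartitionFunction

variable {χ : ℝ → ℝ} (hχ : IsPartitionFunction χ)

theorem isGlobalSolution_iff (X : ℝ → State) :
    IsGlobalSolution χ (fun t => (X t).toE) ↔ Solves hχ.field X := by
  rw [← contDiffOn_and_derivWithin_iff hχ.lipBdd_field.continuous]
  refine and_congr Iff.rfl (forall₂_congr fun t _ => ?_)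
  exact hχ.isVelocity_iff (X t) (derivWithin X (Ici 0) t)

/-- `𝒢` as a set of states. -/
def stateG (χ : ℝ → ℝ) : Set State := {X | X.toE ∈ setG χ}

theorem exists_solves {X₀ : State} (h : X₀ ∈ stateG χ) :
    ∃ X : ℝ → State, X 0 = X₀ ∧ Solves hχ.field X ∧ ∀ t, 0 ≤ t → X t ∈ stateG χ :=
  exists_solves_of_apriori hχ.lipBdd_field hχ.exists_solvesOn_setG hχ.exists_apriori_bound h

/-- The solution with initial value in `𝒢`. -/
def sol (X₀ : stateG χ) : ℝ → State := (hχ.exists_solves X₀.2).choose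

theorem sol_zero (X₀ : stateG χ) : hχ.sol X₀ 0 = X₀ := (hχ.exists_solves X₀.2).choose_spec.1

theorem solves_sol (X₀ : stateG χ) : Solves hχ.field (hχ.sol X₀) :=
  (hχ.exists_solves X₀.2).choose_spec.2.1

theorem sol_mem (X₀ : stateG χ) (t : ℝ) (ht : 0 ≤ t) : hχ.sol X₀ t ∈ stateG χ :=
  (hχ.exists_solves X₀.2).choose_spec.2.2 t ht

theorem continuous_sol : Continuous fun p : stateG χ × NNReal => hχ.sol p.1 p.2 := by
  refine continuous_flow hχ.lipBdd_field hχ.sol_zero hχ.solves_sol fun T R => ?_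
  obtain ⟨B, hB⟩ := hχ.exists_apriori_bound T R
  exact ⟨B, fun X hX t ht => hB _ T le_rfl ((hχ.solves_sol X).solvesOn T)
    (fun t ht => hχ.sol_mem X t ht.1) (by rw [sol_zero]; exact hX) t ht⟩

/-- The semigroup. -/
def semigroup (t : NNReal) (X₀ : stateG χ) : stateG χ := ⟨hχ.sol X₀ t, hχ.sol_mem X₀ t t.2⟩

theorem semigroup_zero (X₀ : stateG χ) : hχ.semigroup 0 X₀ = X₀ := Subtype.ext (hχ.sol_zero X₀)

/-- The equation is autonomous, so a time-shifted solution is again a solution, and uniqueness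
applies. -/
theorem semigroup_add (s t : NNReal) (X₀ : stateG χ) :
    hχ.semigroup (s + t) X₀ = hχ.semigroup s (hχ.semigroup t X₀) := by
  refine Subtype.ext ?_
  have h := Solves.unique hχ.lipBdd_field ((hχ.solves_sol X₀).shift t.2)
    (hχ.solves_sol (hχ.semigroup t X₀)) (by rw [sol_zero, zero_add]; rfl) s s.2
  exact h

theorem continuous_semigroup :
    Continuous fun p : stateG χ × NNReal => hχ.semigroup p.2 p.1 :=
  hχ.continuous_sol.subtype_mk _

end IsPartitionFunction

end CamassaHolm

end

theorem mainTheorem2 (χ : ℝ → ℝ) (hχ : CamassaHolm.IsPartitionFunction χ) :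
    (∀ X₀ ∈ CamassaHolm.setG χ, ∃ X : ℝ → CamassaHolm.E,
      CamassaHolm.IsGlobalSolution χ X ∧ X 0 = X₀ ∧
      (∀ t : ℝ, 0 ≤ t → X t ∈ CamassaHolm.setG χ) ∧
      ∀ Z : ℝ → CamassaHolm.E, CamassaHolm.IsGlobalSolution χ Z → Z 0 = X₀ →
        ∀ t : ℝ, 0 ≤ t → Z t = X t) ∧
    ∃ S : NNReal → CamassaHolm.setG χ → CamassaHolm.setG χ,
      (∀ (X₀ : CamassaHolm.setG χ) (X : ℝ → CamassaHolm.E),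
        CamassaHolm.IsGlobalSolution χ X → X 0 = X₀ → ∀ t : NNReal, (S t X₀ : CamassaHolm.E) = X t) ∧
      (∀ X₀, S 0 X₀ = X₀) ∧
      (∀ s t X₀, S (s + t) X₀ = S s (S t X₀)) ∧
      Continuous (fun p : CamassaHolm.setG χ × NNReal => S p.2 p.1) := by
  have hu : ∀ (X₀ : CamassaHolm.IsPartitionFunction.stateG χ) (Z : ℝ → CamassaHolm.State),
      CamassaHolm.IsGlobalSolution χ (fun t => (Z t).toE) → Z 0 = X₀ →
      ∀ t : ℝ, 0 ≤ t → Z t = hχ.sol X₀ t := fun X₀ Z hZ h0 =>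
    CamassaHolm.Solves.unique hχ.lipBdd_field ((hχ.isGlobalSolution_iff Z).1 hZ)
      (hχ.solves_sol X₀) (h0.trans (hχ.sol_zero X₀).symm)
  exact ⟨fun X₀ h₀ => ⟨hχ.sol ⟨X₀, h₀⟩, (hχ.isGlobalSolution_iff _).2 (hχ.solves_sol _),
      hχ.sol_zero _, fun t ht => hχ.sol_mem _ t ht, hu ⟨X₀, h₀⟩⟩,
    hχ.semigroup, fun X₀ X hX h0 t => (hu X₀ X hX h0 t t.2).symm, hχ.semigroup_zero,
    hχ.semigroup_add, hχ.continuous_semigroup⟩
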